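/- Let $G=(V,E)$ be a connected undirected graph with $n$ vertices and nonnegative edge weights, and let $r_1,\dots,r_k\in V$ ($k\ge 1$) be required vertices. For a spanning subgraph $H$ of $G$ and $s,t\in V$, let $\sigma_H(s,t)$ be the minimum length (sum of edge weights, with multiplicity) of a walk in $H$ from $s$ to $t$ that visits all of $r_1,\dots,r_k$, with $\sigma_H(s,t)=\infty$ if there is no such walk. A group Steiner spanner of $G$ with stretch $\alpha$ (in this singleton case, where the groups are $\{r_1\},\dots,\{r_k\}$) is a spanning subgraph $H$ of $G$ with $\sigma_H(s,t)\le\alpha\,\sigma_G(s,t)$ for all $s,t\in V$. In the minimum-cost metric Hamiltonian path problem one is given a complete graph with nonnegative edge weights that satisfy the triangle inequality and two distinct vertices $s,t$, and seeks a Hamiltonian path from $s$ to $t$ of minimum total weight. A $\gamma$-approximation algorithm ($\gamma\ge 1$) outputs a Hamiltonian path from $s$ to $t$ of weight at most $\gamma$ times the minimum. **Theorem.** There is an absolute constant $C$ such that the following holds for every real $\gamma\ge 1$. If the minimum-cost metric Hamiltonian path problem has a polynomial-time $\gamma$-approximation algorithm, then there is a polynomial-time algorithm that, given $G$ with its edge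 weights, the vertices $r_1,\dots,r_k$ and a number $\varepsilon\in(0,1)$, computes a group Steiner spanner of $G$ with stretch $\gamma+\varepsilon$ and at most $C\,n/\varepsilon^2$ edges. This holds for either of the two usual meanings of polynomial time, the same one being used in the hypothesis and in the conclusion: (i) all edge weights and $\varepsilon$ are rational numbers encoded in binary, and the number of bit operations is polynomial in the length of the input; (ii) edge weights and $\varepsilon$ are arbitrary real numbers, and the number of steps of a real RAM (unit-cost addition, subtraction, multiplication, division and comparison) is polynomial in the number of input items. -/

import Mathlib

open scoped NNReal ENNReal

namespace GroupSteiner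

/-! ## Group Steiner paths, distances and spanners

A graph on the vertex type `V` is a `SimpleGraph V`, a (not necessarily simple) path is a walk, and
the nonnegative edge weights are given by a function `w : Sym2 V → ℝ≥0`, of which only the
values on edges are ever used. -/

section Graphs

variable {V ι : Type*}

/-- The length of a walk: the sum of its edge weights, with multiplicity. -/
def walkWeight (w : Sym2 V → ℝ≥0) {G : SimpleGraph V} {s t : V} (p : G.Walk s t) : ℝ≥0 :=
  (p.edges.map w).sum

/-- A walk is a group Steiner path if it contains a vertex of each group `R i`. -/
def IsGroupSteinerPath (R : ι → Set V) {G : SimpleGraph V} {s t : V} (p : G.Walk s t) : Prop :=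
  ∀ i, ∃ v ∈ p.support, v ∈ R i

/-- The group Steiner distance: the least length of a group Steiner path from `s` to `t`
(`⊤` if there is none). -/
noncomputable def groupSteinerDist (G : SimpleGraph V) (w : Sym2 V → ℝ≥0) (R : ι → Set V)
    (s t : V) : ℝ≥0∞ :=
  ⨅ (p : G.Walk s t) (_ : IsGroupSteinerPath R p), (walkWeight w p : ℝ≥0∞)

/-- `H` is a group Steiner spanner of `G` with stretch `α`: a spanning subgraph whose group Steiner
distances are at most `α` times those of `G`, for all pairs of vertices. -/
def IsGroupSteinerSpanner (G : SimpleGraph V) (w : Sym2 V → ℝ≥0) (R : ι → Set V) (α : ℝ)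
    (H : SimpleGraph V) : Prop :=
  H ≤ G ∧ ∀ s t : V,
    groupSteinerDist H w R s t ≤ ENNReal.ofReal α * groupSteinerDist G w R s t

/-- The weights of the complete graph on `V` satisfy the triangle inequality. -/
def IsMetricWeight (w : Sym2 V → ℝ≥0) : Prop :=
  ∀ a b c : V, a ≠ b → b ≠ c → a ≠ c → w s(a, c) ≤ w s(a, b) + w s(b, c)

end Graphs

/-! ## Machine model

Data are binary trees whose leaves are numbers. The programming language is a LISP-like while
language in point-free form, with an explicit step count. Numbers are treated in one of two ways:

* `binary`: all numbers in the input are rational, their size is their length in binary, and an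
  arithmetic operation is charged the length of its operands (logarithmic cost). With this cost,
  polynomial time is the same as on Turing machines.
* `realRAM`: numbers are arbitrary reals, and every arithmetic operation has unit cost. -/

/-- The two standard ways to treat numbers. -/
inductive NumModel where
  | binary
  | realRAM

/-- The numbers that may occur in an input. -/
def NumModel.numbers : NumModel → Set ℝ
  | .binary => Set.range ((↑) : ℚ → ℝ)
  | .realRAM => Set.univ

/-- The length of a rational number, written as a reduced fraction in binary. -/
def ratBits (q : ℚ) : ℕ := Nat.size q.num.natAbs + Nat.size q.den

/-- The extra size charged for a number: its length in binary, respectively nothing. (All numbers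
that occur in a computation in the model `binary` are rational.) -/
noncomputable def NumModel.bits : NumModel → ℝ → ℕ
  | .binary, x => by
      classical
      exact if h : ∃ q : ℚ, (q : ℝ) = x then ratBits h.choose else 0
  | .realRAM, _ => 0

theorem NumModel.bits_binary_ratCast (q : ℚ) : NumModel.binary.bits (q : ℝ) = ratBits q := by
  have h : ∃ q' : ℚ, (q' : ℝ) = (q : ℝ) := ⟨q, rfl⟩
  have h2 : h.choose = q := by exact_mod_cast h.choose_spec
  simp only [NumModel.bits, dif_pos h, h2]

/-- The cost of an arithmetic operation or comparison with operands `x` and `y`. -/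
noncomputable def NumModel.arithCost (M : NumModel) (x y : ℝ) : ℕ := 1 + M.bits x + M.bits y

/-- Data: binary trees with numbers at the leaves. -/
inductive Val where
  | num (x : ℝ)
  | pair (a b : Val)

/-- The size of a datum: its number of nodes plus the sizes of its numbers. -/
noncomputable def Val.size (M : NumModel) : Val → ℕ
  | .num x => 1 + M.bits x
  | .pair a b => 1 + a.size M + b.size M

/-- Programs; each denotes a partial function from data to data. -/
inductive Prog where
  | self
  | zero
  | one
  | fst
  | snd
  | isNum
  | add
  | sub
  | mul
  | div
  | le
  | pair (p q : Prog)
  | comp (q p : Prog)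
  | cond (c p q : Prog)
  | loop (c p : Prog)

/-- `Eval M P v a t`: on input `v` the program `P` halts with output `a` after `t` steps. Structural
operations take one step (data are shared, not copied); arithmetic is charged by `arithCost`. An
ill-typed operation, such as a projection of a number or a division by zero, has no result. -/
inductive Eval (M : NumModel) : Prog → Val → Val → ℕ → Prop where
  | self (v : Val) : Eval M .self v v 1
  | zero (v : Val) : Eval M .zero v (.num 0) 1
  | one (v : Val) : Eval M .one v (.num 1) 1
  | fst (a b : Val) : Eval M .fst (.pair a b) a 1
  | snd (a b : Val) : Eval M .snd (.pair a b) b 1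
  | isNum_num (x : ℝ) : Eval M .isNum (.num x) (.num 1) 1
  | isNum_pair (a b : Val) : Eval M .isNum (.pair a b) (.num 0) 1
  | add (x y : ℝ) : Eval M .add (.pair (.num x) (.num y)) (.num (x + y)) (M.arithCost x y)
  | sub (x y : ℝ) : Eval M .sub (.pair (.num x) (.num y)) (.num (x - y)) (M.arithCost x y)
  | mul (x y : ℝ) : Eval M .mul (.pair (.num x) (.num y)) (.num (x * y)) (M.arithCost x y)
  | div (x y : ℝ) (h : y ≠ 0) :
      Eval M .div (.pair (.num x) (.num y)) (.num (x / y)) (M.arithCost x y)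
  | le_true (x y : ℝ) (h : x ≤ y) :
      Eval M .le (.pair (.num x) (.num y)) (.num 1) (M.arithCost x y)
  | le_false (x y : ℝ) (h : ¬ x ≤ y) :
      Eval M .le (.pair (.num x) (.num y)) (.num 0) (M.arithCost x y)
  | pair {p q : Prog} {v a b : Val} {t u : ℕ} (hp : Eval M p v a t) (hq : Eval M q v b u) :
      Eval M (.pair p q) v (.pair a b) (t + u + 1)
  | comp {q p : Prog} {v a b : Val} {t u : ℕ} (hp : Eval M p v a t) (hq : Eval M q a b u) :
      Eval M (.comp q p) v b (t + u + 1)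
  | cond_true {c p q : Prog} {v a : Val} {x : ℝ} {t u : ℕ} (hc : Eval M c v (.num x) t)
      (hx : x ≠ 0) (hp : Eval M p v a u) : Eval M (.cond c p q) v a (t + u + 1)
  | cond_false {c p q : Prog} {v a : Val} {t u : ℕ} (hc : Eval M c v (.num 0) t)
      (hq : Eval M q v a u) : Eval M (.cond c p q) v a (t + u + 1)
  | loop_stop {c p : Prog} {v : Val} {t : ℕ} (hc : Eval M c v (.num 0) t) :
      Eval M (.loop c p) v v (t + 1)
  | loop_step {c p : Prog} {v a b : Val} {x : ℝ} {t u r : ℕ} (hc : Eval M c v (.num x) t)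
      (hx : x ≠ 0) (hp : Eval M p v a u) (hr : Eval M (.loop c p) a b r) :
      Eval M (.loop c p) v b (t + u + r + 1)

/-- On input `v` the program `P` outputs `a` within a number of steps bounded by the polynomial
`τ` in the size of `v`. -/
def ComputesInTime (M : NumModel) (P : Prog) (τ : Polynomial ℕ) (v a : Val) : Prop :=
  ∃ t : ℕ, Eval M P v a t ∧ t ≤ τ.eval (v.size M)

/-! ## Encodings of inputs and outputs -/

/-- Lists as data: `0` is the empty list, and a pair is a head with a tail. -/
def Val.ofList : List Val → Val
  | [] => .num 0
  | a :: l => .pair a (Val.ofList l)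

/-- A vertex is given by its number. -/
def encodeVertex {n : ℕ} (v : Fin n) : Val := .num ((v : ℕ) : ℝ)

/-- A list of vertices. -/
def encodeVertices {n : ℕ} (l : List (Fin n)) : Val := Val.ofList (l.map encodeVertex)

/-- A list of vertex pairs. -/
def encodeEdges {n : ℕ} (l : List (Fin n × Fin n)) : Val :=
  Val.ofList (l.map fun e => .pair (encodeVertex e.1) (encodeVertex e.2))

open Classical in
/-- A weighted graph is given by its adjacency matrix, as the list of its rows; the entry of an edge
is the pair of `1` and its weight, any other entry is the pair of `0` and `0`. -/
noncomputable def encodeGraph {n : ℕ} (G : SimpleGraph (Fin n)) (w : Sym2 (Fin n) → ℝ≥0) : Val :=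
  Val.ofList (List.ofFn fun u : Fin n => Val.ofList (List.ofFn fun v : Fin n =>
    if G.Adj u v then .pair (.num 1) (.num (w s(u, v))) else .pair (.num 0) (.num 0)))

/-- The graph with a given list of edges. -/
def graphOfEdges {n : ℕ} (l : List (Fin n × Fin n)) : SimpleGraph (Fin n) :=
  SimpleGraph.fromRel fun u v => (u, v) ∈ l

/-- All weights of edges of `G` are numbers that may occur in an input. -/
def AdmissibleWeights (M : NumModel) {n : ℕ} (G : SimpleGraph (Fin n))
    (w : Sym2 (Fin n) → ℝ≥0) : Prop :=
  ∀ e ∈ G.edgeSet, (w e : ℝ) ∈ M.numbers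

/-- An input of the minimum-cost metric Hamiltonian path problem: the weighted complete graph and
the two endvertices. -/
noncomputable def encodeHamInput {n : ℕ} (w : Sym2 (Fin n) → ℝ≥0) (s t : Fin n) : Val :=
  .pair (encodeGraph ⊤ w) (.pair (encodeVertex s) (encodeVertex t))

/-- An input of the spanner problem in the singleton case: the weighted graph, the required vertices
`r 0, …, r (k - 1)`, and the accuracy `ε`. -/
noncomputable def encodeSpannerInput {n k : ℕ} (G : SimpleGraph (Fin n))
    (w : Sym2 (Fin n) → ℝ≥0) (r : Fin k → Fin n) (ε : ℝ) : Val :=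
  .pair (encodeGraph G w) (.pair (encodeVertices (List.ofFn r)) (.num ε))

/-- There is a polynomial-time `γ`-approximation algorithm for the minimum-cost metric Hamiltonian
path problem: given a complete graph whose weights satisfy the triangle inequality and two distinct
vertices `s`, `t`, it computes a Hamiltonian path from `s` to `t` whose cost is at most `γ` times
that of any Hamiltonian path from `s` to `t`. -/
def HasPolyTimeHamPathApprox (M : NumModel) (γ : ℝ) : Prop :=
  ∃ (P : Prog) (τ : Polynomial ℕ), ∀ (n : ℕ) (w : Sym2 (Fin n) → ℝ≥0) (s t : Fin n),
    s ≠ t → IsMetricWeight w → AdmissibleWeights M ⊤ w →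
    ∃ π : (⊤ : SimpleGraph (Fin n)).Walk s t,
      ComputesInTime M P τ (encodeHamInput w s t) (encodeVertices π.support) ∧
      π.IsHamiltonian ∧
      ∀ π' : (⊤ : SimpleGraph (Fin n)).Walk s t, π'.IsHamiltonian →
        (walkWeight w π : ℝ) ≤ γ * (walkWeight w π' : ℝ)

end GroupSteiner

namespace GroupSteiner

/-! ## Polynomially bounded functions -/

/-! Let d be the graph distance. Farthest-point insertion selects m marks among the required
vertices, stopping once m ε ≥ 4 or after as many rounds as there are required vertices. The spanner
is the union of the shortest path trees of the marks and of one sparsified tour for every ordered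
pair of marks (p, q). That tour runs from p to a required vertex a, along the approximate
Hamiltonian path from a to b through all required vertices, and on to q; a and b are chosen to make
it shortest.

Stretch (`exists_walk_spanner`): let a walk of length W from s to t visit all required vertices, a
first and b last. Then W ≥ d(s,a) + h + d(b,t), where h is the weight of some Hamiltonian path of
the instance for a, b (`exists_hamiltonian_le`). If a were at distance ρ > εW/4 from every mark,
then a and the marks would be m + 1 points at pairwise distance at least ρ with m ε ≥ 4, and the
walk could not visit them all (`exists_mark_near`). So there are marks x near a and y near b. Going
from s to x in a tree, along the tour for (x, y), and from y to t in a tree costs at most d(s,a) + 2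
d(a,x) + γ h + 2 d(b,y) + d(b,t) ≤ (γ + ε) W.

Size (`ncard_spannerList_le`): a tour is a multigraph whose odd degrees are at its two ends, or
nowhere if these coincide. A spanning forest keeps its connectivity. Among the edges left over, a
second spanning forest contains a subset with the same degree parities as all of them. Together
these edges carry an Euler walk that is no longer than the tour (`exists_walk_sparsify`), so 2n
edges per pair of marks suffice. As m ε ≤ 5, the total is at most 55 n / ε².

Running time: `PolyTime` says that one program computes a family of values from an environment
within a polynomial in a fixed size parameter, and it is closed under the operations the algorithm
uses. Closure under loops and branches (`PolyTime.foldl`, `PolyTime.option_cases`) quantifies over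
all reindexings `φ` and environments `e'`, so that a loop body is written like any other expression
whose free variables are the loop variables. The numbers that get added and compared are sums of
polynomially many input numbers, or small integers, and hence have polynomial bit length
(`NumModel.bits_sum_le`). The hypothesis enters through `HasPolyTimeHamPathApprox.exists_ham`. -/

theorem polynomial_eval_mono (τ : Polynomial ℕ) {a b : ℕ} (h : a ≤ b) : τ.eval a ≤ τ.eval b := by
  simp only [Polynomial.eval_eq_sum_range]
  gcongr

/-- `f` is bounded by a polynomial in the size parameter `N`. -/
def PolyBdd {X : Type} (N f : X → ℕ) : Prop := ∃ τ : Polynomial ℕ, ∀ x, f x ≤ τ.eval (N x)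

namespace PolyBdd

variable {X Y : Type} {N f g : X → ℕ}

theorem mono (hg : PolyBdd N g) (h : ∀ x, f x ≤ g x) : PolyBdd N f :=
  hg.imp fun _ hτ x => (h x).trans (hτ x)

theorem const (c : ℕ) : PolyBdd N fun _ => c := ⟨Polynomial.C c, fun x => by simp⟩

theorem self : PolyBdd N N := ⟨Polynomial.X, fun x => by simp⟩

theorem add (hf : PolyBdd N f) (hg : PolyBdd N g) : PolyBdd N fun x => f x + g x := by
  obtain ⟨σ, hσ⟩ := hf
  obtain ⟨τ, hτ⟩ := hg
  exact ⟨σ + τ, fun x => by rw [Polynomial.eval_add]; exact add_le_add (hσ x) (hτ x)⟩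

theorem mul (hf : PolyBdd N f) (hg : PolyBdd N g) : PolyBdd N fun x => f x * g x := by
  obtain ⟨σ, hσ⟩ := hf
  obtain ⟨τ, hτ⟩ := hg
  exact ⟨σ * τ, fun x => by rw [Polynomial.eval_mul]; exact mul_le_mul' (hσ x) (hτ x)⟩

theorem eval (τ : Polynomial ℕ) (hf : PolyBdd N f) : PolyBdd N fun x => τ.eval (f x) := by
  obtain ⟨σ, hσ⟩ := hf
  exact ⟨τ.comp σ, fun x => by
    rw [Polynomial.eval_comp]; exact polynomial_eval_mono τ (hσ x)⟩

theorem reindex (hf : PolyBdd N f) (φ : Y → X) : PolyBdd (fun y => N (φ y)) fun y => f (φ y) :=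
  hf.imp fun _ hτ y => hτ (φ y)

end PolyBdd

/-! ## Polynomial-time computable functions -/

/-- Types with an encoding as data. -/
class Enc (α : Type) where
  enc : α → Val

open Enc (enc)

instance : Enc Val := ⟨id⟩
noncomputable instance : Enc ℝ≥0 := ⟨fun x => .num x⟩
noncomputable instance : Enc ℕ := ⟨fun x => .num x⟩
noncomputable instance {n : ℕ} : Enc (Fin n) := ⟨encodeVertex⟩
noncomputable instance : Enc Bool := ⟨fun b => if b then .num 1 else .num 0⟩
instance {α β : Type} [Enc α] [Enc β] : Enc (α × β) := ⟨fun x => .pair (enc x.1) (enc x.2)⟩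
instance {α : Type} [Enc α] : Enc (List α) := ⟨fun l => Val.ofList (l.map enc)⟩
-- The padding zero makes a present value a pair even when the value itself is a number, so that
-- `isNum` tells the two cases apart.
noncomputable instance {α : Type} [Enc α] : Enc (Option α) :=
  ⟨fun o => o.elim (.num 0) fun a => .pair (enc a) (.num 0)⟩
/-- A function on `Fin n` is encoded by its table. -/
noncomputable instance {n : ℕ} {α : Type} [Enc α] : Enc (Fin n → α) :=
  ⟨fun f => enc ((List.finRange n).map fun i => (i, f i))⟩

/-- One program computes all `f x` from the data `e x`, in time polynomial in `N x`. -/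
def PolyTime (M : NumModel) {X : Type} (N : X → ℕ) (e : X → Val) {A : X → Type}
    [∀ x, Enc (A x)] (f : ∀ x, A x) : Prop :=
  ∃ (P : Prog) (T : X → ℕ), PolyBdd N T ∧ ∀ x, ∃ t ≤ T x, Eval M P (e x) (enc (f x)) t

namespace PolyTime

variable {M : NumModel} {X Y : Type} {N : X → ℕ} {e : X → Val} {A B C : X → Type}
  [∀ x, Enc (A x)] [∀ x, Enc (B x)] [∀ x, Enc (C x)]

theorem of_const_steps {f : ∀ x, A x} (P : Prog) (c : ℕ)
    (h : ∀ x, ∃ t ≤ c, Eval M P (e x) (enc (f x)) t) : PolyTime M N e f :=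
  ⟨P, fun _ => c, .const c, h⟩

/-- The time of the second program is measured in `N x` and not in the size of its actual input `f
x`. Hence intermediate results need no size bounds. -/
theorem comp {f : ∀ x, A x} {g : ∀ x, B x} (hf : PolyTime M N e f)
    (hg : PolyTime M N (fun x => enc (f x)) g) : PolyTime M N e g := by
  obtain ⟨P, T, hT, hP⟩ := hf
  obtain ⟨Q, U, hU, hQ⟩ := hg
  refine ⟨.comp Q P, fun x => T x + U x + 1, (hT.add hU).add (.const 1), fun x => ?_⟩
  obtain ⟨t, ht, h1⟩ := hP x
  obtain ⟨u, hu, h2⟩ := hQ x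
  exact ⟨_, by dsimp only; omega, .comp h1 h2⟩

/-- Only the data matter: a value may be replaced, at no cost, by a value of another type with the
same encoding. -/
theorem congr_enc {f : ∀ x, A x} {g : ∀ x, B x} (hf : PolyTime M N e f)
    (h : ∀ x, enc (f x) = enc (g x)) : PolyTime M N e g := by
  obtain ⟨P, T, hT, hP⟩ := hf
  exact ⟨P, T, hT, fun x => h x ▸ hP x⟩

theorem congr {f g : ∀ x, A x} (hf : PolyTime M N e f) (h : ∀ x, f x = g x) :
    PolyTime M N e g := hf.congr_enc fun x => by rw [h x]

theorem reindex {f : ∀ x, A x} (hf : PolyTime M N e f) (φ : Y → X) :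
    PolyTime M (fun y => N (φ y)) (fun y => e (φ y)) (fun y => f (φ y)) := by
  obtain ⟨P, T, hT, hP⟩ := hf
  exact ⟨P, _, hT.reindex φ, fun y => hP (φ y)⟩

/-- Inside a loop body or branch the environment has grown. Whatever was computable from the old
environment stays computable as long as the old one can be recovered from the new one. -/
theorem lift {f : ∀ x, A x} (hf : PolyTime M N e f) {φ : Y → X} {e' : Y → Val}
    (he : PolyTime M (fun y => N (φ y)) e' (fun y => e (φ y))) :
    PolyTime M (fun y => N (φ y)) e' (fun y => f (φ y)) :=
  he.comp (hf.reindex φ)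

theorem env : PolyTime M N e e := of_const_steps .self 1 fun _ => ⟨1, le_rfl, .self _⟩

theorem pair {f : ∀ x, A x} {g : ∀ x, B x} (hf : PolyTime M N e f) (hg : PolyTime M N e g) :
    PolyTime M N e (fun x => (f x, g x)) := by
  obtain ⟨P, T, hT, hP⟩ := hf
  obtain ⟨Q, U, hU, hQ⟩ := hg
  refine ⟨.pair P Q, fun x => T x + U x + 1, (hT.add hU).add (.const 1), fun x => ?_⟩
  obtain ⟨t, ht, h1⟩ := hP x
  obtain ⟨u, hu, h2⟩ := hQ x
  exact ⟨_, by dsimp only; omega, .pair h1 h2⟩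

theorem fst {f : ∀ x, A x × B x} (hf : PolyTime M N e f) : PolyTime M N e (fun x => (f x).1) :=
  hf.comp (of_const_steps .fst 1 fun _ => ⟨1, le_rfl, .fst _ _⟩)

theorem snd {f : ∀ x, A x × B x} (hf : PolyTime M N e f) : PolyTime M N e (fun x => (f x).2) :=
  hf.comp (of_const_steps .snd 1 fun _ => ⟨1, le_rfl, .snd _ _⟩)

theorem num_zero : PolyTime M N e (fun _ => Val.num 0) :=
  of_const_steps .zero 1 fun _ => ⟨1, le_rfl, .zero _⟩

theorem num_one : PolyTime M N e (fun _ => Val.num 1) :=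
  of_const_steps .one 1 fun _ => ⟨1, le_rfl, .one _⟩

theorem zero_nat : PolyTime M N e (fun _ => (0 : ℕ)) := num_zero.congr_enc fun _ => by simp [enc]
theorem one_nat : PolyTime M N e (fun _ => (1 : ℕ)) := num_one.congr_enc fun _ => by simp [enc]
theorem zero_nnreal : PolyTime M N e (fun _ => (0 : ℝ≥0)) :=
  num_zero.congr_enc fun _ => by simp [enc]
theorem one_nnreal : PolyTime M N e (fun _ => (1 : ℝ≥0)) :=
  num_one.congr_enc fun _ => by simp [enc]
theorem bool_false : PolyTime M N e (fun _ => false) := num_zero.congr_enc fun _ => by simp [enc]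
theorem nil : PolyTime M N e (fun x => ([] : List (A x))) := num_zero.congr_enc fun _ => rfl
theorem none : PolyTime M N e (fun x => (.none : Option (A x))) := num_zero.congr_enc fun _ => rfl

theorem cons {a : ∀ x, A x} {l : ∀ x, List (A x)} (ha : PolyTime M N e a)
    (hl : PolyTime M N e l) : PolyTime M N e (fun x => a x :: l x) :=
  (ha.pair hl).congr_enc fun _ => rfl

theorem some {a : ∀ x, A x} (ha : PolyTime M N e a) : PolyTime M N e (fun x => Option.some (a x)) :=
  (ha.pair num_zero).congr_enc fun _ => rfl

/-- The case distinction, where each branch may use the outcome of the test. -/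
theorem ite_of {p : X → Prop} [∀ x, Decidable (p x)] {f g : ∀ x, A x}
    (hp : PolyTime M N e (fun x => decide (p x)))
    (hf : PolyTime M (fun y : {x // p x} => N y.1) (fun y => e y.1) (fun y => f y.1))
    (hg : PolyTime M (fun y : {x // ¬ p x} => N y.1) (fun y => e y.1) (fun y => g y.1)) :
    PolyTime M N e (fun x => if p x then f x else g x) := by
  obtain ⟨R, S, ⟨ρ, hS⟩, hR⟩ := hp
  obtain ⟨P, T, ⟨σ, hT⟩, hP⟩ := hf
  obtain ⟨Q, U, ⟨τ, hU⟩, hQ⟩ := hg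
  -- The branch bounds `T` and `U` are defined on subtypes only, so the common bound is formed from
  -- their polynomials.
  refine ⟨.cond R P Q, fun x => ρ.eval (N x) + (σ.eval (N x) + τ.eval (N x)) + 1,
    ⟨ρ + (σ + τ) + 1, fun x => by simp⟩, fun x => ?_⟩
  obtain ⟨s, hs, h0⟩ := hR x
  have := hS x
  by_cases h : p x
  · obtain ⟨t, ht, h1⟩ := hP ⟨x, h⟩
    have := hT ⟨x, h⟩
    simp only at this
    refine ⟨s + t + 1, by dsimp only; omega, ?_⟩
    dsimp only
    rw [if_pos h]
    simp only [enc, decide_eq_true h, if_true] at h0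
    exact .cond_true h0 one_ne_zero h1
  · obtain ⟨t, ht, h1⟩ := hQ ⟨x, h⟩
    have := hU ⟨x, h⟩
    simp only at this
    refine ⟨s + t + 1, by dsimp only; omega, ?_⟩
    dsimp only
    rw [if_neg h]
    simp only [enc, decide_eq_false h, Bool.false_eq_true, if_false] at h0
    exact .cond_false h0 h1

theorem ite {p : X → Prop} [∀ x, Decidable (p x)] {f g : ∀ x, A x}
    (hp : PolyTime M N e (fun x => decide (p x)))
    (hf : PolyTime M N e f) (hg : PolyTime M N e g) :
    PolyTime M N e (fun x => if p x then f x else g x) :=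
  ite_of hp (hf.reindex _) (hg.reindex _)

theorem and {p q : X → Prop} [∀ x, Decidable (p x)] [∀ x, Decidable (q x)]
    [∀ x, Decidable (p x ∧ q x)]
    (hp : PolyTime M N e (fun x => decide (p x))) (hq : PolyTime M N e (fun x => decide (q x))) :
    PolyTime M N e (fun x => decide (p x ∧ q x)) :=
  (ite hp hq bool_false).congr fun x => by by_cases h : p x <;> simp [h]

theorem of_iff {p q : X → Prop} [∀ x, Decidable (p x)] [∀ x, Decidable (q x)]
    (hp : PolyTime M N e (fun x => decide (p x))) (h : ∀ x, p x ↔ q x) :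
    PolyTime M N e (fun x => decide (q x)) :=
  hp.congr fun x => by simp [h x]

theorem isSome {o : ∀ x, Option (A x)} (ho : PolyTime M N e o) :
    PolyTime M N e (fun x => (o x).isSome) := by
  refine ho.comp (of_const_steps (.cond .isNum .zero .one) 3 fun x => ?_)
  cases h : o x
  · exact ⟨3, le_rfl, .cond_true (.isNum_num _) one_ne_zero (.zero _)⟩
  · exact ⟨3, le_rfl, .cond_false (.isNum_pair _ _) (.one _)⟩

/-- Case distinction on an optional value. -/
theorem option_cases {o : ∀ x, Option (A x)} {g : ∀ x, Option (A x) → B x}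
    (ho : PolyTime M N e o)
    (hnone : ∀ (Y : Type) (φ : Y → X) (e' : Y → Val), (∀ y, o (φ y) = .none) →
      PolyTime M (fun y => N (φ y)) e' (fun y => e (φ y)) →
      PolyTime M (fun y => N (φ y)) e' (fun y => g (φ y) .none))
    (hsome : ∀ (Y : Type) (φ : Y → X) (e' : Y → Val) (a : ∀ y, A (φ y)),
      (∀ y, o (φ y) = .some (a y)) →
      PolyTime M (fun y => N (φ y)) e' (fun y => e (φ y)) →
      PolyTime M (fun y => N (φ y)) e' a →
      PolyTime M (fun y => N (φ y)) e' (fun y => g (φ y) (.some (a y)))) :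
    PolyTime M N e (fun x => g x (o x)) := by
  -- Both branches return the same expression; the test serves only to make the shape of `o x` known
  -- in each of them.
  have key : PolyTime M N e
      (fun x => if (o x).isSome = true then g x (o x) else g x (o x)) := by
    refine ite_of (ho.isSome.congr fun x => by simp) ?_ ?_
    · have h := hsome {x // (o x).isSome = true} Subtype.val (fun y => e y.1)
        (fun y => (o y.1).get y.2) (fun y => by simp) env ?_
      · exact h.congr fun y => by simp
      · refine (ho.reindex _).comp (of_const_steps .fst 1 fun y => ⟨1, le_rfl, ?_⟩)
        obtain ⟨x, hx⟩ := y
        obtain ⟨a, ha⟩ := Option.isSome_iff_exists.1 hx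
        simp only [ha, Option.get_some]
        exact .fst _ _
    · have h (y : {x // ¬ (o x).isSome = true}) : o y.1 = .none := by simpa using y.2
      exact (hnone _ Subtype.val (fun y => e y.1) h env).congr fun y => by rw [h y]
  exact key.congr fun x => by simp

theorem head? {l : ∀ x, List (A x)} (hl : PolyTime M N e l) :
    PolyTime M N e (fun x => (l x).head?) := by
  refine hl.comp (of_const_steps (.cond .isNum .zero (.pair .fst .zero)) 5 fun x => ?_)
  cases h : l x
  · exact ⟨3, by omega, .cond_true (.isNum_num _) one_ne_zero (.zero _)⟩
  · exact ⟨5, le_rfl, .cond_false (.isNum_pair _ _) (.pair (.fst _ _) (.zero _))⟩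

/-! ### Loops -/

/-- The loop that folds the step `P` over a list; the state consists of the environment, the rest of
the list, and the accumulator. -/
def foldLoop (P : Prog) : Prog :=
  .loop (.comp (.cond .isNum .zero .one) (.comp .fst .snd))
    (.pair .fst (.pair (.comp .snd (.comp .fst .snd))
      (.comp P (.pair .fst (.pair (.comp .snd .snd) (.comp .fst (.comp .fst .snd)))))))

/-- Induction on the rest of the list. The constants 40 and 20 generously cover the test and the
rebuilding of the loop state; the invariant may depend on the number of rounds done. -/
theorem eval_foldLoop {M : NumModel} {α β : Type} [Enc α] [Enc β] {v : Val} {P : Prog} {T : ℕ}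
    (step : β → α → β) (Inv : ℕ → β → Prop) (l : List α)
    (h : ∀ i b a, i < l.length → a ∈ l → Inv i b → Inv (i + 1) (step b a) ∧
      ∃ t ≤ T, Eval M P (.pair v (.pair (enc b) (enc a))) (enc (step b a)) t)
    (l' : List α) (i : ℕ) (b : β) (hsub : ∀ a ∈ l', a ∈ l) (hi : i + l'.length = l.length)
    (hb : Inv i b) :
    ∃ t ≤ l'.length * (T + 40) + 20,
      Eval M (foldLoop P)
        (.pair v (.pair (enc l') (enc b)))
        (.pair v (.pair (.num 0) (enc (l'.foldl step b)))) t := by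
  induction l' generalizing i b with
  | nil =>
    exact ⟨_, by omega, Eval.loop_stop (.comp (.comp (.snd _ _) (.fst _ _))
      (.cond_true (.isNum_num _) one_ne_zero (.zero _)))⟩
  | cons a l' ih =>
    simp only [List.length_cons] at hi
    obtain ⟨hinv, t, ht, hP⟩ := h i b a (by omega) (hsub a (by simp)) hb
    obtain ⟨u, hu, hr⟩ := ih (i + 1) (step b a) (fun c hc => hsub c (by simp [hc])) (by omega) hinv
    refine ⟨_, ?_, .loop_step (x := 1) (.comp (.comp (.snd _ _) (.fst _ _))
      (.cond_false (.isNum_pair _ _) (.one _))) one_ne_zero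
      (.pair (.fst _ _) (.pair (.comp (.comp (.snd _ _) (.fst _ _)) (.snd _ _))
        (.comp (.pair (.fst _ _) (.pair (.comp (.snd _ _) (.snd _ _))
          (.comp (.comp (.snd _ _) (.fst _ _)) (.fst _ _)))) hP))) hr⟩
    simp only [List.length_cons]
    have : (l'.length + 1) * (T + 40) = l'.length * (T + 40) + (T + 40) := by ring
    omega

/-- Folding over a list of polynomial length, with an invariant of the accumulator. -/
theorem foldl {l : ∀ x, List (A x)} {b : ∀ x, B x} {step : ∀ x, B x → A x → B x}
    (Inv : ∀ x, ℕ → B x → Prop)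
    (hl : PolyTime M N e l) (hb : PolyTime M N e b) (hlen : PolyBdd N fun x => (l x).length)
    (h0 : ∀ x, Inv x 0 (b x))
    (hstep : ∀ x i b a, i < (l x).length → a ∈ l x → Inv x i b → Inv x (i + 1) (step x b a))
    (hc : ∀ (Y : Type) (φ : Y → X) (e' : Y → Val) (i : Y → ℕ) (b' : ∀ y, B (φ y))
      (a : ∀ y, A (φ y)), (∀ y, i y < (l (φ y)).length) → (∀ y, a y ∈ l (φ y)) →
      (∀ y, Inv (φ y) (i y) (b' y)) →
      PolyTime M (fun y => N (φ y)) e' (fun y => e (φ y)) →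
      PolyTime M (fun y => N (φ y)) e' b' → PolyTime M (fun y => N (φ y)) e' a →
      PolyTime M (fun y => N (φ y)) e' (fun y => step (φ y) (b' y) (a y))) :
    PolyTime M N e (fun x => (l x).foldl (step x) (b x)) := by
  -- The body is instantiated on the type of all loop states that satisfy the invariant. This gives
  -- one program for every round, and its time is bounded by a polynomial in `N x` uniformly over
  -- the states above `x`.
  obtain ⟨P, T, ⟨τ, hT⟩, hP⟩ := hc
    {y : Σ x, ℕ × B x × A x // y.2.1 < (l y.1).length ∧ y.2.2.2 ∈ l y.1 ∧ Inv y.1 y.2.1 y.2.2.1}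
    (·.1.1) (fun y => .pair (e y.1.1) (.pair (enc y.1.2.2.1) (enc y.1.2.2.2)))
    (·.1.2.1) (·.1.2.2.1) (·.1.2.2.2) (fun y => y.2.1) (fun y => y.2.2.1) (fun y => y.2.2.2)
    (of_const_steps .fst 1 fun _ => ⟨1, le_rfl, .fst _ _⟩)
    (of_const_steps (.comp .fst .snd) 3 fun _ => ⟨3, le_rfl, .comp (.snd _ _) (.fst _ _)⟩)
    (of_const_steps (.comp .snd .snd) 3 fun _ => ⟨3, le_rfl, .comp (.snd _ _) (.snd _ _)⟩)
  refine (PolyTime.pair (env (N := N) (e := e)) (hl.pair hb)).comp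
    (B := B) ⟨.comp (.comp .snd .snd) (foldLoop P),
      fun x => (l x).length * (τ.eval (N x) + 40) + 30,
      (hlen.mul ((PolyBdd.eval τ .self).add (.const 40))).add (.const 30), fun x => ?_⟩
  obtain ⟨t, ht, hE⟩ := eval_foldLoop (M := M) (v := e x) (P := P) (T := τ.eval (N x)) (step x)
    (Inv x) (l x) (fun i b a hi ha hb => ⟨hstep x i b a hi ha hb, by
      obtain ⟨t, ht, hE⟩ := hP ⟨⟨x, i, b, a⟩, hi, ha, hb⟩
      exact ⟨t, ht.trans (hT _), hE⟩⟩) (l x) 0 (b x) (fun _ h => h) (by simp) (h0 x)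
  exact ⟨_, by dsimp only; omega, .comp hE (.comp (.snd _ _) (.snd _ _))⟩

theorem reverse {l : ∀ x, List (A x)} (hl : PolyTime M N e l)
    (hlen : PolyBdd N fun x => (l x).length) : PolyTime M N e (fun x => (l x).reverse) :=
  (foldl (b := fun x => ([] : List (A x))) (step := fun _ acc a => a :: acc) (fun _ _ _ => True)
    hl nil hlen (fun _ => trivial) (fun _ _ _ _ _ _ _ => trivial)
    (fun _ _ _ _ _ _ _ _ _ _ hb ha => ha.cons hb)).congr fun x => by simp

theorem append {l l' : ∀ x, List (A x)} (hl : PolyTime M N e l) (hl' : PolyTime M N e l')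
    (hlen : PolyBdd N fun x => (l x).length) : PolyTime M N e (fun x => l x ++ l' x) :=
  (foldl (l := fun x => (l x).reverse) (b := l') (step := fun _ acc a => a :: acc)
    (fun _ _ _ => True)
    (hl.reverse hlen) hl' (hlen.mono fun _ => by simp) (fun _ => trivial)
    (fun _ _ _ _ _ _ _ => trivial)
    (fun _ _ _ _ _ _ _ _ _ _ hb ha => ha.cons hb)).congr fun x => by simp

theorem map {l : ∀ x, List (A x)} {f : ∀ x, A x → B x} (hl : PolyTime M N e l)
    (hlen : PolyBdd N fun x => (l x).length)
    (hf : ∀ (Y : Type) (φ : Y → X) (e' : Y → Val) (a : ∀ y, A (φ y)), (∀ y, a y ∈ l (φ y)) →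
      PolyTime M (fun y => N (φ y)) e' (fun y => e (φ y)) →
      PolyTime M (fun y => N (φ y)) e' a →
      PolyTime M (fun y => N (φ y)) e' (fun y => f (φ y) (a y))) :
    PolyTime M N e (fun x => (l x).map (f x)) := by
  have h := foldl (b := fun x => ([] : List (B x))) (step := fun x acc a => f x a :: acc)
    (fun _ _ _ => True)
    hl nil hlen (fun _ => trivial) (fun _ _ _ _ _ _ _ => trivial)
    (fun Y φ e' _ _ a _ hmem _ he hb ha => (hf Y φ e' a hmem he ha).cons hb)
  have h2 (x) : (l x).foldl (fun acc a => f x a :: acc) [] = ((l x).map (f x)).reverse := by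
    rw [← List.foldl_map (f := f x) (g := fun acc b => b :: acc)]; simp
  exact ((h.congr h2).reverse (hlen.mono fun _ => by simp)).congr fun x => by simp

/-- The length bound in `hf` pays for the append in each round. Folding over the reversed list
allows each piece to be put in front. -/
theorem flatMap {l : ∀ x, List (A x)} {f : ∀ x, A x → List (B x)} (hl : PolyTime M N e l)
    (hlen : PolyBdd N fun x => (l x).length)
    (hf : ∀ (Y : Type) (φ : Y → X) (e' : Y → Val) (a : ∀ y, A (φ y)), (∀ y, a y ∈ l (φ y)) →
      PolyTime M (fun y => N (φ y)) e' (fun y => e (φ y)) →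
      PolyTime M (fun y => N (φ y)) e' a →
      PolyTime M (fun y => N (φ y)) e' (fun y => f (φ y) (a y)) ∧
      PolyBdd (fun y => N (φ y)) (fun y => (f (φ y) (a y)).length)) :
    PolyTime M N e (fun x => (l x).flatMap (f x)) := by
  have h := foldl (l := fun x => (l x).reverse) (b := fun x => ([] : List (B x)))
    (step := fun x acc a => f x a ++ acc)
    (fun _ _ _ => True)
    (hl.reverse hlen) nil (hlen.mono fun _ => by simp)
    (fun _ => trivial) (fun _ _ _ _ _ _ _ => trivial)
    (fun Y φ e' _ _ a _ hmem _ he hb ha =>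
      have h := hf Y φ e' a (fun y => by simpa using hmem y) he ha
      h.1.append hb h.2)
  refine h.congr fun x => ?_
  rw [List.foldl_reverse]
  induction l x with
  | nil => rfl
  | cons a l ih => simp [List.flatMap_cons, ih]

end PolyTime

/-! ## Bit lengths -/

/-- Reduction to lowest terms only shrinks numerator and denominator. The extra 1 covers `b = 0`,
where the quotient is 0 with denominator 1. -/
theorem ratBits_div_le (a b : ℕ) : ratBits ((a : ℚ) / b) ≤ Nat.size a + Nat.size b + 1 := by
  rcases Nat.eq_zero_or_pos b with rfl | hb
  · simp [ratBits]
  have h : ((a : ℚ) / b) = Rat.divInt a b := by simp [Rat.divInt_eq_div]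
  have h1 : (Rat.divInt a b).num.natAbs ≤ a := by
    rcases Nat.eq_zero_or_pos a with rfl | ha
    · simp
    · have := Rat.num_dvd (a : ℤ) (b := (b : ℤ)) (by omega)
      exact Nat.le_of_dvd ha (by simpa using Int.natAbs_dvd_natAbs.2 this)
  have h2 : (Rat.divInt a b).den ≤ b :=
    Nat.le_of_dvd hb (by exact_mod_cast Rat.den_dvd a b)
  rw [ratBits, h]
  have := Nat.size_le_size h1
  have := Nat.size_le_size h2
  omega

theorem NumModel.bits_div_le (M : NumModel) (a b : ℕ) :
    M.bits ((a : ℝ) / b) ≤ Nat.size a + Nat.size b + 1 := by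
  cases M with
  | binary =>
    have := NumModel.bits_binary_ratCast ((a : ℚ) / b)
    push_cast at this
    rw [this]
    exact ratBits_div_le a b
  | realRAM => exact Nat.zero_le _

theorem natSize_le_self (a : ℕ) : Nat.size a ≤ a := Nat.size_le.2 a.lt_two_pow_self

theorem NumModel.bits_natCast_le (M : NumModel) (a : ℕ) : M.bits (a : ℝ) ≤ a + 2 := by
  have h := M.bits_div_le a 1
  rw [Nat.cast_one, div_one] at h
  have := natSize_le_self a
  simp only [Nat.size_one] at h
  omega

/-- Over the product of the denominators, which is at most `2 ^ (l.length * B)`, the sum has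
numerator at most `l.length * 2 ^ (l.length * B)`. This keeps all path lengths polynomially long in
the binary model. -/
theorem NumModel.bits_sum_le (M : NumModel) (B : ℕ) (l : List ℝ≥0)
    (h : ∀ x ∈ l, (x : ℝ) ∈ M.numbers ∧ M.bits x ≤ B) :
    (l.sum : ℝ) ∈ M.numbers ∧ M.bits (l.sum : ℝ) ≤ l.length * (2 * B + 1) + 2 := by
  cases M with
  | realRAM => exact ⟨trivial, Nat.zero_le _⟩
  | binary =>
    have key : ∃ a b : ℕ, ((l.sum : ℝ≥0) : ℝ) = a / b ∧ 0 < b ∧ a ≤ l.length * 2 ^ (l.length * B) ∧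
        b ≤ 2 ^ (l.length * B) := by
      induction l with
      | nil => exact ⟨0, 1, by simp⟩
      | cons x l ih =>
        obtain ⟨a, b, hs, hb, ha1, hb1⟩ := ih fun y hy => h y (by simp [hy])
        obtain ⟨⟨q, hq⟩, hB⟩ := h x (by simp)
        rw [← hq, NumModel.bits_binary_ratCast, ratBits] at hB
        have hq0 : 0 ≤ q := by
          have : (0 : ℝ) ≤ q := hq ▸ x.2
          exact_mod_cast this
        have hnum : q.num.natAbs ≤ 2 ^ B := (Nat.size_le.1 (by omega : Nat.size _ ≤ B)).le
        have hden : q.den ≤ 2 ^ B := (Nat.size_le.1 (by omega : Nat.size _ ≤ B)).le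
        refine ⟨q.num.natAbs * b + a * q.den, q.den * b, ?_, Nat.mul_pos q.den_pos hb, ?_, ?_⟩
        · have hx : (x : ℝ) = q.num.natAbs / q.den := by
            rw [← hq]
            have h1 : ((q.num.natAbs : ℕ) : ℤ) = q.num :=
              Int.natAbs_of_nonneg (Rat.num_nonneg.2 hq0)
            have h2 : ((q.num.natAbs : ℕ) : ℝ) = (q.num : ℝ) := by
              rw [← Int.cast_natCast, h1]
            rw [h2, Rat.cast_def]
          have hbr : (b : ℝ) ≠ 0 := by positivity
          have hdr : (q.den : ℝ) ≠ 0 := by simp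
          rw [List.sum_cons, NNReal.coe_add, hs, hx]
          push_cast
          field_simp
        · calc q.num.natAbs * b + a * q.den
              ≤ 2 ^ B * 2 ^ (l.length * B) + l.length * 2 ^ (l.length * B) * 2 ^ B := by gcongr
            _ = (x :: l).length * 2 ^ ((x :: l).length * B) := by
              rw [List.length_cons]; ring
        · calc q.den * b ≤ 2 ^ B * 2 ^ (l.length * B) := by gcongr
            _ = 2 ^ ((x :: l).length * B) := by
              rw [List.length_cons, add_mul, pow_add, one_mul]; ring
    obtain ⟨a, b, hs, hb, ha1, hb1⟩ := key
    rw [hs]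
    refine ⟨⟨(a : ℚ) / b, by push_cast; rfl⟩, (NumModel.bits_div_le _ a b).trans ?_⟩
    have h1 : Nat.size a ≤ l.length + l.length * B := Nat.size_le.2 <| ha1.trans_lt <| by
      rw [pow_add]; gcongr; exact Nat.lt_two_pow_self
    have h2 : Nat.size b ≤ l.length * B + 1 := Nat.size_le.2 <| hb1.trans_lt <|
      Nat.pow_lt_pow_right (by norm_num) (Nat.lt_succ_self _)
    have : l.length * (2 * B + 1) = l.length * B + l.length * B + l.length := by ring
    omega

namespace PolyTime

variable {M : NumModel} {X Y : Type} {N : X → ℕ} {e : X → Val} {A B C : X → Type}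
  [∀ x, Enc (A x)] [∀ x, Enc (B x)] [∀ x, Enc (C x)]

/-! ### Arithmetic -/

theorem nnreal_add {a b : X → ℝ≥0} (ha : PolyTime M N e a) (hb : PolyTime M N e b)
    (ha' : PolyBdd N fun x => M.bits (a x)) (hb' : PolyBdd N fun x => M.bits (b x)) :
    PolyTime M N e (fun x => a x + b x) := by
  refine (ha.pair hb).comp (B := fun _ => ℝ≥0)
    ⟨.add, fun x => M.arithCost (a x) (b x), ((PolyBdd.const 1).add ha').add hb', fun x => ?_⟩
  refine ⟨_, le_rfl, ?_⟩
  simp only [enc, NNReal.coe_add]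
  exact .add _ _

theorem nnreal_le {a b : X → ℝ≥0} [∀ x, Decidable (a x ≤ b x)]
    (ha : PolyTime M N e a) (hb : PolyTime M N e b)
    (ha' : PolyBdd N fun x => M.bits (a x)) (hb' : PolyBdd N fun x => M.bits (b x)) :
    PolyTime M N e (fun x => decide (a x ≤ b x)) := by
  refine (ha.pair hb).comp (B := fun _ => Bool)
    ⟨.le, fun x => M.arithCost (a x) (b x), ((PolyBdd.const 1).add ha').add hb', fun x => ?_⟩
  refine ⟨_, le_rfl, ?_⟩
  by_cases h : a x ≤ b x
  · simp only [enc, h, decide_true, if_true]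
    exact .le_true _ _ h
  · simp only [enc, h, decide_false, Bool.false_eq_true, if_false]
    exact .le_false _ _ h

theorem bits_natCast {a : X → ℕ} (ha : PolyBdd N a) :
    PolyBdd N fun x => M.bits ((a x : ℝ≥0) : ℝ) :=
  (ha.add (.const 2)).mono fun x => by simpa using M.bits_natCast_le (a x)

theorem nat_cast {a : X → ℕ} (ha : PolyTime M N e a) : PolyTime M N e (fun x => (a x : ℝ≥0)) :=
  ha.congr_enc fun x => by simp [enc]

theorem nat_add {a b : X → ℕ} (ha : PolyTime M N e a) (hb : PolyTime M N e b)
    (ha' : PolyBdd N a) (hb' : PolyBdd N b) : PolyTime M N e (fun x => a x + b x) :=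
  (nnreal_add ha.nat_cast hb.nat_cast (bits_natCast ha') (bits_natCast hb')).congr_enc
    fun x => by simp [enc]

theorem nat_le {a b : X → ℕ} [∀ x, Decidable (a x ≤ b x)]
    (ha : PolyTime M N e a) (hb : PolyTime M N e b)
    (ha' : PolyBdd N a) (hb' : PolyBdd N b) : PolyTime M N e (fun x => decide (a x ≤ b x)) :=
  (nnreal_le ha.nat_cast hb.nat_cast (bits_natCast ha') (bits_natCast hb')).congr
    fun x => by simp

theorem nat_const (c : ℕ) : PolyTime M N e (fun _ => c) := by
  induction c with
  | zero => exact zero_nat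
  | succ c ih => exact ih.nat_add one_nat (.const _) (.const _)

theorem fin_val {n : X → ℕ} {u : ∀ x, Fin (n x)} (hu : PolyTime M N e u) :
    PolyTime M N e (fun x => (u x : ℕ)) := hu.congr_enc fun _ => rfl

theorem fin_eq {n : X → ℕ} {u v : ∀ x, Fin (n x)} [∀ x, Decidable (u x = v x)]
    (hn : PolyBdd N n) (hu : PolyTime M N e u) (hv : PolyTime M N e v) :
    PolyTime M N e (fun x => decide (u x = v x)) := by
  have hu' : PolyBdd N fun x => (u x : ℕ) := hn.mono fun x => (u x).2.le
  have hv' : PolyBdd N fun x => (v x : ℕ) := hn.mono fun x => (v x).2.le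
  exact ((nat_le hu.fin_val hv.fin_val hu' hv').and (nat_le hv.fin_val hu.fin_val hv' hu')).of_iff
    fun x => by rw [← le_antisymm_iff, Fin.ext_iff]

/-! ### Tables -/

variable {n : X → ℕ}

theorem table {f : ∀ x, Fin (n x) → A x} (hf : PolyTime M N e f) :
    PolyTime M N e (fun x => (List.finRange (n x)).map fun i => (i, f x i)) :=
  hf.congr_enc fun _ => rfl

theorem of_table {f : ∀ x, Fin (n x) → A x}
    (hf : PolyTime M N e (fun x => (List.finRange (n x)).map fun i => (i, f x i))) :
    PolyTime M N e f := hf.congr_enc fun _ => rfl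

theorem finRange {f : ∀ x, Fin (n x) → A x} (hf : PolyTime M N e f) (hn : PolyBdd N n) :
    PolyTime M N e (fun x => List.finRange (n x)) :=
  (hf.table.map (f := fun _ p => p.1) (hn.mono fun _ => by simp)
    fun _ _ _ _ _ _ ha => ha.fst).congr fun x => by simp [Function.comp_def]

theorem tabulate {f : ∀ x, Fin (n x) → A x} (hn : PolyBdd N n)
    (hr : PolyTime M N e (fun x => List.finRange (n x)))
    (hf : ∀ (Y : Type) (φ : Y → X) (e' : Y → Val) (i : ∀ y, Fin (n (φ y))),
      PolyTime M (fun y => N (φ y)) e' (fun y => e (φ y)) →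
      PolyTime M (fun y => N (φ y)) e' i →
      PolyTime M (fun y => N (φ y)) e' (fun y => f (φ y) (i y))) :
    PolyTime M N e f :=
  of_table <| hr.map (f := fun x i => (i, f x i)) (hn.mono fun _ => by simp)
    fun Y φ e' i _ he hi => hi.pair (hf Y φ e' i he hi)

/-- A linear scan of the table. The accumulator is raw data, because `A x` need not offer a value to
start from. -/
theorem apply {f : ∀ x, Fin (n x) → A x} {u : ∀ x, Fin (n x)} (hn : PolyBdd N n)
    (hf : PolyTime M N e f) (hu : PolyTime M N e u) : PolyTime M N e (fun x => f x (u x)) := by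
  have h := foldl (l := fun x => (List.finRange (n x)).map fun i => (i, f x i))
    (b := fun _ => Val.num 0) (step := fun x v p => if p.1 = u x then enc p.2 else v)
    (fun _ _ _ => True)
    hf.table num_zero (hn.mono fun _ => by simp) (fun _ => trivial) (fun _ _ _ _ _ _ _ => trivial)
    (fun Y φ e' _ v p _ _ _ he hv hp =>
      ite (fin_eq (hn.reindex φ) hp.fst (hu.lift he)) (hp.snd.congr_enc fun _ => rfl) hv)
  refine h.congr_enc fun x => ?_
  rw [List.foldl_map]
  have key (l : List (Fin (n x))) (v : Val) :
      l.foldl (fun v i => if i = u x then enc (f x i) else v) v =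
        if u x ∈ l then enc (f x (u x)) else v := by
    induction l generalizing v with
    | nil => rfl
    | cons i l ih =>
      rw [List.foldl_cons, ih]
      by_cases h1 : u x ∈ l
      · simp [h1]
      · by_cases h2 : i = u x
        · simp [h2]
        · simp [h1, h2, Ne.symm h2]
  have := key (List.finRange (n x)) (.num 0)
  simp only [List.mem_finRange, if_true] at this
  exact this

theorem update {f : ∀ x, Fin (n x) → A x} {u : ∀ x, Fin (n x)} {a : ∀ x, A x} (hn : PolyBdd N n)
    (hf : PolyTime M N e f) (hu : PolyTime M N e u) (ha : PolyTime M N e a) :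
    PolyTime M N e (fun x => Function.update (f x) (u x) (a x)) :=
  tabulate hn (hf.finRange hn) fun _ φ _ _ he hi =>
    (ite (fin_eq (hn.reindex φ) hi (hu.lift he)) (ha.lift he)
      (apply (hn.reindex φ) (hf.lift he) hi)).congr fun y => by
        simp [Function.update_apply]

/-- The table of a function given by the list of its values. -/
theorem of_ofFn {f : ∀ x, Fin (n x) → A x} (hn : PolyBdd N n)
    (hf : PolyTime M N e (fun x => List.ofFn (f x))) : PolyTime M N e f := by
  -- The loop carries a counter that numbers the entries. The invariant, counter equals round,
  -- bounds the cost of incrementing it.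
  have h := foldl (A := A) (B := fun x => ℕ × List (ℕ × A x)) (l := fun x => List.ofFn (f x))
    (b := fun _ => (0, [])) (step := fun _ s a => (s.1 + 1, (s.1, a) :: s.2))
    (fun _ i s => s.1 = i)
    hf (zero_nat.pair nil) (hn.mono fun _ => by simp) (fun _ => rfl)
    (fun _ _ _ _ _ _ h => by simp [h])
    (fun Y φ e' i s a hi _ hs he hs' ha =>
      have hb : PolyBdd (fun y => N (φ y)) (fun y => (s y).1) :=
        (hn.reindex φ).mono fun y => by rw [hs y]; simpa using (hi y).le
      (hs'.fst.nat_add one_nat hb (.const 1)).pair ((hs'.fst.pair ha).cons hs'.snd))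
  have key (x : X) (m : ℕ) (l : List (A x)) (L : List (ℕ × A x)) :
      (l.foldl (fun s a => (s.1 + 1, (s.1, a) :: s.2)) (m, L)).2 =
        ((l.zipIdx m).map fun p => (p.2, p.1)).reverse ++ L := by
    induction l generalizing m L with
    | nil => rfl
    | cons a l ih => simp [ih, List.zipIdx_cons]
  have h2 : PolyTime M N e fun x => ((List.ofFn (f x)).zipIdx.map fun p => (p.2, p.1)) :=
    ((h.snd.congr fun x => key x 0 _ _).reverse (hn.mono fun _ => by simp)).congr fun x => by simp
  refine h2.congr_enc fun x => ?_
  have h3 : (List.ofFn (f x)).zipIdx.map (fun p => (p.2, p.1)) =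
      (List.finRange (n x)).map fun i : Fin (n x) => (i.val, f x i) :=
    List.ext_getElem (by simp) fun i h1 h2 => by simp
  rw [h3]
  simp only [enc, List.map_map]
  rfl

/-! ### Optimal elements of lists -/

end PolyTime

open Classical in
/-- The first element of a list that is best for the total preorder `R`. -/
noncomputable def pick {α : Type} (R : α → α → Prop) (l : List α) : Option α :=
  l.foldl (fun o a => o.elim (some a) fun b => some (if R b a then b else a)) none

open Classical in
theorem pick_spec {α : Type} {R : α → α → Prop} (htot : ∀ a b, R a b ∨ R b a)
    (htrans : ∀ a b c, R a b → R b c → R a c) {l : List α} (hl : l ≠ []) :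
    ∃ a, pick R l = some a ∧ a ∈ l ∧ ∀ b ∈ l, R a b := by
  induction l using List.reverseRecOn with
  | nil => exact absurd rfl hl
  | append_singleton l c ih =>
    have hrefl (a) : R a a := (htot a a).elim id id
    rcases eq_or_ne l [] with rfl | hl'
    · exact ⟨c, rfl, by simp, by simp [hrefl]⟩
    obtain ⟨a, ha, hmem, hR⟩ := ih hl'
    have h : pick R (l ++ [c]) = (pick R l).elim (some c) fun b => some (if R b c then b else c) := by
      simp [pick, List.foldl_append]
    rw [h, ha, Option.elim_some]
    refine ⟨_, rfl, ?_⟩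
    split_ifs with hac
    · refine ⟨by simp [hmem], fun b hb => ?_⟩
      rcases List.mem_append.1 hb with hb | hb
      · exact hR b hb
      · rw [List.mem_singleton.1 hb]; exact hac
    · have hca := (htot a c).resolve_left hac
      refine ⟨by simp, fun b hb => ?_⟩
      rcases List.mem_append.1 hb with hb | hb
      · exact htrans _ _ _ hca (hR b hb)
      · rw [List.mem_singleton.1 hb]; exact hrefl c

open Classical in
-- The invariant keeps the current best element in the list, so `hR` has to handle members only; for
-- these, callers can bound the bit lengths of the numbers compared.
theorem PolyTime.pick {M : NumModel} {X : Type} {N : X → ℕ} {e : X → Val} {A : X → Type}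
    [∀ x, Enc (A x)] {R : ∀ x, A x → A x → Prop} {l : ∀ x, List (A x)} (hl : PolyTime M N e l)
    (hlen : PolyBdd N fun x => (l x).length)
    (hR : ∀ (Y : Type) (φ : Y → X) (e' : Y → Val) (a b : ∀ y, A (φ y)),
      (∀ y, a y ∈ l (φ y)) → (∀ y, b y ∈ l (φ y)) →
      PolyTime M (fun y => N (φ y)) e' (fun y => e (φ y)) →
      PolyTime M (fun y => N (φ y)) e' a → PolyTime M (fun y => N (φ y)) e' b →
      PolyTime M (fun y => N (φ y)) e' (fun y => decide (R (φ y) (a y) (b y)))) :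
    PolyTime M N e (fun x => pick (R x) (l x)) := by
  refine foldl (A := A) (b := fun x => (Option.none : Option (A x)))
    (B := fun x => Option (A x))
    (step := fun x o a => o.elim (Option.some a) fun b => Option.some (if R x b a then b else a))
    (fun x _ o => ∀ b ∈ o, b ∈ l x) hl .none hlen (by simp) ?_ ?_
  · intro x i o a _ ha ho b hb
    cases o with
    | none => simp at hb; exact hb ▸ ha
    | some c =>
      have hc : c ∈ l x := ho c rfl
      simp only [Option.elim_some, Option.mem_def, Option.some.injEq] at hb
      split_ifs at hb <;> subst hb <;> assumption
  · intro Y φ e' _ o a _ hmem ho he ho' ha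
    refine option_cases (A := fun y => A (φ y))
      (B := fun y => Option (A (φ y)))
      (g := fun y o => o.elim (Option.some (a y))
        fun b => Option.some (if R (φ y) b (a y) then b else a y))
      ho' ?_ ?_
    · intro Z ψ e'' _ he'
      exact (ha.lift he').some
    · intro Z ψ e'' b hb he' hb'
      exact (ite (hR Z (fun z => φ (ψ z)) e'' b (fun z => a (ψ z))
        (fun z => ho (ψ z) _ (hb z)) (fun z => hmem _) (he.lift he') hb' (ha.lift he'))
        hb' (ha.lift he')).some

/-! ## Sparse connected edge sets with prescribed parities -/

/-- Weighted edges, with an orientation. -/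
abbrev WEdge (V : Type) : Type := V × V × ℝ≥0

/-- The total weight of a list of edges. -/
noncomputable def wt {V : Type} (l : List (WEdge V)) : ℝ≥0 := (l.map fun e => e.2.2).sum

/-! ### Weights, connectivity and degree parities of edge lists. -/

section Weight

variable {V : Type}

@[simp] theorem wt_nil : wt ([] : List (WEdge V)) = 0 := rfl

@[simp] theorem wt_cons (e : WEdge V) (l : List (WEdge V)) : wt (e :: l) = e.2.2 + wt l := by
  simp [wt]

@[simp] theorem wt_append (l l' : List (WEdge V)) : wt (l ++ l') = wt l + wt l' := by simp [wt]

theorem wt_perm {l l' : List (WEdge V)} (h : l.Perm l') : wt l = wt l' := (h.map _).sum_eq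

theorem wt_sublist {l l' : List (WEdge V)} (h : l.Sublist l') : wt l ≤ wt l' := by
  induction h with
  | slnil => rfl
  | cons e _ ih => rw [wt_cons]; exact ih.trans le_add_self
  | cons_cons e _ ih => rw [wt_cons, wt_cons]; gcongr

/-- The two vertices are in the same component of the graph with the given edges. -/
def Joined (l : List (WEdge V)) : V → V → Prop :=
  Relation.EqvGen fun a b => ∃ e ∈ l, e.1 = a ∧ e.2.1 = b

theorem Joined.refl (l : List (WEdge V)) (a : V) : Joined l a a := Relation.EqvGen.refl a

theorem Joined.symm {l : List (WEdge V)} {a b : V} (h : Joined l a b) : Joined l b a :=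
  Relation.EqvGen.symm _ _ h

theorem Joined.trans {l : List (WEdge V)} {a b c : V} (h : Joined l a b) (h' : Joined l b c) :
    Joined l a c := Relation.EqvGen.trans _ _ _ h h'

theorem Joined.of_mem {l : List (WEdge V)} {e : WEdge V} (h : e ∈ l) : Joined l e.1 e.2.1 :=
  Relation.EqvGen.rel _ _ ⟨e, h, rfl, rfl⟩

theorem Joined.of_forall {l l' : List (WEdge V)} (h : ∀ e ∈ l, Joined l' e.1 e.2.1) {a b : V}
    (hab : Joined l a b) : Joined l' a b := by
  induction hab with
  | rel a b h' => obtain ⟨e, he, rfl, rfl⟩ := h'; exact h e he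
  | refl a => exact .refl _ _
  | symm a b _ ih => exact ih.symm
  | trans a b c _ _ ih1 ih2 => exact ih1.trans ih2

theorem Joined.mono {l l' : List (WEdge V)} (h : l ⊆ l') {a b : V} (hab : Joined l a b) :
    Joined l' a b := hab.of_forall fun _ he => .of_mem (h he)

/-- A set of vertices that contains both or no ends of each edge is a union of components. -/
theorem Joined.iff_of_closed {l : List (WEdge V)} {C : V → Prop}
    (hC : ∀ e ∈ l, (C e.1 ↔ C e.2.1)) {a b : V} (hab : Joined l a b) : C a ↔ C b := by
  induction hab with
  | rel a b h => obtain ⟨e, he, rfl, rfl⟩ := h; exact hC e he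
  | refl a => rfl
  | symm a b _ ih => exact ih.symm
  | trans a b c _ _ ih1 ih2 => exact ih1.trans ih2

/-- A connection that starts in a closed set never leaves it, so it uses only edges with both ends
in the set. -/
theorem Joined.filter {l : List (WEdge V)} {C : V → Prop} [DecidablePred C]
    (hC : ∀ e ∈ l, (C e.1 ↔ C e.2.1)) {a b : V} (hab : Joined l a b) (ha : C a) :
    Joined (l.filter fun e => C e.1) a b := by
  induction hab with
  | rel a b h =>
    obtain ⟨e, he, rfl, rfl⟩ := h
    exact .of_mem (List.mem_filter.2 ⟨he, by simpa using ha⟩)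
  | refl a => exact .refl _ _
  | symm a b h ih => exact (ih ((Joined.iff_of_closed hC h).2 ha)).symm
  | trans a b c h _ ih1 ih2 => exact (ih1 ha).trans (ih2 ((Joined.iff_of_closed hC h).1 ha))

theorem add_self_eq_zero_zmod_two (f : V → ZMod 2) : f + f = 0 := by
  ext v; exact CharTwo.add_self_eq_zero (f v)

/-- All members of the list are edges of `H` with their weights. -/
def EdgesIn (H : SimpleGraph V) (w : Sym2 V → ℝ≥0) (l : List (WEdge V)) : Prop :=
  ∀ e ∈ l, H.Adj e.1 e.2.1 ∧ e.2.2 = w s(e.1, e.2.1)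

theorem EdgesIn.mono {H : SimpleGraph V} {w : Sym2 V → ℝ≥0} {l l' : List (WEdge V)}
    (h : EdgesIn H w l) (hl : l' ⊆ l) : EdgesIn H w l' := fun e he => h e (hl he)

theorem walkWeight_cons (w : Sym2 V → ℝ≥0) {G : SimpleGraph V} {a b c : V} (h : G.Adj a b)
    (p : G.Walk b c) : walkWeight w (.cons h p) = w s(a, b) + walkWeight w p := by
  simp [walkWeight]

theorem walkWeight_append (w : Sym2 V → ℝ≥0) {G : SimpleGraph V} {a b c : V}
    (p : G.Walk a b) (q : G.Walk b c) :
    walkWeight w (p.append q) = walkWeight w p + walkWeight w q := by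
  simp [walkWeight, SimpleGraph.Walk.edges_append]

theorem walkWeight_reverse (w : Sym2 V → ℝ≥0) {G : SimpleGraph V} {a b : V}
    (p : G.Walk a b) : walkWeight w p.reverse = walkWeight w p := by
  simp [walkWeight, SimpleGraph.Walk.edges_reverse]

variable [DecidableEq V]

/-- The parities of the degrees. -/
def parity (l : List (WEdge V)) : V → ZMod 2 :=
  (l.map fun e => Pi.single e.1 1 + Pi.single e.2.1 1).sum

@[simp] theorem parity_nil : parity ([] : List (WEdge V)) = 0 := rfl

@[simp] theorem parity_cons (e : WEdge V) (l : List (WEdge V)) :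
    parity (e :: l) = Pi.single e.1 1 + Pi.single e.2.1 1 + parity l := by simp [parity]

@[simp] theorem parity_append (l l' : List (WEdge V)) :
    parity (l ++ l') = parity l + parity l' := by simp [parity]

theorem parity_perm {l l' : List (WEdge V)} (h : l.Perm l') : parity l = parity l' :=
  (h.map _).sum_eq

/-- By closedness an edge that is kept contributes only inside `C`, and one that is dropped only
outside. -/
theorem parity_filter {l : List (WEdge V)} {C : V → Prop} [DecidablePred C]
    (hC : ∀ e ∈ l, (C e.1 ↔ C e.2.1)) (v : V) :
    parity (l.filter fun e => C e.1) v = if C v then parity l v else 0 := by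
  induction l with
  | nil => simp
  | cons e l ih =>
    have ih := ih fun f hf => hC f (by simp [hf])
    have he := hC e (by simp)
    by_cases h : C e.1
    · rw [List.filter_cons_of_pos (by simpa using h), parity_cons, parity_cons, Pi.add_apply, ih]
      by_cases hv : C v
      · simp [hv]
      · have h1 : v ≠ e.1 := fun h' => hv (h' ▸ h)
        have h2 : v ≠ e.2.1 := fun h' => hv (h' ▸ he.1 h)
        simp [hv, h1, h2]
    · rw [List.filter_cons_of_neg (by simpa using h), parity_cons, Pi.add_apply, ih]
      by_cases hv : C v
      · have h1 : v ≠ e.1 := fun h' => h (h' ▸ hv)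
        have h2 : v ≠ e.2.1 := fun h' => h (he.2 (h' ▸ hv))
        simp [h1, h2]
      · simp [hv]

/-- The handshake lemma modulo 2. -/
theorem sum_parity [Fintype V] (l : List (WEdge V)) : ∑ v, parity l v = 0 := by
  induction l with
  | nil => simp
  | cons e l ih =>
    simp only [parity_cons, Pi.add_apply, Finset.sum_add_distrib, ih, Finset.sum_pi_single',
      Finset.mem_univ, if_true, add_zero]
    exact CharTwo.add_self_eq_zero 1

/-- If the edges `F` connect the ends of all edges `J`, some of them have the same parities. -/
theorem exists_sublist_parity {F J : List (WEdge V)} (h : ∀ e ∈ J, Joined F e.1 e.2.1) :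
    ∃ J' : List (WEdge V), J'.Sublist F ∧ parity J' = parity J := by
  -- Over the field with two elements a linear combination of edge vectors is the sum over a subset
  -- of the edges.
  have hspan (F : List (WEdge V)) (x : V → ZMod 2)
      (hx : x ∈ Submodule.span (ZMod 2) {y | ∃ e ∈ F, parity [e] = y}) :
      ∃ J' : List (WEdge V), J'.Sublist F ∧ parity J' = x := by
    induction F generalizing x with
    | nil => exact ⟨[], List.Sublist.slnil, by simpa [eq_comm] using hx⟩
    | cons e F ih =>
      have : {y | ∃ f ∈ e :: F, parity [f] = y} = insert (parity [e]) {y | ∃ f ∈ F, parity [f] = y} := by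
        ext y; simp [eq_comm]
      rw [this, Submodule.mem_span_insert] at hx
      obtain ⟨a, z, hz, rfl⟩ := hx
      obtain ⟨J', hJ, rfl⟩ := ih z hz
      have ha : a = 0 ∨ a = 1 := by revert a; decide
      rcases ha with rfl | rfl
      · exact ⟨J', hJ.cons e, by simp⟩
      · exact ⟨e :: J', hJ.cons_cons e, by simp⟩
  refine hspan F _ ?_
  -- Along a connection from `a` to `b` the edge vectors telescope modulo 2.
  have hj {a b : V} (hab : Joined F a b) : (Pi.single a 1 + Pi.single b 1 : V → ZMod 2) ∈
      Submodule.span (ZMod 2) {y | ∃ e ∈ F, parity [e] = y} := by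
    induction hab with
    | rel a b h =>
      obtain ⟨e, he, rfl, rfl⟩ := h
      exact Submodule.subset_span ⟨e, he, by simp⟩
    | refl a => rw [add_self_eq_zero_zmod_two]; exact zero_mem _
    | symm a b _ ih => rwa [add_comm]
    | trans a b c _ _ ih1 ih2 =>
      have := add_mem ih1 ih2
      rwa [add_assoc, ← add_assoc (Pi.single b 1 : V → ZMod 2), add_self_eq_zero_zmod_two, zero_add] at this
  induction J with
  | nil => exact zero_mem _
  | cons e J ih =>
    rw [parity_cons]
    exact add_mem (hj (h e (by simp))) (ih fun f hf => h f (by simp [hf]))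

end Weight

/-! ### Euler walks. -/

section Euler

variable {V : Type} [DecidableEq V] [Fintype V]

open Classical in
/-- Euler's theorem: edges with odd degrees exactly at `s` and `t` carry a walk from `s` to `t`
through the whole component of `s`. -/
theorem exists_walk_of_parity {H : SimpleGraph V} (w : Sym2 V → ℝ≥0) (l : List (WEdge V))
    (hl : EdgesIn H w l) (s t : V) (hp : parity l = Pi.single s 1 + Pi.single t 1) :
    ∃ p : H.Walk s t, walkWeight w p ≤ wt l ∧ ∀ v, Joined l s v → v ∈ p.support := by
  induction hlen : l.length using Nat.strong_induction_on generalizing l s t with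
  | _ m ih =>
  subst hlen
  -- Induction on the number of edges: remove an edge from `s` to some `u`. The remaining edges have
  -- parities matching a walk from `u` to `t`.
  by_cases hs : ∃ e ∈ l, e.1 = s ∨ e.2.1 = s
  · obtain ⟨e, he, hes⟩ := hs
    have hperm : l.Perm (e :: l.erase e) := List.perm_cons_erase he
    set l' := l.erase e with hl'
    have hlen : l'.length < l.length := by rw [hperm.length_eq]; simp
    have hsub : l' ⊆ l := List.erase_subset
    have hel : EdgesIn H w l' := hl.mono hsub
    obtain ⟨u, hadj, hw, hpar, hends⟩ : ∃ u, H.Adj s u ∧ e.2.2 = w s(s, u) ∧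
        (Pi.single e.1 1 + Pi.single e.2.1 1 : V → ZMod 2) = Pi.single s 1 + Pi.single u 1 ∧
        (e.1 = s ∧ e.2.1 = u ∨ e.1 = u ∧ e.2.1 = s) := by
      obtain ⟨h1, h2⟩ := hl e he
      rcases hes with rfl | rfl
      · exact ⟨e.2.1, h1, h2, rfl, by simp⟩
      · exact ⟨e.1, h1.symm, by rw [h2, Sym2.eq_swap], add_comm _ _, by simp⟩
    have hp' : parity l' = Pi.single u 1 + Pi.single t 1 := by
      have h := parity_perm hperm
      rw [hp, parity_cons, hpar] at h
      calc parity l' = Pi.single s 1 + Pi.single u 1 + (Pi.single s 1 + Pi.single u 1 + parity l')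
            := by rw [← add_assoc, add_self_eq_zero_zmod_two, zero_add]
        _ = (Pi.single s 1 + Pi.single s 1) + (Pi.single u 1 + Pi.single t 1) := by
            rw [← h]; abel
        _ = _ := by rw [add_self_eq_zero_zmod_two, zero_add]
    have hwt : wt l = w s(s, u) + wt l' := by rw [wt_perm hperm, wt_cons, hw]
    have hjoin : ∀ v, Joined l s v → Joined l' s v ∨ Joined l' u v := by
      intro v hv
      refine (Joined.iff_of_closed (C := fun v => Joined l' s v ∨ Joined l' u v) ?_ hv).1
        (.inl (.refl _ _))
      intro f hf
      rcases List.mem_cons.1 (hperm.subset hf) with rfl | hf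
      · rcases hends with ⟨h1, h2⟩ | ⟨h1, h2⟩ <;> rw [h1, h2] <;> simp [Joined.refl]
      · have := Joined.of_mem hf
        exact ⟨Or.imp (·.trans this) (·.trans this),
          Or.imp (·.trans this.symm) (·.trans this.symm)⟩
    -- If `s` and `u` are still connected, one walk from `u` covers the rest of the component.
    -- Otherwise the removed edge is a bridge: a closed walk covers the side of `s`, the bridge is
    -- crossed once, and a walk to `t` covers the side of `u`.
    by_cases hsu : Joined l' s u
    · obtain ⟨q, hq, hqv⟩ := ih _ hlen l' hel u t hp' rfl
      refine ⟨.cons hadj q, ?_, fun v hv => ?_⟩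
      · rw [walkWeight_cons, hwt]; gcongr
      · rw [SimpleGraph.Walk.support_cons]
        refine List.mem_cons_of_mem _ (hqv v ?_)
        rcases hjoin v hv with h | h
        · exact hsu.symm.trans h
        · exact h
    · have hC : ∀ f ∈ l', (Joined l' s f.1 ↔ Joined l' s f.2.1) := fun f hf =>
        ⟨(·.trans (.of_mem hf)), (·.trans (Joined.of_mem hf).symm)⟩
      have hC' : ∀ f ∈ l', (¬ Joined l' s f.1 ↔ ¬ Joined l' s f.2.1) := fun f hf =>
        not_congr (hC f hf)
      set l1 := l'.filter fun f => Joined l' s f.1 with hl1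
      set l2 := l'.filter fun f => ¬ Joined l' s f.1 with hl2
      have h12 : (l1 ++ l2).Perm l' := by
        have := List.filter_append_perm (fun f : WEdge V => decide (Joined l' s f.1)) l'
        simpa [hl1, hl2] using this
      have p1 := parity_filter (C := fun v => Joined l' s v) hC
      have p2 := parity_filter (C := fun v => ¬ Joined l' s v) hC'
      -- With `t` on the side of `s`, that side would have exactly one vertex of odd degree, against
      -- the handshake lemma.
      have hst : ¬ Joined l' s t := by
        intro hst
        have : ∀ v, parity l1 v = (Pi.single t 1 : V → ZMod 2) v := fun v => by
          rw [hl1, p1, hp']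
          by_cases hv : Joined l' s v
          · have : v ≠ u := fun h => hsu (h ▸ hv)
            simp [hv, this]
          · have : v ≠ t := fun h => hv (h ▸ hst)
            simp [hv, this]
        have h := sum_parity l1
        simp only [this, Finset.sum_pi_single', Finset.mem_univ, if_true] at h
        exact one_ne_zero h
      obtain ⟨q1, hq1, hv1⟩ := ih l1.length
        ((List.length_filter_le _ _).trans_lt hlen) l1
        (hel.mono (List.filter_subset_self _)) s s (by
          rw [add_self_eq_zero_zmod_two]
          ext v
          rw [hl1, p1, hp']
          split_ifs with hv
          · have h1 : v ≠ u := fun h => hsu (h ▸ hv)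
            have h2 : v ≠ t := fun h => hst (h ▸ hv)
            simp [h1, h2]
          · rfl) rfl
      obtain ⟨q2, hq2, hv2⟩ := ih l2.length
        ((List.length_filter_le _ _).trans_lt hlen) l2
        (hel.mono (List.filter_subset_self _)) u t (by
          ext v
          rw [hl2, p2, hp']
          by_cases hv : Joined l' s v
          · have h1 : v ≠ u := fun h => hsu (h ▸ hv)
            have h2 : v ≠ t := fun h => hst (h ▸ hv)
            simp [h1, h2]
          · simp [hv]) rfl
      refine ⟨q1.append (.cons hadj q2), ?_, fun v hv => ?_⟩
      · rw [walkWeight_append, walkWeight_cons, hwt, ← wt_perm h12, wt_append]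
        calc walkWeight w q1 + (w s(s, u) + walkWeight w q2)
            ≤ wt l1 + (w s(s, u) + wt l2) := by gcongr
          _ = _ := by ring
      · rw [SimpleGraph.Walk.mem_support_append_iff, SimpleGraph.Walk.support_cons]
        rcases hjoin v hv with h | h
        · exact .inl (hv1 v (Joined.filter hC h (.refl _ _)))
        · exact .inr (List.mem_cons_of_mem _ (hv2 v (Joined.filter (C := fun v => ¬ Joined l' s v) hC' h hsu)))
  -- No edge meets `s`, so its degree is even, which forces `s = t`; the component is then the
  -- single vertex `s`.
  · have hst : s = t := by
      by_contra hst
      have h0 : parity l s = 0 := by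
        clear ih hl hp
        induction l with
        | nil => simp
        | cons e l ih =>
          have he : e.1 ≠ s ∧ e.2.1 ≠ s := by
            constructor <;> intro h <;> exact hs ⟨e, by simp, by simp [h]⟩
          rw [parity_cons, Pi.add_apply, ih fun ⟨f, hf, h⟩ => hs ⟨f, by simp [hf], h⟩]
          simp [he.1.symm, he.2.symm]
      rw [hp] at h0
      simp [hst] at h0
    subst hst
    refine ⟨.nil, by simp [walkWeight], fun v hv => ?_⟩
    have := (Joined.iff_of_closed (C := fun v => v = s) (fun e he => by
      have : e.1 ≠ s ∧ e.2.1 ≠ s := by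
        constructor <;> intro h <;> exact hs ⟨e, he, by simp [h]⟩
      simp [this.1, this.2]) hv).1 rfl
    simp [this]

end Euler

/-! ### Sparsification by two spanning forests. -/

section Forest

variable {V : Type} [DecidableEq V]

/-- The greedy spanning forest: the state consists of the labels of the components, the forest, and
the rejected edges. -/
def forestStep (s : (V → V) × List (WEdge V) × List (WEdge V)) (e : WEdge V) :
    (V → V) × List (WEdge V) × List (WEdge V) :=
  if s.1 e.1 = s.1 e.2.1 then (s.1, s.2.1, e :: s.2.2)
  else (fun v => if s.1 v = s.1 e.1 then s.1 e.2.1 else s.1 v, e :: s.2.1, s.2.2)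

def forest (l : List (WEdge V)) : (V → V) × List (WEdge V) × List (WEdge V) :=
  l.foldl forestStep (id, [], [])

/-- The labels stand for the components: vertices with equal labels are connected in the forest, and
every processed edge has ends with equal labels. Each accepted edge makes one label disappear, so
accepted edges and surviving labels together number at most `Fintype.card V`. -/
theorem forest_spec [Fintype V] (l : List (WEdge V)) :
    ((forest l).2.1 ++ (forest l).2.2).Perm l ∧
    (∀ a b, (forest l).1 a = (forest l).1 b → Joined (forest l).2.1 a b) ∧
    (∀ e ∈ l, (forest l).1 e.1 = (forest l).1 e.2.1) ∧
    (forest l).2.1.length + (Finset.univ.image (forest l).1).card ≤ Fintype.card V := by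
  induction l using List.reverseRecOn with
  | nil => exact ⟨.refl _, fun a b h => by simp [forest] at h; exact h ▸ .refl _ _, by simp,
      by simp [forest]⟩
  | append_singleton l e ih =>
    have h : forest (l ++ [e]) = forestStep (forest l) e := by simp [forest, List.foldl_append]
    rw [h]
    generalize forest l = s at ih ⊢
    obtain ⟨h1, h2, h3, h4⟩ := ih
    by_cases hc : s.1 e.1 = s.1 e.2.1
    · simp only [forestStep, hc, if_true]
      refine ⟨?_, h2, ?_, h4⟩
      · exact (List.perm_middle.trans (h1.cons e)).trans (List.perm_append_singleton e l).symm
      · intro f hf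
        rcases List.mem_append.1 hf with hf | hf
        · exact h3 f hf
        · rw [List.mem_singleton.1 hf, hc]
    · simp only [forestStep, if_neg hc]
      refine ⟨?_, ?_, ?_, ?_⟩
      · exact (h1.cons e).trans (List.perm_append_singleton e l).symm
      · have hm {a b} (h : s.1 a = s.1 b) : Joined (e :: s.2.1) a b :=
          (h2 a b h).mono (List.subset_cons_self _ _)
        have he : Joined (e :: s.2.1) e.1 e.2.1 := .of_mem (by simp)
        intro a b hab
        by_cases ha : s.1 a = s.1 e.1 <;> by_cases hb : s.1 b = s.1 e.1 <;>
          simp only [ha, hb, if_true, if_false] at hab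
        · exact hm (ha.trans hb.symm)
        · exact ((hm ha).trans he).trans (hm hab)
        · exact ((hm hab).trans he.symm).trans (hm hb.symm)
        · exact hm hab
      · intro f hf
        rcases List.mem_append.1 hf with hf | hf
        · simp only [h3 f hf]
        · rw [List.mem_singleton.1 hf]; simp
      -- Merging removes the label of `e.1` and creates no new one.
      · have hsub : (Finset.univ.image fun v => if s.1 v = s.1 e.1 then s.1 e.2.1 else s.1 v) ⊆
            (Finset.univ.image s.1).erase (s.1 e.1) := by
          intro x hx
          obtain ⟨v, -, rfl⟩ := Finset.mem_image.1 hx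
          split_ifs with hv
          · exact Finset.mem_erase.2 ⟨Ne.symm hc, by simp⟩
          · exact Finset.mem_erase.2 ⟨hv, by simp⟩
        have hcard := Finset.card_le_card hsub
        have hmem : s.1 e.1 ∈ Finset.univ.image s.1 := by simp
        rw [Finset.card_erase_of_mem hmem] at hcard
        have := Finset.card_pos.2 ⟨_, hmem⟩
        simp only [List.length_cons]
        omega

/-- A spanning forest together with a spanning forest of the remaining edges. -/
def sparsify (l : List (WEdge V)) : List (WEdge V) :=
  (forest l).2.1 ++ (forest (forest l).2.2).2.1

theorem sparsify_subset [Fintype V] (l : List (WEdge V)) : sparsify l ⊆ l := by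
  have h1 := (forest_spec l).1.subset
  have h2 := (forest_spec (forest l).2.2).1.subset
  intro e he
  rcases List.mem_append.1 he with he | he
  · exact h1 (List.mem_append_left _ he)
  · exact h1 (List.mem_append_right _ (h2 (List.mem_append_left _ he)))

theorem length_forest_le [Fintype V] (l : List (WEdge V)) :
    (forest l).2.1.length ≤ Fintype.card V := by
  have := (forest_spec l).2.2.2; omega

theorem length_sparsify_le [Fintype V] (l : List (WEdge V)) :
    (sparsify l).length ≤ 2 * Fintype.card V := by
  have h1 := length_forest_le l
  have h2 := length_forest_le (forest l).2.2
  rw [sparsify, List.length_append]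
  omega

/-- The first forest preserves connectivity. The second spans the rejected edges, so it contains a
set `J` with the same degree parities as all of them. The first forest plus `J` therefore has the
parities of `l`, and its weight is at most that of `l` because `J` is taken among the rejected
edges. -/
theorem exists_walk_sparsify [Fintype V] {H : SimpleGraph V} (w : Sym2 V → ℝ≥0)
    (l : List (WEdge V)) (hl : EdgesIn H w (sparsify l)) (s t : V)
    (hp : parity l = Pi.single s 1 + Pi.single t 1) :
    ∃ p : H.Walk s t, walkWeight w p ≤ wt l ∧ ∀ v, Joined l s v → v ∈ p.support := by
  obtain ⟨h1, h2, h3, -⟩ := forest_spec l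
  obtain ⟨g1, g2, g3, -⟩ := forest_spec (forest l).2.2
  obtain ⟨J, hJ, hJp⟩ := exists_sublist_parity (F := (forest (forest l).2.2).2.1)
    (J := (forest l).2.2) fun e he => g2 _ _ (g3 e he)
  obtain ⟨p, hpw, hpv⟩ := exists_walk_of_parity w ((forest l).2.1 ++ J)
    (hl.mono (List.append_subset.2
      ⟨List.subset_append_left _ _, fun e he => List.mem_append_right _ (hJ.subset he)⟩)) s t (by
      rw [parity_append, hJp, ← parity_append, parity_perm h1, hp])
  refine ⟨p, hpw.trans ?_, fun v hv => hpv v ?_⟩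
  · rw [← wt_perm h1, wt_append, wt_append]
    gcongr
    rw [← wt_perm g1, wt_append]
    exact (wt_sublist hJ).trans le_self_add
  · exact (hv.of_forall fun e he => h2 _ _ (h3 e he)).mono (List.subset_append_left _ _)

end Forest

/-! ## Shortest paths -/

section Dijkstra

variable {n : ℕ}

/-- The settled vertices with their shortest paths to the target. -/
abbrev PathTable (n : ℕ) : Type := Fin n → Option (List (WEdge (Fin n)))

/-- The edges that lead to the settled vertices from outside, with the path that continues them. -/
def pathExtensions (E : List (WEdge (Fin n))) (st : PathTable n) :
    List (WEdge (Fin n) × List (WEdge (Fin n))) :=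
  E.flatMap fun e => if (st e.1).isSome = true then [] else (st e.2.1).elim [] fun l => [(e, l)]

noncomputable def dijkstraStep (E : List (WEdge (Fin n))) (st : PathTable n) : PathTable n :=
  (pick (fun a b => wt (a.1 :: a.2) ≤ wt (b.1 :: b.2)) (pathExtensions E st)).elim st
    fun c => Function.update st c.1.1 (some (c.1 :: c.2))

/-- Dijkstra's algorithm: shortest paths to `p`. -/
noncomputable def dijkstra (E : List (WEdge (Fin n))) (p : Fin n) : PathTable n :=
  (List.finRange n).foldl (fun st _ => dijkstraStep E st)
    (Function.update (fun _ => none) p (some []))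

/-- A shortest path from `u` to `p`. -/
noncomputable def shortestPath (E : List (WEdge (Fin n))) (u p : Fin n) : List (WEdge (Fin n)) :=
  (dijkstra E p u).elim [] id

/-- The distance from `u` to `p`. -/
noncomputable def pathDist (E : List (WEdge (Fin n))) (u p : Fin n) : ℝ≥0 := wt (shortestPath E u p)

theorem mem_pathExtensions {E : List (WEdge (Fin n))} {st : PathTable n}
    {c : WEdge (Fin n) × List (WEdge (Fin n))} :
    c ∈ pathExtensions E st ↔ c.1 ∈ E ∧ st c.1.1 = none ∧ st c.1.2.1 = some c.2 := by
  obtain ⟨e, l⟩ := c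
  simp only [pathExtensions, List.mem_flatMap]
  constructor
  · rintro ⟨f, hf, h⟩
    split_ifs at h with h1
    · simp at h
    · cases h2 : st f.2.1 with
      | none => simp [h2] at h
      | some l' =>
        simp only [h2, Option.elim_some, List.mem_singleton, Prod.mk.injEq] at h
        obtain ⟨rfl, rfl⟩ := h
        exact ⟨hf, by simpa using h1, h2⟩
  · rintro ⟨h1, h2, h3⟩
    exact ⟨e, h1, by simp [h2, h3]⟩

/-- `E` lists the edges of `G` in both orientations. -/
def IsEdgeList (G : SimpleGraph (Fin n)) (w : Sym2 (Fin n) → ℝ≥0) (E : List (WEdge (Fin n))) :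
    Prop := ∀ e, e ∈ E ↔ G.Adj e.1 e.2.1 ∧ e.2.2 = w s(e.1, e.2.1)

/-- The invariant of Dijkstra's algorithm after `i` steps. -/
structure DijkstraInv (G : SimpleGraph (Fin n)) (w : Sym2 (Fin n) → ℝ≥0)
    (E : List (WEdge (Fin n))) (p : Fin n) (i : ℕ) (st : PathTable n) : Prop where
  start : st p = some []
  first : ∀ u l, st u = some l → (l = [] ∧ u = p) ∨
    ∃ e l', l = e :: l' ∧ e.1 = u ∧ e ∈ E ∧ st e.2.1 = some l'
  shortest : ∀ u l, st u = some l → ∀ q : G.Walk u p, wt l ≤ walkWeight w q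
  length : ∀ u l, st u = some l → l.length ≤ i
  progress : (∀ u, st u ≠ none) ∨ i + 1 ≤ (Finset.univ.filter fun u => st u ≠ none).card

variable {G : SimpleGraph (Fin n)} {w : Sym2 (Fin n) → ℝ≥0} {E : List (WEdge (Fin n))}

theorem DijkstraInv.init (p : Fin n) :
    DijkstraInv G w E p 0 (Function.update (fun _ => none) p (some [])) := by
  have h {u l} (h : Function.update (fun _ => none) p (some []) u =
      (some l : Option (List (WEdge (Fin n))))) : l = [] ∧ u = p := by
    rw [Function.update_apply] at h
    split_ifs at h with hu
    exact ⟨by simpa using h.symm, hu⟩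
  refine ⟨by simp, fun u l hu => .inl (h hu), fun u l hu q => ?_, fun u l hu => ?_, .inr ?_⟩
  · simp [(h hu).1]
  · simp [(h hu).1]
  · rw [zero_add, Nat.one_le_iff_ne_zero, ← Nat.pos_iff_ne_zero, Finset.card_pos]
    exact ⟨p, by simp⟩

/-- The walk ends in the settled vertex `p`, so it has a first step into the settled set. Since
weights are nonnegative, the part before that step can be dropped; the part after it is at least as
long as the stored path. -/
theorem DijkstraInv.exists_extension_le (hE : IsEdgeList G w E) {p : Fin n} {i : ℕ}
    {st : PathTable n} (h : DijkstraInv G w E p i st) {u : Fin n} (q : G.Walk u p)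
    (hu : st u = none) :
    ∃ c ∈ pathExtensions E st, wt (c.1 :: c.2) ≤ walkWeight w q := by
  induction q with
  | nil => simp [h.start] at hu
  | @cons u v p hadj q ih =>
    rw [walkWeight_cons]
    cases hv : st v with
    | none =>
      obtain ⟨c, hc, hle⟩ := ih h hv
      exact ⟨c, hc, hle.trans le_add_self⟩
    | some l =>
      refine ⟨((u, v, w s(u, v)), l),
        mem_pathExtensions.2 ⟨(hE _).2 ⟨hadj, rfl⟩, hu, hv⟩, ?_⟩
      rw [wt_cons]
      gcongr
      exact h.shortest v l hv q

theorem wt_total (a b : WEdge (Fin n) × List (WEdge (Fin n))) :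
    wt (a.1 :: a.2) ≤ wt (b.1 :: b.2) ∨ wt (b.1 :: b.2) ≤ wt (a.1 :: a.2) := le_total _ _

/-- A cheapest extension is a shortest path, because every walk from its start to `p` is bounded
below by some extension. If there is no extension left, connectivity shows that all vertices are
settled. -/
theorem DijkstraInv.step (hE : IsEdgeList G w E) (hG : G.Connected) {p : Fin n} {i : ℕ}
    {st : PathTable n} (h : DijkstraInv G w E p i st) :
    DijkstraInv G w E p (i + 1) (dijkstraStep E st) := by
  rcases eq_or_ne (pathExtensions E st) [] with hnil | hne
  · have : dijkstraStep E st = st := by simp [dijkstraStep, hnil, pick]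
    rw [this]
    refine ⟨h.start, h.first, h.shortest, fun u l hu => (h.length u l hu).trans (Nat.le_succ _),
      .inl fun u hu => ?_⟩
    obtain ⟨c, hc, -⟩ := h.exists_extension_le hE (hG.preconnected u p).some hu
    simp [hnil] at hc
  · obtain ⟨⟨e, l⟩, hc, hmem, hmin⟩ := pick_spec wt_total (fun a b c => le_trans) hne
    rw [dijkstraStep, hc, Option.elim_some]
    obtain ⟨heE, he1, he2⟩ := mem_pathExtensions.1 hmem
    simp only at heE he1 he2 hmin ⊢
    have hold {u l'} (hu : st u = some l') :
        Function.update st e.1 (some (e :: l)) u = some l' := by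
      rw [Function.update_of_ne (fun hue => by simp [hue, he1] at hu), hu]
    have hnew {u l'} (hu : Function.update st e.1 (some (e :: l)) u = some l') :
        (u = e.1 ∧ l' = e :: l) ∨ st u = some l' := by
      rw [Function.update_apply] at hu
      split_ifs at hu with hue
      · exact .inl ⟨hue, by simpa using hu.symm⟩
      · exact .inr hu
    refine ⟨hold h.start, fun u l' hu => ?_, fun u l' hu q => ?_, fun u l' hu => ?_, ?_⟩
    · rcases hnew hu with ⟨rfl, rfl⟩ | hu
      · exact .inr ⟨e, l, rfl, rfl, heE, hold he2⟩
      · rcases h.first u l' hu with h1 | ⟨f, l'', h1, h2, h3, h4⟩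
        · exact .inl h1
        · exact .inr ⟨f, l'', h1, h2, h3, hold h4⟩
    · rcases hnew hu with ⟨rfl, rfl⟩ | hu
      · obtain ⟨c, hc, hle⟩ := h.exists_extension_le hE q he1
        exact (hmin c hc).trans hle
      · exact h.shortest u l' hu q
    · rcases hnew hu with ⟨rfl, rfl⟩ | hu
      · simpa using h.length _ l he2
      · exact (h.length u l' hu).trans (Nat.le_succ _)
    · rcases h.progress with hp | hp
      · exact absurd he1 (hp e.1)
      · refine .inr ((Nat.succ_le_succ hp).trans ?_)
        rw [Nat.succ_le_iff]
        refine Finset.card_lt_card (Finset.ssubset_iff.2 ⟨e.1, by simp [he1], ?_⟩)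
        intro u hu
        simp only [Finset.mem_insert, Finset.mem_filter, Finset.mem_univ, true_and] at hu ⊢
        rcases hu with rfl | hu
        · simp
        · obtain ⟨l', hl'⟩ := Option.ne_none_iff_exists'.1 hu
          simp [hold hl']

theorem DijkstraInv.foldl (hE : IsEdgeList G w E) (hG : G.Connected) {p : Fin n} {i : ℕ}
    {st : PathTable n} (h : DijkstraInv G w E p i st) (L : List (Fin n)) :
    DijkstraInv G w E p (i + L.length) (L.foldl (fun st _ => dijkstraStep E st) st) := by
  induction L generalizing i st with
  | nil => exact h
  | cons a L ih =>
    rw [List.foldl_cons, List.length_cons, ← add_assoc, add_right_comm]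
    exact ih (h.step hE hG)

theorem dijkstra_spec (hE : IsEdgeList G w E) (hG : G.Connected) (p : Fin n) :
    DijkstraInv G w E p n (dijkstra E p) ∧ ∀ u, dijkstra E p u = some (shortestPath E u p) := by
  have h := (DijkstraInv.init (G := G) (w := w) (E := E) p).foldl hE hG (List.finRange n)
  rw [List.length_finRange, zero_add] at h
  refine ⟨h, fun u => ?_⟩
  -- An unsettled vertex would leave only the other alternative of `progress`, namely at least `n +
  -- 1` settled vertices.
  have hu : dijkstra E p u ≠ none := by
    rcases h.progress with h | h
    · exact h u
    · have := (Finset.card_le_univ (Finset.univ.filter fun u => dijkstra E p u ≠ none))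
      rw [Fintype.card_fin] at this
      exact absurd (h.trans this) (by omega)
  obtain ⟨l, hl⟩ := Option.ne_none_iff_exists'.1 hu
  simp [shortestPath, hl]

/-- The tail of a stored path is the stored path of its second vertex. Hence the first edges alone
determine all paths to `p`, and a tree of at most `n` edges carries them. -/
theorem shortestPath_cases (hE : IsEdgeList G w E) (hG : G.Connected) (u p : Fin n) :
    (shortestPath E u p = [] ∧ u = p) ∨ ∃ e, e.1 = u ∧ e ∈ E ∧
      shortestPath E u p = e :: shortestPath E e.2.1 p := by
  obtain ⟨h, h'⟩ := dijkstra_spec hE hG p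
  rcases h.first u _ (h' u) with h1 | ⟨e, l, h1, h2, h3, h4⟩
  · exact .inl h1
  · rw [h' e.2.1] at h4
    exact .inr ⟨e, h2, h3, by rw [h1, Option.some_inj.1 h4]⟩

/-- Induction along shortest paths. -/
theorem shortestPath_induction (hE : IsEdgeList G w E) (hG : G.Connected) (p : Fin n)
    (P : Fin n → List (WEdge (Fin n)) → Prop) (h0 : shortestPath E p p = [] → P p [])
    (hs : ∀ e ∈ E, shortestPath E e.1 p = e :: shortestPath E e.2.1 p →
      P e.2.1 (shortestPath E e.2.1 p) → P e.1 (e :: shortestPath E e.2.1 p)) (u : Fin n) :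
    P u (shortestPath E u p) := by
  induction hl : (shortestPath E u p).length generalizing u with
  | zero =>
    rcases shortestPath_cases hE hG u p with ⟨h1, rfl⟩ | ⟨e, -, -, h⟩
    · rw [h1]; exact h0 h1
    · simp [h] at hl
  | succ m ih =>
    rcases shortestPath_cases hE hG u p with ⟨h1, rfl⟩ | ⟨e, rfl, he, h⟩
    · simp [h1] at hl
    · have := ih e.2.1 (by rw [h] at hl; simpa using hl)
      rw [h]
      exact hs e he h this

theorem length_shortestPath_le (hE : IsEdgeList G w E) (hG : G.Connected) (u p : Fin n) :
    (shortestPath E u p).length ≤ n :=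
  have h := dijkstra_spec hE hG p
  h.1.length u _ (h.2 u)

theorem shortestPath_subset (hE : IsEdgeList G w E) (hG : G.Connected) (u p : Fin n) :
    shortestPath E u p ⊆ E :=
  shortestPath_induction hE hG p (fun _ l => l ⊆ E) (fun _ => by simp)
    (fun e he _ ih => List.cons_subset.2 ⟨he, ih⟩) u

theorem parity_shortestPath (hE : IsEdgeList G w E) (hG : G.Connected) (u p : Fin n) :
    parity (shortestPath E u p) = Pi.single u 1 + Pi.single p 1 :=
  shortestPath_induction hE hG p (fun u l => parity l = Pi.single u 1 + Pi.single p 1)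
    (fun _ => by rw [add_self_eq_zero_zmod_two, parity_nil])
    (fun e he _ ih => by
      rw [parity_cons, ih, add_assoc, ← add_assoc (Pi.single e.2.1 1 : Fin n → ZMod 2),
        add_self_eq_zero_zmod_two, zero_add]) u

theorem joined_shortestPath (hE : IsEdgeList G w E) (hG : G.Connected) (u p : Fin n) :
    Joined (shortestPath E u p) u p :=
  shortestPath_induction hE hG p (fun u l => Joined l u p) (fun _ => .refl _ _)
    (fun e he _ ih => (Joined.of_mem (by simp)).trans (ih.mono (List.subset_cons_self _ _))) u

/-- `H` is only asked to contain first edges, as following them step by step traces the whole path.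
-/
theorem exists_walk_shortestPath (hE : IsEdgeList G w E) (hG : G.Connected)
    {H : SimpleGraph (Fin n)} (p : Fin n)
    (hH : ∀ u e, (shortestPath E u p).head? = some e → H.Adj e.1 e.2.1) (u : Fin n) :
    ∃ q : H.Walk u p, walkWeight w q = pathDist E u p :=
  shortestPath_induction hE hG p (fun u l => ∃ q : H.Walk u p, walkWeight w q = wt l)
    (fun _ => ⟨.nil, by simp [walkWeight]⟩)
    (fun e he h ⟨q, hq⟩ => ⟨.cons (hH e.1 e (by simp [h])) q, by
      rw [walkWeight_cons, wt_cons, hq, ((hE e).1 he).2]⟩) u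

theorem pathDist_le_walkWeight (hE : IsEdgeList G w E) (hG : G.Connected) {u p : Fin n}
    (q : G.Walk u p) : pathDist E u p ≤ walkWeight w q :=
  have h := dijkstra_spec hE hG p
  h.1.shortest u _ (h.2 u) q

theorem exists_walk_pathDist (hE : IsEdgeList G w E) (hG : G.Connected) (u p : Fin n) :
    ∃ q : G.Walk u p, walkWeight w q = pathDist E u p :=
  exists_walk_shortestPath hE hG p (fun v e he =>
    ((hE e).1 (shortestPath_subset hE hG v p (List.mem_of_head? he))).1) u

theorem pathDist_self (hE : IsEdgeList G w E) (hG : G.Connected) (u : Fin n) :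
    pathDist E u u = 0 :=
  le_antisymm ((pathDist_le_walkWeight hE hG .nil).trans (by simp [walkWeight])) zero_le

theorem pathDist_comm (hE : IsEdgeList G w E) (hG : G.Connected) (u v : Fin n) :
    pathDist E u v = pathDist E v u := by
  have key (u v) : pathDist E u v ≤ pathDist E v u := by
    obtain ⟨q, hq⟩ := exists_walk_pathDist hE hG v u
    rw [← hq, ← walkWeight_reverse]
    exact pathDist_le_walkWeight hE hG _
  exact le_antisymm (key u v) (key v u)

theorem pathDist_triangle (hE : IsEdgeList G w E) (hG : G.Connected) (u v x : Fin n) :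
    pathDist E u x ≤ pathDist E u v + pathDist E v x := by
  obtain ⟨p, hp⟩ := exists_walk_pathDist hE hG u v
  obtain ⟨q, hq⟩ := exists_walk_pathDist hE hG v x
  rw [← hp, ← hq, ← walkWeight_append]
  exact pathDist_le_walkWeight hE hG _

theorem pathDist_cons (hE : IsEdgeList G w E) (hG : G.Connected) {u v : Fin n} (h : G.Adj u v)
    (x : Fin n) : pathDist E u x ≤ w s(u, v) + pathDist E v x := by
  obtain ⟨q, hq⟩ := exists_walk_pathDist hE hG v x
  rw [← hq, ← walkWeight_cons w h]
  exact pathDist_le_walkWeight hE hG _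

/-! ### Sequences of points -/

/-- The length of the polygon through `p` and the points of the list. -/
noncomputable def seqLength (d : Fin n → Fin n → ℝ≥0) : Fin n → List (Fin n) → ℝ≥0
  | _, [] => 0
  | p, x :: l => d p x + seqLength d x l

theorem seqLength_append (d : Fin n → Fin n → ℝ≥0) (p x : Fin n) (l l' : List (Fin n)) :
    seqLength d p (l ++ x :: l') = seqLength d p (l ++ [x]) + seqLength d x l' := by
  induction l generalizing p with
  | nil => simp [seqLength]
  | cons y l ih => simp only [List.cons_append, seqLength, ih, add_assoc]

/-- The concatenation of shortest paths through `p` and the points of the list. -/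
noncomputable def expandSeq (E : List (WEdge (Fin n))) :
    Fin n → List (Fin n) → List (WEdge (Fin n))
  | _, [] => []
  | p, x :: l => shortestPath E p x ++ expandSeq E x l

theorem wt_expandSeq (E : List (WEdge (Fin n))) (p : Fin n) (l : List (Fin n)) :
    wt (expandSeq E p l) = seqLength (pathDist E) p l := by
  induction l generalizing p with
  | nil => rfl
  | cons x l ih => rw [expandSeq, wt_append, ih]; rfl

theorem expandSeq_subset (hE : IsEdgeList G w E) (hG : G.Connected) (p : Fin n)
    (l : List (Fin n)) : expandSeq E p l ⊆ E := by
  induction l generalizing p with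
  | nil => simp [expandSeq]
  | cons x l ih => exact List.append_subset.2 ⟨shortestPath_subset hE hG _ _, ih x⟩

theorem length_expandSeq_le (hE : IsEdgeList G w E) (hG : G.Connected) (p : Fin n)
    (l : List (Fin n)) : (expandSeq E p l).length ≤ l.length * n := by
  induction l generalizing p with
  | nil => simp [expandSeq]
  | cons x l ih =>
    have h1 := length_shortestPath_le hE hG p x
    have h2 := ih x
    rw [expandSeq, List.length_append, List.length_cons, Nat.succ_mul]
    omega

theorem parity_expandSeq (hE : IsEdgeList G w E) (hG : G.Connected) (p q : Fin n)
    (l : List (Fin n)) :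
    parity (expandSeq E p (l ++ [q])) = Pi.single p 1 + Pi.single q 1 := by
  induction l generalizing p with
  | nil => simp [expandSeq, parity_shortestPath hE hG]
  | cons x l ih =>
    rw [List.cons_append, expandSeq, parity_append, ih, parity_shortestPath hE hG, add_assoc,
      ← add_assoc (Pi.single x 1 : Fin n → ZMod 2), add_self_eq_zero_zmod_two, zero_add]

theorem joined_expandSeq (hE : IsEdgeList G w E) (hG : G.Connected) (p : Fin n)
    (l : List (Fin n)) : ∀ x ∈ l, Joined (expandSeq E p l) p x := by
  induction l generalizing p with
  | nil => simp
  | cons y l ih =>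
    have h : Joined (expandSeq E p (y :: l)) p y :=
      (joined_shortestPath hE hG p y).mono (List.subset_append_left _ _)
    intro x hx
    rcases List.mem_cons.1 hx with rfl | hx
    · exact h
    · exact h.trans ((ih y x hx).mono (List.subset_append_right _ _))

/-- A walk visits some given points in some order. -/
theorem exists_order_le_walkWeight (hE : IsEdgeList G w E) (hG : G.Connected) {ι : Type}
    [DecidableEq ι] (r : ι → Fin n) {s t : Fin n} (q : G.Walk s t) (S : Finset ι)
    (hS : ∀ i ∈ S, r i ∈ q.support) :
    ∃ L : List ι, L.Nodup ∧ L.toFinset = S ∧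
      seqLength (pathDist E) s (L.map r ++ [t]) ≤ walkWeight w q := by
  have hstay (s : Fin n) (L L' : List ι) (hL : ∀ i ∈ L, r i = s) (t : Fin n) :
      seqLength (pathDist E) s ((L ++ L').map r ++ [t]) =
        seqLength (pathDist E) s (L'.map r ++ [t]) := by
    induction L with
    | nil => rfl
    | cons i L ih =>
      have hi := hL i (by simp)
      simp only [List.cons_append, List.map_cons, seqLength, hi, pathDist_self hE hG, zero_add]
      exact ih fun j hj => hL j (by simp [hj])
  induction q generalizing S with
  | @nil s =>
    refine ⟨S.toList, S.nodup_toList, S.toList_toFinset, ?_⟩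
    have := hstay s S.toList [] (fun i hi => by simpa using hS i (by simpa using hi)) s
    rw [List.append_nil] at this
    rw [this]
    simp [seqLength, pathDist_self hE hG]
  | @cons s v t hadj q ih =>
    -- Indices are ordered by first visit: those located at `s` come first, at no cost, and the
    -- others lie on the rest of the walk. Several indices may share a vertex.
    obtain ⟨L, hL1, hL2, hL3⟩ := ih (S.filter fun i => r i ≠ s) fun i hi => by
      have h := hS i (Finset.mem_filter.1 hi).1
      rw [SimpleGraph.Walk.support_cons, List.mem_cons] at h
      exact h.resolve_left (Finset.mem_filter.1 hi).2
    refine ⟨(S.filter fun i => r i = s).toList ++ L, ?_, ?_, ?_⟩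
    · refine List.Nodup.append (Finset.nodup_toList _) hL1 fun i hi hi' => ?_
      rw [← List.mem_toFinset, hL2] at hi'
      simp at hi hi'
      exact hi'.2 hi.2
    · rw [List.toFinset_append, hL2, Finset.toList_toFinset, Finset.filter_union_filter_not_eq]
    · rw [hstay s _ _ (fun i hi => by simp at hi; exact hi.2), walkWeight_cons]
      refine le_trans ?_ (add_le_add_right hL3 _)
      cases L with
      | nil =>
        simp only [List.map_nil, List.nil_append, seqLength, add_zero]
        exact pathDist_cons hE hG hadj t
      | cons i L =>
        simp only [List.map_cons, List.cons_append, seqLength]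
        rw [← add_assoc]
        gcongr
        exact pathDist_cons hE hG hadj _

/-- A walk through points of pairwise distance at least `ρ` is long. -/
theorem card_mul_le_walkWeight (hE : IsEdgeList G w E) (hG : G.Connected) {s t : Fin n}
    (q : G.Walk s t) (ρ : ℝ≥0) (S : Finset (Fin n)) (hS : ∀ x ∈ S, x ∈ q.support)
    (hne : S.Nonempty) (hsep : ∀ x ∈ S, ∀ y ∈ S, x ≠ y → ρ ≤ pathDist E x y) :
    ∃ a ∈ S, pathDist E s a + (S.card - 1 : ℕ) * ρ ≤ walkWeight w q := by
  induction q generalizing S with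
  | @nil s =>
    have hSs : S = {s} := Finset.eq_singleton_iff_nonempty_unique_mem.2
      ⟨hne, fun x hx => by simpa using hS x hx⟩
    exact ⟨s, by simp [hSs], by simp [hSs, pathDist_self hE hG]⟩
  | @cons s v t hadj q ih =>
    have hmem {x} (hx : x ∈ S) (hxs : x ≠ s) : x ∈ q.support := by
      have h := hS x hx
      rw [SimpleGraph.Walk.support_cons, List.mem_cons] at h
      exact h.resolve_left hxs
    rw [walkWeight_cons]
    -- The witness `a` is the first point of `S` on the walk, and the term for the way to `a` is
    -- what makes the induction work. If `s` itself is in `S`, the way to the next point of `S`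
    -- already has length at least `ρ`.
    by_cases hs : s ∈ S
    · refine ⟨s, hs, ?_⟩
      rw [pathDist_self hE hG, zero_add]
      rcases (S.erase s).eq_empty_or_nonempty with h0 | h0
      · have : S.card - 1 = 0 := by rw [← Finset.card_erase_of_mem hs, h0, Finset.card_empty]
        simp [this]
      · obtain ⟨a, ha, hle⟩ := ih (S.erase s)
          (fun x hx => hmem (Finset.mem_of_mem_erase hx) (Finset.ne_of_mem_erase hx)) h0
          fun x hx y hy => hsep x (Finset.mem_of_mem_erase hx) y (Finset.mem_of_mem_erase hy)
        have hpos := Finset.card_pos.2 h0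
        have hcard : S.card - 1 = ((S.erase s).card - 1) + 1 := by
          rw [← Finset.card_erase_of_mem hs]; omega
        rw [hcard, Nat.cast_add, Nat.cast_one]
        calc ((((S.erase s).card - 1 : ℕ) : ℝ≥0) + 1) * ρ
            = ρ + ((S.erase s).card - 1 : ℕ) * ρ := by ring
          _ ≤ (w s(s, v) + pathDist E v a) + ((S.erase s).card - 1 : ℕ) * ρ := by
            gcongr
            exact (hsep s hs a (Finset.mem_of_mem_erase ha)
              (Finset.ne_of_mem_erase ha).symm).trans (pathDist_cons hE hG hadj a)
          _ = w s(s, v) + (pathDist E v a + ((S.erase s).card - 1 : ℕ) * ρ) := by ring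
          _ ≤ _ := by gcongr
    · obtain ⟨a, ha, hle⟩ := ih S (fun x hx => hmem hx (fun h => hs (h ▸ hx))) hne hsep
      refine ⟨a, ha, ?_⟩
      calc pathDist E s a + (S.card - 1 : ℕ) * ρ
          ≤ (w s(s, v) + pathDist E v a) + (S.card - 1 : ℕ) * ρ := by
            gcongr; exact pathDist_cons hE hG hadj a
        _ = w s(s, v) + (pathDist E v a + (S.card - 1 : ℕ) * ρ) := by ring
        _ ≤ _ := by gcongr

end Dijkstra

/-! ## The spanner -/

section Spanner

variable {n k : ℕ}

/-- The distance from `a` to the nearest point of the list. -/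
noncomputable def nearestDist (E : List (WEdge (Fin n))) (m : List (Fin n)) (a : Fin n) : ℝ≥0 :=
  (pick (· ≤ ·) (m.map (pathDist E a))).elim 0 id

/-- The point of `R` with the largest distance from the points of `m`. -/
noncomputable def farthest (E : List (WEdge (Fin n))) (R m : List (Fin n)) : Option (Fin n) :=
  pick (fun a b => nearestDist E m b ≤ nearestDist E m a) R

/-- The state consists of the marks chosen so far and the product of their number and `ε`. -/
noncomputable def marksStep (E : List (WEdge (Fin n))) (ε : ℝ≥0) (R : List (Fin n))
    (s : ℝ≥0 × List (Fin n)) : ℝ≥0 × List (Fin n) :=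
  if 4 ≤ s.1 then s else (farthest E R s.2).elim s fun p => (s.1 + ε, p :: s.2)

noncomputable def marksState (E : List (WEdge (Fin n))) (ε : ℝ≥0) (R : List (Fin n)) :
    ℝ≥0 × List (Fin n) :=
  R.foldl (fun s _ => marksStep E ε R s) (0, [])

/-- About `4 / ε` points of `R`, chosen by farthest-point insertion. -/
noncomputable def marks (E : List (WEdge (Fin n))) (ε : ℝ≥0) (R : List (Fin n)) : List (Fin n) :=
  (marksState E ε R).2

/-- The points of an instance of the Hamiltonian path problem: the endpoints come first. -/
def hamPoints (r : Fin k → Fin n) (a b : Fin n) : Fin (k + 2) → Fin n :=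
  Fin.cons a (Fin.cons b r : Fin (k + 1) → Fin n)

/-- The tour from `p` via the Hamiltonian path to `q`. -/
noncomputable def tour (E : List (WEdge (Fin n))) (r : Fin k → Fin n)
    (ham : Fin n → Fin n → List (Fin (k + 2))) (p q a b : Fin n) : List (WEdge (Fin n)) :=
  expandSeq E p ((ham a b).map (hamPoints r a b) ++ [q])

noncomputable def bestTour (E : List (WEdge (Fin n))) (r : Fin k → Fin n)
    (ham : Fin n → Fin n → List (Fin (k + 2))) (p q : Fin n) : List (WEdge (Fin n)) :=
  (pick (fun l l' => wt l ≤ wt l')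
    ((List.ofFn r).flatMap fun a => (List.ofFn r).map fun b => tour E r ham p q a b)).elim [] id

/-- The edges of the shortest path tree of `p`. -/
noncomputable def pathTree (E : List (WEdge (Fin n))) (p : Fin n) : List (WEdge (Fin n)) :=
  (List.finRange n).flatMap fun u => (shortestPath E u p).head?.toList

/-- The trees serve the ways from `s` to a mark and from a mark to `t`; the tours visit the required
vertices in between. -/
noncomputable def spannerEdges (E : List (WEdge (Fin n))) (r : Fin k → Fin n) (ε : ℝ≥0)
    (ham : Fin n → Fin n → List (Fin (k + 2))) : List (WEdge (Fin n)) :=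
  (marks E ε (List.ofFn r)).flatMap fun p => pathTree E p ++
    (marks E ε (List.ofFn r)).flatMap fun q => sparsify (bestTour E r ham p q)

/-! ### Marks by farthest-point insertion. -/

theorem nearestDist_spec (E : List (WEdge (Fin n))) {m : List (Fin n)} (hm : m ≠ []) (a : Fin n) :
    (∃ p ∈ m, nearestDist E m a = pathDist E a p) ∧ ∀ p ∈ m, nearestDist E m a ≤ pathDist E a p := by
  obtain ⟨x, hx, hmem, hmin⟩ := pick_spec (R := fun a b : ℝ≥0 => a ≤ b) le_total
    (fun _ _ _ => le_trans) (l := m.map (pathDist E a)) (by simpa using hm)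
  have : nearestDist E m a = x := by rw [nearestDist, hx]; rfl
  rw [this]
  obtain ⟨p, hp, rfl⟩ := List.mem_map.1 hmem
  exact ⟨⟨p, hp, rfl⟩, fun q hq => hmin _ (List.mem_map.2 ⟨q, hq, rfl⟩)⟩

theorem farthest_spec (E : List (WEdge (Fin n))) {R : List (Fin n)} (hR : R ≠ [])
    (m : List (Fin n)) :
    ∃ p, farthest E R m = some p ∧ p ∈ R ∧ ∀ a ∈ R, nearestDist E m a ≤ nearestDist E m p :=
  pick_spec (R := fun a b => nearestDist E m b ≤ nearestDist E m a)
    (fun _ _ => le_total _ _) (fun _ _ _ h h' => h'.trans h) hR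

/-- The invariant of the choice of marks after `i` steps. -/
structure MarksInv (E : List (WEdge (Fin n))) (ε : ℝ≥0) (R : List (Fin n)) (i : ℕ)
    (s : ℝ≥0 × List (Fin n)) : Prop where
  acc : s.1 = s.2.length * ε
  subset : s.2 ⊆ R
  acc_lt : s.1 < 4 + ε
  length_le : s.2.length ≤ i
  progress : 4 ≤ s.1 ∨ s.2.length = i
  separated : ∀ ρ, (∃ a ∈ R, ∀ p ∈ s.2, ρ ≤ pathDist E a p) →
    s.2.Pairwise fun p q => ρ ≤ pathDist E p q

/-- Separation survives because the new mark is farthest: if after the step some point still has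
distance at least `ρ` from all marks, then the new mark had at least that distance from the older
ones. -/
theorem MarksInv.step {E : List (WEdge (Fin n))} {ε : ℝ≥0} {R : List (Fin n)} (hR : R ≠ [])
    {i : ℕ} {s : ℝ≥0 × List (Fin n)} (h : MarksInv E ε R i s) :
    MarksInv E ε R (i + 1) (marksStep E ε R s) := by
  rw [marksStep]
  split_ifs with h4
  · exact ⟨h.acc, h.subset, h.acc_lt, h.length_le.trans (Nat.le_succ _), .inl h4, h.separated⟩
  · obtain ⟨p, hp, hpR, hmax⟩ := farthest_spec E hR s.2
    rw [hp, Option.elim_some]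
    refine ⟨?_, List.cons_subset.2 ⟨hpR, h.subset⟩, ?_, ?_, .inr ?_, ?_⟩
    · simp only [h.acc, List.length_cons]; push_cast; ring
    · have := not_le.1 h4
      simp only; gcongr
    · simpa using h.length_le
    · simpa using h.progress.resolve_left h4
    · rintro ρ ⟨a, ha, hρ⟩
      refine List.pairwise_cons.2 ⟨fun q hq => ?_,
        h.separated ρ ⟨a, ha, fun q hq => hρ q (List.mem_cons_of_mem _ hq)⟩⟩
      have hne : s.2 ≠ [] := List.ne_nil_of_mem hq
      obtain ⟨⟨x, hx, hx'⟩, -⟩ := nearestDist_spec E hne a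
      exact ((hρ x (List.mem_cons_of_mem _ hx)).trans (hx' ▸ hmax a ha)).trans
        ((nearestDist_spec E hne p).2 q hq)

theorem marksInv {E : List (WEdge (Fin n))} {ε : ℝ≥0} {R : List (Fin n)} (hR : R ≠ []) :
    MarksInv E ε R R.length (marksState E ε R) := by
  have key (L : List (Fin n)) : MarksInv E ε R L.length
      (L.foldl (fun s _ => marksStep E ε R s) (0, [])) := by
    induction L using List.reverseRecOn with
    | nil => exact ⟨by simp, by simp, by simp, by simp, by simp, by simp⟩
    | append_singleton L a ih =>
      rw [List.foldl_append, List.length_append]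
      exact ih.step hR
  exact key R

theorem length_marks_le (E : List (WEdge (Fin n))) (ε : ℝ≥0) (R : List (Fin n)) :
    (marks E ε R).length ≤ R.length := by
  rcases eq_or_ne R [] with rfl | hR
  · simp [marks, marksState]
  · exact (marksInv hR).length_le

variable {G : SimpleGraph (Fin n)} {w : Sym2 (Fin n) → ℝ≥0} {E : List (WEdge (Fin n))}

/-- Each required point has a mark within an `ε / 4` fraction of the length of any walk through all
required points. -/
theorem exists_mark_near (hE : IsEdgeList G w E) (hG : G.Connected) {R : List (Fin n)} {ε : ℝ≥0}
    {s t : Fin n} (q : G.Walk s t) (hq : ∀ x ∈ R, x ∈ q.support) {a : Fin n} (ha : a ∈ R) :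
    ∃ p ∈ marks E ε R, 4 * pathDist E a p ≤ ε * walkWeight w q := by
  have h : MarksInv E ε R R.length (marksState E ε R) := marksInv (List.ne_nil_of_mem ha)
  have hne : marks E ε R ≠ [] := by
    intro h0
    change (marksState E ε R).2 = [] at h0
    rcases h.progress with h1 | h1
    · rw [h.acc, h0] at h1; norm_num at h1
    · rw [h0] at h1; exact List.ne_nil_of_mem ha (List.length_eq_zero_iff.1 h1.symm)
  obtain ⟨⟨p, hp, hρ⟩, hle⟩ := nearestDist_spec E hne a
  refine ⟨p, hp, ?_⟩
  set ρ := pathDist E a p with hρdef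
  rw [hρ] at hle
  have hsep : (a :: marks E ε R).Pairwise fun x y => ρ ≤ pathDist E x y :=
    List.pairwise_cons.2 ⟨hle, h.separated ρ ⟨a, ha, hle⟩⟩
  have hsubR : a :: marks E ε R ⊆ R := List.cons_subset.2 ⟨ha, h.subset⟩
  -- A repetition in this list forces `ρ = 0`, by separation and zero self-distance. Without
  -- repetition the selection must have stopped at the threshold: otherwise there would be as many
  -- marks as entries of `R`, and `a` would be one distinct entry too many.
  by_cases hnd : (a :: marks E ε R).Nodup
  · have h4 : 4 ≤ (marks E ε R).length * ε := by
      rcases h.progress with h1 | h1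
      · exact h.acc ▸ h1
      · have h2 := (hnd.subperm hsubR).length_le
        rw [List.length_cons] at h2
        change (marks E ε R).length = _ at h1
        omega
    obtain ⟨b, -, hb⟩ := card_mul_le_walkWeight hE hG q ρ (a :: marks E ε R).toFinset
      (fun x hx => hq x (hsubR (List.mem_toFinset.1 hx))) ⟨a, by simp⟩ (by
        have : ∀ x ∈ a :: marks E ε R, ∀ y ∈ a :: marks E ε R, x ≠ y → ρ ≤ pathDist E x y :=
          fun x hx y hy hxy =>
            have : Std.Symm fun x y => ρ ≤ pathDist E x y :=
              ⟨fun x y h => pathDist_comm hE hG x y ▸ h⟩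
            hsep.forall hx hy hxy
        simpa only [List.mem_toFinset] using this)
    rw [List.toFinset_card_of_nodup hnd, List.length_cons, Nat.add_sub_cancel] at hb
    calc 4 * ρ ≤ (marks E ε R).length * ε * ρ := by gcongr
      _ = ε * ((marks E ε R).length * ρ) := by ring
      _ ≤ ε * walkWeight w q := by gcongr; exact le_add_self.trans hb
  · have h0 : ρ = 0 := by
      by_contra h0
      refine hnd (List.Pairwise.imp (fun {x y} hxy (hne : x = y) => h0 ?_) hsep)
      rw [hne, pathDist_self hE hG] at hxy
      exact le_antisymm hxy zero_le
    rw [h0, mul_zero]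
    exact zero_le

/-- The last mark is added while the product is still below 4, which leaves it below `4 + ε`. -/
theorem length_marks_mul_le (E : List (WEdge (Fin n))) {ε : ℝ≥0} (hε : ε ≤ 1) (R : List (Fin n)) :
    (marks E ε R).length * ε ≤ 5 := by
  rcases eq_or_ne R [] with rfl | hR
  · simp [marks, marksState]
  · have h := marksInv (E := E) (ε := ε) hR
    have h2 := h.acc_lt.le
    rw [h.acc] at h2
    exact h2.trans ((add_le_add_right hε 4).trans (by norm_num))

/-! ### Hamiltonian paths -/

theorem exists_walk_top_support {V : Type} (l : List V) (i j : V) (h : (i :: (l ++ [j])).Nodup) :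
    ∃ π : (⊤ : SimpleGraph V).Walk i j, π.support = i :: (l ++ [j]) := by
  induction l generalizing i with
  | nil =>
    have : i ≠ j := by simpa using h
    exact ⟨.cons (by simpa using this) .nil, rfl⟩
  | cons x l ih =>
    obtain ⟨h1, h2⟩ := List.nodup_cons.1 h
    obtain ⟨π, hπ⟩ := ih x h2
    refine ⟨.cons (v := x) (by simp; rintro rfl; simp at h1) π, by simp [hπ]⟩

theorem seqLength_support {m : ℕ} (d : Fin n → Fin n → ℝ≥0) (f : Fin m → Fin n)
    {w' : Sym2 (Fin m) → ℝ≥0} (hw : ∀ i j, w' s(i, j) = d (f i) (f j))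
    {H : SimpleGraph (Fin m)} {i j : Fin m} (π : H.Walk i j) (p q : Fin n) :
    seqLength d p (π.support.map f ++ [q]) = d p (f i) + walkWeight w' π + d (f j) q := by
  induction π generalizing p with
  | nil => simp [seqLength, walkWeight]
  | @cons i x j hadj π ih =>
    rw [SimpleGraph.Walk.support_cons, List.map_cons, List.cons_append, seqLength, ih,
      walkWeight_cons, hw]
    ring

/-- A walk through all required points is at least as long as a Hamiltonian path between suitable
required points, together with the ways from and to its ends. -/
theorem exists_hamiltonian_le (hE : IsEdgeList G w E) (hG : G.Connected) (hk : 1 ≤ k)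
    (r : Fin k → Fin n) {s t : Fin n} (q : G.Walk s t) (hq : ∀ i, r i ∈ q.support) :
    ∃ a ∈ List.ofFn r, ∃ b ∈ List.ofFn r, ∀ w' : Sym2 (Fin (k + 2)) → ℝ≥0,
      (∀ i j, w' s(i, j) = pathDist E (hamPoints r a b i) (hamPoints r a b j)) →
      ∃ π : (⊤ : SimpleGraph (Fin (k + 2))).Walk 0 1, π.IsHamiltonian ∧
        pathDist E s a + walkWeight w' π + pathDist E b t ≤ walkWeight w q := by
  obtain ⟨L, hnd, huniv, hle⟩ := exists_order_le_walkWeight hE hG r q Finset.univ fun i _ => hq i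
  have hall : ∀ i, i ∈ L := fun i => by rw [← List.mem_toFinset, huniv]; simp
  have hLne : L ≠ [] := List.ne_nil_of_mem (hall ⟨0, hk⟩)
  obtain ⟨i0, L', rfl⟩ := List.exists_cons_of_ne_nil hLne
  -- The first and last indices in order of visit supply the ends `a` and `b`.
  obtain ⟨L'', j0, hj⟩ := List.eq_nil_or_concat' (i0 :: L') |>.resolve_left hLne
  refine ⟨r i0, by simp, r j0, by simp, fun w' hw => ?_⟩
  -- The ends enter the instance as extra points 0 and 1 besides the `k` required ones, so the two
  -- endpoints are distinct even if `a = b`. The Hamiltonian path then has first and last edges of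
  -- length zero.
  have hnd' : ((0 : Fin (k + 2)) :: ((i0 :: L').map (fun i => i.succ.succ) ++ [1])).Nodup := by
    refine List.nodup_cons.2 ⟨?_, ?_⟩
    · intro h
      rcases List.mem_append.1 h with h | h
      · obtain ⟨i, -, hi⟩ := List.mem_map.1 h
        exact Fin.succ_ne_zero _ hi
      · simp at h
    · refine List.Nodup.append (hnd.map fun i j h => by simpa using h) (by simp) ?_
      intro x hx h1
      obtain ⟨i, -, rfl⟩ := List.mem_map.1 hx
      rw [List.mem_singleton] at h1
      have := congrArg Fin.val h1
      simp at this
  obtain ⟨π, hπ⟩ := exists_walk_top_support _ _ _ hnd'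
  refine ⟨π, ?_, ?_⟩
  · intro x
    refine List.count_eq_one_of_mem (hπ ▸ hnd') ?_
    rw [hπ]
    refine Fin.cases (by simp) (fun x => Fin.cases ?_ (fun i => ?_) x) x
    · exact List.mem_cons_of_mem _ (List.mem_append_right _ (by simp))
    · exact List.mem_cons_of_mem _ (List.mem_append_left _
        (List.mem_map.2 ⟨i, hall i, rfl⟩))
  · have h := seqLength_support (pathDist E) (hamPoints r (r i0) (r j0)) hw π (r i0) (r j0)
    have h0 : hamPoints r (r i0) (r j0) 0 = r i0 := rfl
    have h1 : hamPoints r (r i0) (r j0) 1 = r j0 := rfl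
    have hmap : π.support.map (hamPoints r (r i0) (r j0)) =
        r i0 :: ((i0 :: L').map r ++ [r j0]) := by
      rw [hπ, List.map_cons, List.map_append, List.map_map]; rfl
    rw [h0, h1, hmap, pathDist_self hE hG, pathDist_self hE hG, zero_add, add_zero] at h
    rw [← h]
    refine le_trans (le_of_eq ?_) hle
    have e1 (x y : Fin n) : seqLength (pathDist E) x ((i0 :: L').map r ++ [y]) =
        seqLength (pathDist E) x ((i0 :: L').map r) + pathDist E (r j0) y := by
      have hz (z) : seqLength (pathDist E) x ((L'' ++ [j0]).map r ++ [z]) =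
          seqLength (pathDist E) x ((L'' ++ [j0]).map r) + pathDist E (r j0) z := by
        rw [List.map_append, List.map_cons, List.map_nil, List.append_assoc, List.singleton_append,
          seqLength_append]
        simp [seqLength]
      rw [hj]
      exact hz y
    have e2 : seqLength (pathDist E) (r i0)
        ((r i0 :: ((i0 :: L').map r ++ [r j0])) ++ [r j0]) =
        seqLength (pathDist E) (r i0) (L'.map r) := by
      rw [List.cons_append, List.append_assoc, seqLength, pathDist_self hE hG, zero_add]
      have := seqLength_append (pathDist E) (r i0) (r j0) ((i0 :: L').map r) [r j0]
      rw [List.singleton_append, this, e1, pathDist_self hE hG]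
      simp [seqLength, pathDist_self hE hG]
    rw [e2, e1, List.map_cons, seqLength]

/-- The paths `ham a b` are Hamiltonian paths with the approximation ratio `γ`. -/
def IsHamApprox (E : List (WEdge (Fin n))) (r : Fin k → Fin n) (γ : ℝ)
    (ham : Fin n → Fin n → List (Fin (k + 2))) : Prop :=
  ∀ a b, ∃ w' : Sym2 (Fin (k + 2)) → ℝ≥0,
    (∀ i j, w' s(i, j) = pathDist E (hamPoints r a b i) (hamPoints r a b j)) ∧
    ∃ π : (⊤ : SimpleGraph (Fin (k + 2))).Walk 0 1, π.support = ham a b ∧ π.IsHamiltonian ∧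
      ∀ π' : (⊤ : SimpleGraph (Fin (k + 2))).Walk 0 1, π'.IsHamiltonian →
        (walkWeight w' π : ℝ) ≤ γ * (walkWeight w' π' : ℝ)

/-! ### Best tours, number of edges and stretch. -/

variable {r : Fin k → Fin n} {γ : ℝ} {ham : Fin n → Fin n → List (Fin (k + 2))}

theorem IsHamApprox.mem (h : IsHamApprox E r γ ham) (a b : Fin n) (i : Fin k) :
    r i ∈ (ham a b).map (hamPoints r a b) := by
  obtain ⟨w', hw, π, hπ, hham, -⟩ := h a b
  exact List.mem_map.2 ⟨i.succ.succ, hπ ▸ hham.mem_support _, rfl⟩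

/-- The ends used by the best tour need not be those of the walk it is compared with; minimality
over all pairs of required vertices is what makes the comparison possible. -/
theorem bestTour_spec (hk : 1 ≤ k) (p q : Fin n) :
    (∃ a b, bestTour E r ham p q = tour E r ham p q a b) ∧
    ∀ a ∈ List.ofFn r, ∀ b ∈ List.ofFn r,
      wt (bestTour E r ham p q) ≤ wt (tour E r ham p q a b) := by
  have hmem : ∀ a ∈ List.ofFn r, ∀ b ∈ List.ofFn r, tour E r ham p q a b ∈
      (List.ofFn r).flatMap fun a => (List.ofFn r).map fun b => tour E r ham p q a b :=
    fun a ha b hb => List.mem_flatMap.2 ⟨a, ha, List.mem_map.2 ⟨b, hb, rfl⟩⟩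
  have h0 : r ⟨0, hk⟩ ∈ List.ofFn r := by simp
  obtain ⟨l, hl, hl1, hl2⟩ := pick_spec (R := fun l l' : List (WEdge (Fin n)) => wt l ≤ wt l')
    (fun _ _ => le_total _ _) (fun _ _ _ => le_trans) (List.ne_nil_of_mem (hmem _ h0 _ h0))
  have : bestTour E r ham p q = l := by rw [bestTour, hl]; rfl
  rw [this]
  obtain ⟨a, -, h⟩ := List.mem_flatMap.1 hl1
  obtain ⟨b, -, rfl⟩ := List.mem_map.1 h
  exact ⟨⟨a, b, rfl⟩, fun a ha b hb => hl2 _ (hmem a ha b hb)⟩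

theorem bestTour_subset (hE : IsEdgeList G w E) (hG : G.Connected) (hk : 1 ≤ k) (p q : Fin n) :
    bestTour E r ham p q ⊆ E := by
  obtain ⟨⟨a, b, h⟩, -⟩ := bestTour_spec (E := E) (r := r) (ham := ham) hk p q
  rw [h]
  exact expandSeq_subset hE hG _ _

theorem pathTree_subset (hE : IsEdgeList G w E) (hG : G.Connected) (p : Fin n) :
    pathTree E p ⊆ E := by
  intro e he
  obtain ⟨u, -, hu⟩ := List.mem_flatMap.1 he
  exact shortestPath_subset hE hG u p (List.mem_of_head? (by simpa using hu))

theorem spannerEdges_subset (hE : IsEdgeList G w E) (hG : G.Connected) (hk : 1 ≤ k) (ε : ℝ≥0) :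
    spannerEdges E r ε ham ⊆ E := by
  intro e he
  obtain ⟨p, -, hp⟩ := List.mem_flatMap.1 he
  rcases List.mem_append.1 hp with h | h
  · exact pathTree_subset hE hG p h
  · obtain ⟨q, -, hq⟩ := List.mem_flatMap.1 h
    exact bestTour_subset hE hG hk p q (sparsify_subset _ hq)

theorem length_flatMap_le {α β : Type} (l : List α) (f : α → List β) (c : ℕ)
    (h : ∀ a ∈ l, (f a).length ≤ c) : (l.flatMap f).length ≤ l.length * c := by
  induction l with
  | nil => simp
  | cons a l ih =>
    have h1 := h a (by simp)
    have h2 := ih fun b hb => h b (by simp [hb])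
    rw [List.flatMap_cons, List.length_append, List.length_cons, Nat.succ_mul]
    omega

theorem length_pathTree_le (E : List (WEdge (Fin n))) (p : Fin n) :
    (pathTree E p).length ≤ n :=
  (length_flatMap_le _ _ 1 fun u _ => by
    cases (shortestPath E u p).head? <;> simp).trans (by simp)

theorem length_spannerEdges_le (ε : ℝ≥0) :
    (spannerEdges E r ε ham).length ≤ (marks E ε (List.ofFn r)).length *
      (n + (marks E ε (List.ofFn r)).length * (2 * n)) := by
  refine length_flatMap_le _ _ _ fun p _ => ?_
  rw [List.length_append]
  refine add_le_add (length_pathTree_le E p) (length_flatMap_le _ _ _ fun q _ => ?_)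
  simpa using length_sparsify_le (bestTour E r ham p q)

/-- The graph of the spanner edges. -/
noncomputable def spannerList (E : List (WEdge (Fin n))) (r : Fin k → Fin n) (ε : ℝ≥0)
    (ham : Fin n → Fin n → List (Fin (k + 2))) : List (Fin n × Fin n) :=
  (spannerEdges E r ε ham).map fun e => (e.1, e.2.1)

theorem adj_graphOfEdges (hE : IsEdgeList G w E) (hG : G.Connected) (hk : 1 ≤ k) {ε : ℝ≥0}
    {e : WEdge (Fin n)} (he : e ∈ spannerEdges E r ε ham) :
    (graphOfEdges (spannerList E r ε ham)).Adj e.1 e.2.1 := by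
  have h := ((hE e).1 (spannerEdges_subset hE hG hk ε he)).1
  exact (SimpleGraph.fromRel_adj _ _ _).2
    ⟨h.ne, .inl (List.mem_map.2 ⟨e, he, rfl⟩)⟩

theorem graphOfEdges_le (hE : IsEdgeList G w E) (hG : G.Connected) (hk : 1 ≤ k) (ε : ℝ≥0) :
    graphOfEdges (spannerList E r ε ham) ≤ G := by
  have key {u v : Fin n} (h : (u, v) ∈ spannerList E r ε ham) : G.Adj u v := by
    obtain ⟨e, he, h⟩ := List.mem_map.1 h
    simp only [Prod.mk.injEq] at h
    obtain ⟨rfl, rfl⟩ := h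
    exact ((hE e).1 (spannerEdges_subset hE hG hk ε he)).1
  intro u v h
  obtain ⟨-, h | h⟩ := (SimpleGraph.fromRel_adj _ _ _).1 h
  · exact key h
  · exact (key h).symm

/-- The detours via marks `x` near `a` and `y` near `b` each cost twice a distance of at most a
quarter of `ε` times the length of `q`, hence `ε` times that length in all. The tour for `(x, y)`
costs no more than the one through `a` and `b`, and its sparsified edges still reach every required
vertex. -/
theorem exists_walk_spanner (hE : IsEdgeList G w E) (hG : G.Connected) (hk : 1 ≤ k) {ε : ℝ≥0}
    (hγ : 1 ≤ γ) (hham : IsHamApprox E r γ ham) {s t : Fin n} (q : G.Walk s t)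
    (hq : ∀ i, r i ∈ q.support) :
    ∃ q' : (graphOfEdges (spannerList E r ε ham)).Walk s t, (∀ i, r i ∈ q'.support) ∧
      (walkWeight w q' : ℝ) ≤ (γ + ε) * walkWeight w q := by
  set H := graphOfEdges (spannerList E r ε ham)
  obtain ⟨a, ha, b, hb, hopt⟩ := exists_hamiltonian_le hE hG hk r q hq
  have hq' : ∀ x ∈ List.ofFn r, x ∈ q.support := by
    intro x hx
    obtain ⟨i, rfl⟩ := (List.mem_ofFn' r x).1 hx
    exact hq i
  obtain ⟨x, hx, hxa⟩ := exists_mark_near hE hG (ε := ε) q hq' ha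
  obtain ⟨y, hy, hyb⟩ := exists_mark_near hE hG (ε := ε) q hq' hb
  obtain ⟨w', hw', π, hπ, hπham, hπopt⟩ := hham a b
  obtain ⟨π', hπ'ham, hle⟩ := hopt w' hw'
  have htree {p : Fin n} (hp : p ∈ marks E ε (List.ofFn r)) (u : Fin n) :
      ∃ q : H.Walk u p, walkWeight w q = pathDist E u p :=
    exists_walk_shortestPath hE hG p (fun v e he => adj_graphOfEdges hE hG hk
      (List.mem_flatMap.2 ⟨p, hp, List.mem_append_left _
        (List.mem_flatMap.2 ⟨v, List.mem_finRange v, by simp [he]⟩)⟩)) u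
  obtain ⟨q1, hq1⟩ := htree hx s
  obtain ⟨q3, hq3⟩ := htree hy t
  obtain ⟨⟨a', b', htour⟩, hbest⟩ := bestTour_spec (E := E) (r := r) (ham := ham) hk x y
  obtain ⟨q2, hq2, hq2v⟩ := exists_walk_sparsify (H := H) w (bestTour E r ham x y)
    (fun e he => ⟨adj_graphOfEdges hE hG hk (List.mem_flatMap.2 ⟨x, hx,
      List.mem_append_right _ (List.mem_flatMap.2 ⟨y, hy, he⟩)⟩),
      ((hE e).1 (bestTour_subset hE hG hk x y (sparsify_subset _ he))).2⟩) x y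
    (by rw [htour]; exact parity_expandSeq hE hG _ _ _)
  refine ⟨q1.append (q2.append q3.reverse), fun i => ?_, ?_⟩
  · rw [SimpleGraph.Walk.mem_support_append_iff, SimpleGraph.Walk.mem_support_append_iff]
    refine .inr (.inl (hq2v _ ?_))
    rw [htour]
    exact joined_expandSeq hE hG _ _ _ (List.mem_append_left _ (hham.mem a' b' i))
  · have hw2 : walkWeight w q2 ≤ pathDist E x a + walkWeight w' π + pathDist E b y := by
      refine hq2.trans ((hbest a ha b hb).trans (le_of_eq ?_))
      rw [tour, wt_expandSeq, ← hπ]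
      exact seqLength_support (pathDist E) _ hw' π x y
    have hopt := hπopt π' hπ'ham
    rw [walkWeight_append, walkWeight_append, walkWeight_reverse, hq1, hq3]
    have t1 := pathDist_triangle hE hG s a x
    have t2 := pathDist_triangle hE hG t b y
    rw [pathDist_comm hE hG x a] at hw2
    rw [pathDist_comm hE hG t b] at t2
    rw [← NNReal.coe_le_coe] at hw2 t1 t2 hle hxa hyb
    push_cast at *
    have p1 : (0 : ℝ) ≤ pathDist E s a := NNReal.coe_nonneg _
    have p2 : (0 : ℝ) ≤ pathDist E b t := NNReal.coe_nonneg _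
    -- Because `γ ≥ 1`, the exact end pieces may be multiplied by `γ` as well, so that `hle` times
    -- `γ` bounds all three parts at once.
    have p3 : (pathDist E s a : ℝ) ≤ γ * pathDist E s a := le_mul_of_one_le_left p1 hγ
    have p4 : (pathDist E b t : ℝ) ≤ γ * pathDist E b t := le_mul_of_one_le_left p2 hγ
    have p5 := mul_le_mul_of_nonneg_left hle (zero_le_one.trans hγ)
    rw [mul_add, mul_add] at p5
    rw [add_mul]
    linarith

theorem isGroupSteinerSpanner_spannerList (hE : IsEdgeList G w E) (hG : G.Connected) (hk : 1 ≤ k)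
    {ε : ℝ≥0} (hγ : 1 ≤ γ) (hham : IsHamApprox E r γ ham) :
    IsGroupSteinerSpanner G w (fun i : Fin k => ({r i} : Set (Fin n))) (γ + ε)
      (graphOfEdges (spannerList E r ε ham)) := by
  refine ⟨graphOfEdges_le hE hG hk ε, fun s t => ?_⟩
  have hpos : 0 < γ + ε := by positivity
  -- A nonzero finite factor can be moved inside the infimum, also when no admissible walk exists.
  have h0 : ENNReal.ofReal (γ + ε) ≠ 0 := by simpa using hpos
  rw [groupSteinerDist, groupSteinerDist]
  simp only [ENNReal.mul_iInf_of_ne h0 ENNReal.ofReal_ne_top]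
  refine le_iInf₂ fun q hq => ?_
  obtain ⟨q', hq', hle⟩ := exists_walk_spanner hE hG hk (ε := ε) hγ hham q fun i => by
    obtain ⟨v, hv, hvi⟩ := hq i
    exact Set.mem_singleton_iff.1 hvi ▸ hv
  refine (iInf₂_le q' fun i => ⟨r i, hq' i, rfl⟩).trans ?_
  rw [← ENNReal.ofReal_coe_nnreal, ← ENNReal.ofReal_coe_nnreal, ← ENNReal.ofReal_mul hpos.le]
  exact ENNReal.ofReal_le_ofReal hle

theorem ncard_graphOfEdges_le (l : List (Fin n × Fin n)) :
    (graphOfEdges l).edgeSet.ncard ≤ l.length := by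
  have hsub : (graphOfEdges l).edgeSet ⊆ ((l.map fun e => s(e.1, e.2)).toFinset : Set _) := by
    intro e
    refine Sym2.ind (fun u v h => ?_) e
    obtain ⟨-, h | h⟩ := (SimpleGraph.fromRel_adj _ _ _).1 (SimpleGraph.mem_edgeSet _ |>.1 h)
    · simpa using ⟨u, v, h, by simp⟩
    · simpa using ⟨v, u, h, by simp⟩
  refine (Set.ncard_le_ncard hsub (Finset.finite_toSet _)).trans ?_
  rw [Set.ncard_coe_finset]
  exact (List.toFinset_card_le _).trans (by simp)

theorem ncard_spannerList_le (E : List (WEdge (Fin n))) (r : Fin k → Fin n) {ε : ℝ≥0} (h0 : 0 < ε)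
    (h1 : ε ≤ 1) (ham : Fin n → Fin n → List (Fin (k + 2))) :
    ((graphOfEdges (spannerList E r ε ham)).edgeSet.ncard : ℝ) ≤ 55 * n / (ε : ℝ) ^ 2 := by
  have hlen : (graphOfEdges (spannerList E r ε ham)).edgeSet.ncard ≤
      (marks E ε (List.ofFn r)).length * (n + (marks E ε (List.ofFn r)).length * (2 * n)) :=
    (ncard_graphOfEdges_le _).trans (by
      rw [spannerList, List.length_map]; exact length_spannerEdges_le ε)
  have hm := length_marks_mul_le E h1 (List.ofFn r)
  generalize (marks E ε (List.ofFn r)).length = m at hlen hm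
  rw [← NNReal.coe_le_coe] at hm h1
  have h0 : (0 : ℝ) < ε := h0
  push_cast at hm h1
  rw [le_div_iff₀ (by positivity)]
  have hlen' : ((graphOfEdges (spannerList E r ε ham)).edgeSet.ncard : ℝ) ≤
      m * (n + m * (2 * n)) := by exact_mod_cast hlen
  -- By `m * ε ≤ 5` and `ε ≤ 1` the trees contribute `5 * n` and the tours `2 * 25 * n`.
  calc _ ≤ (m : ℝ) * (n + m * (2 * n)) * (ε : ℝ) ^ 2 := by gcongr
    _ = (m * ε) * n * ε + (m * ε) * (m * ε) * (2 * n) := by ring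
    _ ≤ 5 * n * 1 + 5 * 5 * (2 * n) := by gcongr
    _ = 55 * n := by ring

end Spanner

/-! ## Inputs and their sizes -/

/-- The inputs of the spanner problem. -/
structure SpannerInput (M : NumModel) where
  n : ℕ
  k : ℕ
  G : SimpleGraph (Fin n)
  w : Sym2 (Fin n) → ℝ≥0
  r : Fin k → Fin n
  ε : ℝ≥0
  connected : G.Connected
  one_le_k : 1 ≤ k
  admissible : AdmissibleWeights M G w
  ε_mem : (ε : ℝ) ∈ M.numbers

theorem length_le_size_ofList (M : NumModel) (l : List Val) : l.length ≤ (Val.ofList l).size M := by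
  induction l with
  | nil => simp
  | cons a l ih =>
    rw [Val.ofList, Val.size, List.length_cons]
    omega

theorem size_le_size_ofList (M : NumModel) {l : List Val} {a : Val} (ha : a ∈ l) :
    a.size M ≤ (Val.ofList l).size M := by
  induction l with
  | nil => simp at ha
  | cons b l ih =>
    rw [Val.ofList, Val.size]
    rcases List.mem_cons.1 ha with rfl | ha
    · omega
    · have := ih ha; omega

theorem size_ofList_le (M : NumModel) {l : List Val} {B : ℕ} (h : ∀ a ∈ l, a.size M ≤ B) :
    (Val.ofList l).size M ≤ 1 + M.bits 0 + l.length * (1 + B) := by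
  induction l with
  | nil => simp [Val.ofList, Val.size]
  | cons a l ih =>
    have h1 := h a (by simp)
    have h2 := ih fun b hb => h b (by simp [hb])
    rw [Val.ofList, Val.size, List.length_cons, Nat.succ_mul]
    omega

namespace SpannerInput

variable {M : NumModel}

noncomputable def size (I : SpannerInput M) : ℕ := (encodeSpannerInput I.G I.w I.r I.ε).size M

open Classical in
/-- The edges of the graph in both orientations. -/
noncomputable def edges (I : SpannerInput M) : List (WEdge (Fin I.n)) :=
  (List.finRange I.n).flatMap fun u => (List.finRange I.n).flatMap fun v =>
    if I.G.Adj u v then [(u, v, I.w s(u, v))] else []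

theorem isEdgeList (I : SpannerInput M) : IsEdgeList I.G I.w I.edges := by
  rintro ⟨u, v, x⟩
  simp only [edges, List.mem_flatMap, List.mem_finRange, true_and]
  constructor
  · rintro ⟨u', v', h⟩
    split_ifs at h with h'
    · simp only [List.mem_singleton, Prod.mk.injEq] at h
      obtain ⟨rfl, rfl, rfl⟩ := h
      exact ⟨h', rfl⟩
    · simp at h
  · rintro ⟨h1, h2⟩
    exact ⟨u, v, by simp_all⟩

theorem size_matrix_le (I : SpannerInput M) : (encodeGraph I.G I.w).size M ≤ I.size := by
  rw [size, encodeSpannerInput, Val.size]; omega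

theorem n_le_size (I : SpannerInput M) : I.n ≤ I.size := by
  refine le_trans ?_ I.size_matrix_le
  refine le_trans ?_ (length_le_size_ofList M _)
  simp

theorem k_le_size (I : SpannerInput M) : I.k ≤ I.size := by
  have h : I.k ≤ (encodeVertices (List.ofFn I.r)).size M :=
    le_trans (by simp) (length_le_size_ofList M _)
  rw [size, encodeSpannerInput, Val.size, Val.size]; omega

theorem bits_ε_le (I : SpannerInput M) : M.bits I.ε ≤ I.size := by
  rw [size, encodeSpannerInput, Val.size, Val.size, Val.size]; omega

theorem bits_edge_le (I : SpannerInput M) : ∀ e ∈ I.edges,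
    (e.2.2 : ℝ) ∈ M.numbers ∧ M.bits e.2.2 ≤ I.size := by
  rintro ⟨u, v, x⟩ he
  obtain ⟨hadj, hx⟩ := (I.isEdgeList _).1 he
  simp only at hadj hx
  subst hx
  refine ⟨I.admissible _ hadj, le_trans ?_ I.size_matrix_le⟩
  refine le_trans ?_ (size_le_size_ofList M (List.mem_ofFn.2 ⟨u, rfl⟩))
  refine le_trans ?_ (size_le_size_ofList M (List.mem_ofFn.2 ⟨v, rfl⟩))
  rw [if_pos hadj, Val.size, Val.size, Val.size]
  dsimp only
  omega

theorem length_edges_le (I : SpannerInput M) : I.edges.length ≤ I.size * I.size := by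
  have h : I.edges.length ≤ I.n * (I.n * 1) := by
    refine (length_flatMap_le _ _ _ fun u _ => length_flatMap_le _ _ 1 fun v _ => ?_).trans
      (by simp)
    split_ifs <;> simp
  exact h.trans (by rw [mul_one]; exact Nat.mul_le_mul I.n_le_size I.n_le_size)

theorem bits_wt_le (I : SpannerInput M) {l : List (WEdge (Fin I.n))} (hl : l ⊆ I.edges) :
    (wt l : ℝ) ∈ M.numbers ∧ M.bits (wt l) ≤ l.length * (2 * I.size + 1) + 2 := by
  have h := M.bits_sum_le I.size (l.map fun e => e.2.2) fun x hx => by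
    obtain ⟨e, he, rfl⟩ := List.mem_map.1 hx
    exact I.bits_edge_le e (hl he)
  rwa [List.length_map] at h

/-- The internal form of an input has an edge list in place of the matrix and omits the proofs.
Running times are still measured by the size of the original encoding. -/
noncomputable instance : Enc (SpannerInput M) :=
  ⟨fun I => enc (I.edges, List.finRange I.n, I.r, I.ε)⟩

end SpannerInput

/-- Unlike `shortestPath_subset` this applies during the run, where the compared path weights must
have polynomial bit length. -/
theorem DijkstraInv.subset {n : ℕ} {G : SimpleGraph (Fin n)} {w : Sym2 (Fin n) → ℝ≥0}
    {E : List (WEdge (Fin n))} {p : Fin n} {i : ℕ} {st : PathTable n}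
    (h : DijkstraInv G w E p i st) {u : Fin n} {l : List (WEdge (Fin n))} (hu : st u = some l) :
    l ⊆ E := by
  induction l generalizing u with
  | nil => simp
  | cons e l ih =>
    rcases h.first u _ hu with ⟨h1, -⟩ | ⟨f, l', h1, -, h2, h3⟩
    · simp at h1
    · obtain ⟨rfl, rfl⟩ := List.cons.inj h1
      exact List.cons_subset.2 ⟨h2, ih h3⟩

namespace PolyTime

/-! ## The parts of the algorithm run in polynomial time -/

variable {M : NumModel} {X : Type} {e : X → Val} {I : X → SpannerInput M}

theorem bdd_n (I : X → SpannerInput M) : PolyBdd (fun x => (I x).size) (fun x => (I x).n) :=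
  PolyBdd.self.mono fun x => (I x).n_le_size

theorem bdd_k (I : X → SpannerInput M) : PolyBdd (fun x => (I x).size) (fun x => (I x).k) :=
  PolyBdd.self.mono fun x => (I x).k_le_size

theorem bdd_edges (I : X → SpannerInput M) :
    PolyBdd (fun x => (I x).size) (fun x => (I x).edges.length) :=
  (PolyBdd.self.mul .self).mono fun x => (I x).length_edges_le

theorem input_data (hI : PolyTime M (fun x => (I x).size) e I) :
    PolyTime M (fun x => (I x).size) e
    (fun x => ((I x).edges, List.finRange (I x).n, (I x).r, (I x).ε)) :=
  hI.congr_enc fun _ => rfl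

theorem edges (hI : PolyTime M (fun x => (I x).size) e I) :
    PolyTime M (fun x => (I x).size) e (fun x => (I x).edges) := hI.input_data.fst

theorem vertices (hI : PolyTime M (fun x => (I x).size) e I) :
    PolyTime M (fun x => (I x).size) e (fun x => List.finRange (I x).n) :=
  hI.input_data.snd.fst

theorem required (hI : PolyTime M (fun x => (I x).size) e I) :
    PolyTime M (fun x => (I x).size) e (fun x => (I x).r) :=
  hI.input_data.snd.snd.fst

theorem accuracy (hI : PolyTime M (fun x => (I x).size) e I) :
    PolyTime M (fun x => (I x).size) e (fun x => (I x).ε) :=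
  hI.input_data.snd.snd.snd

theorem requiredList (hI : PolyTime M (fun x => (I x).size) e I) :
    PolyTime M (fun x => (I x).size) e (fun x => List.ofFn (I x).r) :=
  (hI.required.table.map (f := fun _ p => p.2) ((bdd_k I).mono fun _ => by simp)
    fun _ _ _ _ _ _ ha => ha.snd).congr fun x => by
      rw [List.map_map, List.ofFn_eq_map]; rfl

theorem bits_wt {l : ∀ x, List (WEdge (Fin (I x).n))} (hsub : ∀ x, l x ⊆ (I x).edges)
    (hlen : PolyBdd (fun x => (I x).size) fun x => (l x).length) :
    PolyBdd (fun x => (I x).size) fun x => M.bits (wt (l x)) :=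
  ((hlen.mul (((PolyBdd.const 2).mul .self).add (.const 1))).add (.const 2)).mono
    fun x => ((I x).bits_wt_le (hsub x)).2

/-- Each partial sum is again the weight of a list of input edges, of length the number of rounds;
so `bits_wt` bounds the operands of every addition. -/
theorem weight {l : ∀ x, List (WEdge (Fin (I x).n))} (hsub : ∀ x, l x ⊆ (I x).edges)
    (hlen : PolyBdd (fun x => (I x).size) fun x => (l x).length)
    (hl : PolyTime M (fun x => (I x).size) e l) :
    PolyTime M (fun x => (I x).size) e (fun x => wt (l x)) := by
  refine (foldl (A := fun x => WEdge (Fin (I x).n)) (B := fun _ => ℝ≥0)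
    (b := fun _ => 0) (step := fun _ s a => s + a.2.2)
    (fun x i s => ∃ L : List (WEdge (Fin (I x).n)), L ⊆ (I x).edges ∧ L.length = i ∧ s = wt L)
    hl zero_nnreal hlen (fun x => ⟨[], by simp, rfl, rfl⟩) ?_ ?_).congr ?_
  · rintro x i s a - ha ⟨L, h1, h2, rfl⟩
    exact ⟨a :: L, List.cons_subset.2 ⟨hsub x ha, h1⟩, by simp [h2], by rw [wt_cons, add_comm]⟩
  · intro Y φ e' i s a hi hmem hs he hs' ha
    refine nnreal_add hs' ha.snd.snd ?_
      (PolyBdd.self.mono fun y => ((I (φ y)).bits_edge_le _ (hsub _ (hmem y))).2)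
    choose L h1 h2 h3 using hs
    simp only [h3]
    exact bits_wt (I := fun y => I (φ y)) h1
      ((hlen.reindex φ).mono fun y => by rw [h2 y]; exact (hi y).le)
  · intro x
    rw [wt, List.sum_eq_foldl, List.foldl_map]

/-! ### Shortest paths -/

variable {u p q : ∀ x, Fin (I x).n}

theorem pathExtensions {st : ∀ x, PathTable (I x).n} (hI : PolyTime M (fun x => (I x).size) e I)
    (hst : PolyTime M (fun x => (I x).size) e st) :
    PolyTime M (fun x => (I x).size) e (fun x => pathExtensions (I x).edges (st x)) := by
  refine flatMap (f := fun x e => if (st x e.1).isSome = true then [] else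
    (st x e.2.1).elim [] fun l => [(e, l)]) hI.edges (bdd_edges I) ?_
  intro Y φ e' a hmem he ha
  constructor
  · refine ite ((isSome (apply (bdd_n fun y => I (φ y)) (hst.lift he) ha.fst)).congr
      fun y => by simp) nil ?_
    refine option_cases (g := fun y o => o.elim [] fun l => [(a y, l)])
      (apply (bdd_n fun y => I (φ y)) (hst.lift he) ha.snd.fst) ?_ ?_
    · intro Z ψ e'' _ he'
      exact nil
    · intro Z ψ e'' l _ he' hl
      exact ((ha.lift he').pair hl).cons nil
  · refine (PolyBdd.const 1).mono fun y => ?_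
    split_ifs
    · simp
    · cases st (φ y) (a y).2.1 <;> simp

/-- The invariant bounds stored paths to at most `n` edges of the graph, and thereby the cost of
comparing extensions. -/
theorem dijkstraStep {st : ∀ x, PathTable (I x).n} (hI : PolyTime M (fun x => (I x).size) e I)
    (hst : PolyTime M (fun x => (I x).size) e st)
    (hinv : ∀ x, ∃ i ≤ (I x).n, DijkstraInv (I x).G (I x).w (I x).edges (p x) i (st x)) :
    PolyTime M (fun x => (I x).size) e (fun x => dijkstraStep (I x).edges (st x)) := by
  refine option_cases (g := fun x o => o.elim (st x)
    fun c => Function.update (st x) c.1.1 (Option.some (c.1 :: c.2)))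
    (pick (R := fun x a b => wt (a.1 :: a.2) ≤ wt (b.1 :: b.2)) (pathExtensions hI hst) ?_ ?_) ?_ ?_
  · refine (bdd_edges I).mono fun x => (length_flatMap_le _ _ 1 fun e _ => ?_).trans (by simp)
    split_ifs
    · simp
    · cases st x e.2.1 <;> simp
  · intro Y φ e' a b ha hb he ha' hb'
    have key (c : ∀ y, WEdge (Fin (I (φ y)).n) × List (WEdge (Fin (I (φ y)).n)))
        (hc : ∀ y, c y ∈ GroupSteiner.pathExtensions (I (φ y)).edges (st (φ y))) :
        (∀ y, (c y).1 :: (c y).2 ⊆ (I (φ y)).edges) ∧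
        PolyBdd (fun y => (I (φ y)).size) (fun y => ((c y).1 :: (c y).2).length) := by
      refine ⟨fun y => ?_, ((bdd_n fun y => I (φ y)).add (.const 1)).mono fun y => ?_⟩ <;>
        obtain ⟨h1, h2, h3⟩ := mem_pathExtensions.1 (hc y) <;>
        obtain ⟨i, hi, hD⟩ := hinv (φ y)
      · exact List.cons_subset.2 ⟨h1, hD.subset h3⟩
      · have := hD.length _ _ h3
        simp only [List.length_cons]
        omega
    obtain ⟨ha1, ha2⟩ := key a ha
    obtain ⟨hb1, hb2⟩ := key b hb
    exact nnreal_le (weight ha1 ha2 (ha'.fst.cons ha'.snd)) (weight hb1 hb2 (hb'.fst.cons hb'.snd))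
      (bits_wt ha1 ha2) (bits_wt hb1 hb2)
  · intro Y φ e' _ he
    exact hst.lift he
  · intro Y φ e' c _ he hc
    exact update (bdd_n fun y => I (φ y)) (hst.lift he) hc.fst.fst (hc.fst.cons hc.snd).some

theorem dijkstra (hI : PolyTime M (fun x => (I x).size) e I)
    (hp : PolyTime M (fun x => (I x).size) e p) :
    PolyTime M (fun x => (I x).size) e (fun x => dijkstra (I x).edges (p x)) := by
  refine foldl (A := fun x => Fin (I x).n) (B := fun x => PathTable (I x).n)
    (step := fun x st _ => GroupSteiner.dijkstraStep (I x).edges st)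
    (fun x i st => i ≤ (I x).n ∧ DijkstraInv (I x).G (I x).w (I x).edges (p x) i st)
    hI.vertices ?_ ((bdd_n I).mono fun x => by simp) (fun x => ⟨Nat.zero_le _, .init _⟩)
    (fun x i st _ hi _ h => ⟨by simpa using hi, h.2.step (I x).isEdgeList (I x).connected⟩) ?_
  · exact update (bdd_n I) (tabulate (bdd_n I) hI.vertices fun _ _ _ _ _ _ => none) hp nil.some
  · intro Y φ e' i st a _ _ h he hst _
    exact dijkstraStep (I := fun y => I (φ y)) (hI.lift he) hst fun y => ⟨i y, h y⟩

theorem shortestPath (hI : PolyTime M (fun x => (I x).size) e I)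
    (hu : PolyTime M (fun x => (I x).size) e u) (hp : PolyTime M (fun x => (I x).size) e p) :
    PolyTime M (fun x => (I x).size) e (fun x => shortestPath (I x).edges (u x) (p x)) :=
  option_cases (g := fun _ o => o.elim [] id) (apply (bdd_n I) (dijkstra hI hp) hu)
    (fun _ _ _ _ _ => nil) (fun _ _ _ _ _ _ hl => hl)

theorem bdd_shortestPath (I : X → SpannerInput M) (u p : ∀ x, Fin (I x).n) :
    PolyBdd (fun x => (I x).size)
      (fun x => (GroupSteiner.shortestPath (I x).edges (u x) (p x)).length) :=
  (bdd_n I).mono fun x => length_shortestPath_le (I x).isEdgeList (I x).connected _ _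

theorem pathDist (hI : PolyTime M (fun x => (I x).size) e I)
    (hu : PolyTime M (fun x => (I x).size) e u) (hp : PolyTime M (fun x => (I x).size) e p) :
    PolyTime M (fun x => (I x).size) e (fun x => pathDist (I x).edges (u x) (p x)) :=
  weight (fun x => shortestPath_subset (I x).isEdgeList (I x).connected _ _)
    (bdd_shortestPath I u p) (shortestPath hI hu hp)

theorem bits_pathDist (I : X → SpannerInput M) (u p : ∀ x, Fin (I x).n) :
    PolyBdd (fun x => (I x).size)
      (fun x => M.bits (GroupSteiner.pathDist (I x).edges (u x) (p x))) :=
  bits_wt (fun x => shortestPath_subset (I x).isEdgeList (I x).connected _ _)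
    (bdd_shortestPath I u p)

theorem expandSeq {l : ∀ x, List (Fin (I x).n)} (hI : PolyTime M (fun x => (I x).size) e I)
    (hp : PolyTime M (fun x => (I x).size) e p) (hl : PolyTime M (fun x => (I x).size) e l)
    (hlen : PolyBdd (fun x => (I x).size) fun x => (l x).length) :
    PolyTime M (fun x => (I x).size) e (fun x => expandSeq (I x).edges (p x) (l x)) := by
  have h := foldl (A := fun x => Fin (I x).n) (B := fun x => Fin (I x).n × List (WEdge (Fin (I x).n)))
    (b := fun x => (p x, []))
    (step := fun x s a => (a, s.2 ++ GroupSteiner.shortestPath (I x).edges s.1 a))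
    (fun x i s => s.2.length ≤ i * (I x).n) hl (hp.pair nil) hlen (fun x => by simp)
    (fun x i s a _ _ h => by
      have := length_shortestPath_le (I x).isEdgeList (I x).connected s.1 a
      simp only [List.length_append, Nat.succ_mul]
      omega)
    (fun Y φ e' i s a hi _ hs he hs' ha => ha.pair
      (append hs'.snd (shortestPath (I := fun y => I (φ y)) (hI.lift he) hs'.fst ha)
        (((hlen.reindex φ).mul (bdd_n fun y => I (φ y))).mono fun y =>
          (hs y).trans (Nat.mul_le_mul_right _ (hi y).le))))
  refine h.snd.congr fun x => ?_
  have key (l : List (Fin (I x).n)) (p : Fin (I x).n) (L : List (WEdge (Fin (I x).n))) :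
      (l.foldl (fun s a => (a, s.2 ++ GroupSteiner.shortestPath (I x).edges s.1 a)) (p, L)).2 =
        L ++ GroupSteiner.expandSeq (I x).edges p l := by
    induction l generalizing p L with
    | nil => simp [GroupSteiner.expandSeq]
    | cons a l ih => simp [ih, GroupSteiner.expandSeq]
  exact key _ _ _

/-! ### Marks -/

theorem nearestDist {m : ∀ x, List (Fin (I x).n)} (hI : PolyTime M (fun x => (I x).size) e I)
    (hm : PolyTime M (fun x => (I x).size) e m)
    (hlen : PolyBdd (fun x => (I x).size) fun x => (m x).length)
    (hu : PolyTime M (fun x => (I x).size) e u) :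
    PolyTime M (fun x => (I x).size) e (fun x => nearestDist (I x).edges (m x) (u x)) ∧
    PolyBdd (fun x => (I x).size)
      (fun x => M.bits (GroupSteiner.nearestDist (I x).edges (m x) (u x))) := by
  constructor
  · refine option_cases (g := fun _ o => o.elim 0 id)
      (pick (A := fun _ => ℝ≥0) (R := fun _ a b => a ≤ b)
        (map (B := fun _ => ℝ≥0) (f := fun x a => GroupSteiner.pathDist (I x).edges (u x) a)
          hm hlen fun Y φ e' a _ he ha =>
            pathDist (I := fun y => I (φ y)) (hI.lift he) (hu.lift he) ha)
        (hlen.mono fun x => by simp) ?_)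
      (fun _ _ _ _ _ => zero_nnreal) (fun _ _ _ _ _ _ hl => hl)
    intro Y φ e' a b ha hb he ha' hb'
    have key (c : Y → ℝ≥0) (hc : ∀ y, c y ∈
        (m (φ y)).map fun a => GroupSteiner.pathDist (I (φ y)).edges (u (φ y)) a) :
        PolyBdd (fun y => (I (φ y)).size) fun y => M.bits (c y) := by
      choose v _ hv2 using fun y => List.mem_map.1 (hc y)
      simp only [← hv2]
      exact bits_pathDist (fun y => I (φ y)) _ _
    exact nnreal_le ha' hb' (key a ha) (key b hb)
  · have h0 : PolyBdd (fun x => (I x).size) fun x => M.bits ((0 : ℝ≥0) : ℝ) := .const _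
    have hbits : ∀ x, ∃ v : Fin (I x).n, M.bits (GroupSteiner.nearestDist (I x).edges (m x) (u x)) ≤
        M.bits ((0 : ℝ≥0) : ℝ) + M.bits (GroupSteiner.pathDist (I x).edges (u x) v) := by
      intro x
      rcases eq_or_ne (m x) [] with h | h
      · exact ⟨u x, by rw [h]; exact Nat.le_add_right _ _⟩
      · obtain ⟨⟨v, -, hv⟩, -⟩ := nearestDist_spec (I x).edges h (u x)
        exact ⟨v, by rw [hv]; exact Nat.le_add_left _ _⟩
    choose v hv using hbits
    exact (h0.add (bits_pathDist I u v)).mono hv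

theorem farthest {R m : ∀ x, List (Fin (I x).n)} (hI : PolyTime M (fun x => (I x).size) e I)
    (hR : PolyTime M (fun x => (I x).size) e R)
    (hlenR : PolyBdd (fun x => (I x).size) fun x => (R x).length)
    (hm : PolyTime M (fun x => (I x).size) e m)
    (hlen : PolyBdd (fun x => (I x).size) fun x => (m x).length) :
    PolyTime M (fun x => (I x).size) e (fun x => farthest (I x).edges (R x) (m x)) := by
  refine pick (R := fun x a b => GroupSteiner.nearestDist (I x).edges (m x) b ≤
    GroupSteiner.nearestDist (I x).edges (m x) a) hR hlenR ?_
  intro Y φ e' a b _ _ he ha hb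
  obtain ⟨h1, h2⟩ := nearestDist (I := fun y => I (φ y)) (hI.lift he) (hm.lift he)
    (hlen.reindex φ) hb
  obtain ⟨h3, h4⟩ := nearestDist (I := fun y => I (φ y)) (hI.lift he) (hm.lift he)
    (hlen.reindex φ) ha
  exact nnreal_le h1 h3 h2 h4

theorem marks (hI : PolyTime M (fun x => (I x).size) e I) :
    PolyTime M (fun x => (I x).size) e
      (fun x => marks (I x).edges (I x).ε (List.ofFn (I x).r)) := by
  have hne (x) : List.ofFn (I x).r ≠ [] := by
    rw [Ne, List.ofFn_eq_nil_iff]; have := (I x).one_le_k; omega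
  refine snd (f := fun x => marksState (I x).edges (I x).ε (List.ofFn (I x).r)) ?_
  refine foldl (A := fun x => Fin (I x).n) (B := fun x => ℝ≥0 × List (Fin (I x).n))
    (step := fun x s _ => marksStep (I x).edges (I x).ε (List.ofFn (I x).r) s)
    (fun x i s => MarksInv (I x).edges (I x).ε (List.ofFn (I x).r) i s)
    hI.requiredList (zero_nnreal.pair nil) ((bdd_k I).mono fun x => by simp)
    (fun x => ⟨by simp, by simp, by simp, by simp, by simp, by simp⟩)
    (fun x i s _ _ _ h => h.step (hne x)) ?_
  intro Y φ e' i s a hi _ hs he hs' _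
  have hlen : PolyBdd (fun y => (I (φ y)).size) fun y => (s y).2.length :=
    (bdd_k fun y => I (φ y)).mono fun y =>
      (hs y).length_le.trans (by simpa using (hi y).le)
  -- The accumulated product equals a sum of copies of `ε`, one per mark, so the bound for sums
  -- applies; no multiplication or division is ever performed.
  have hbits : PolyBdd (fun y => (I (φ y)).size) fun y => M.bits (s y).1 := by
    refine ((hlen.mul (((PolyBdd.const 2).mul .self).add (.const 1))).add (.const 2)).mono
      fun y => ?_
    have h := (M.bits_sum_le (I (φ y)).size (List.replicate (s y).2.length (I (φ y)).ε)
      fun x hx => (List.eq_of_mem_replicate hx) ▸ ⟨(I (φ y)).ε_mem, (I (φ y)).bits_ε_le⟩).2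
    rw [List.sum_replicate, List.length_replicate, nsmul_eq_mul, ← (hs y).acc] at h
    exact h
  refine ite (p := fun y => 4 ≤ (s y).1) (nnreal_le ?_ hs'.fst ?_ hbits) hs' ?_
  · exact ((nat_const 4).nat_cast).congr fun _ => by norm_num
  · exact .const _
  · refine option_cases (g := fun y o => o.elim (s y) fun p => ((s y).1 + (I (φ y)).ε, p :: (s y).2))
      (farthest (I := fun y => I (φ y)) (hI.lift he) (hI.lift he).requiredList
        ((bdd_k fun y => I (φ y)).mono fun y => by simp) hs'.snd hlen) ?_ ?_
    · intro Z ψ e'' _ he'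
      exact hs'.lift he'
    · intro Z ψ e'' c _ he' hc
      exact (nnreal_add (hs'.lift he').fst ((hI.lift he).lift he').accuracy (hbits.reindex ψ)
        (PolyBdd.self.mono fun z => (I (φ (ψ z))).bits_ε_le)).pair (hc.cons (hs'.lift he').snd)

theorem bdd_marks (I : X → SpannerInput M) : PolyBdd (fun x => (I x).size)
    fun x => (GroupSteiner.marks (I x).edges (I x).ε (List.ofFn (I x).r)).length :=
  (bdd_k I).mono fun x => (length_marks_le _ _ _).trans (by simp)

/-! ### Sparsification -/

theorem forest {l : ∀ x, List (WEdge (Fin (I x).n))} (hI : PolyTime M (fun x => (I x).size) e I)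
    (hl : PolyTime M (fun x => (I x).size) e l)
    (hlen : PolyBdd (fun x => (I x).size) fun x => (l x).length) :
    PolyTime M (fun x => (I x).size) e (fun x => forest (l x)) := by
  refine foldl (A := fun x => WEdge (Fin (I x).n))
    (B := fun x => (Fin (I x).n → Fin (I x).n) × List (WEdge (Fin (I x).n)) ×
      List (WEdge (Fin (I x).n)))
    (step := fun _ => forestStep) (fun _ _ _ => True) hl ?_ hlen (fun _ => trivial)
    (fun _ _ _ _ _ _ _ => trivial) ?_
  · exact (tabulate (f := fun _ i => i) (bdd_n I) hI.vertices fun _ _ _ _ _ hi => hi).pair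
      (nil.pair nil)
  · intro Y φ e' i s a _ _ _ he hs ha
    have hn := bdd_n fun y => I (φ y)
    refine ite (fin_eq hn (apply hn hs.fst ha.fst) (apply hn hs.fst ha.snd.fst))
      (hs.fst.pair (hs.snd.fst.pair (ha.cons hs.snd.snd))) (PolyTime.pair ?_
        ((ha.cons hs.snd.fst).pair hs.snd.snd))
    refine tabulate (f := fun y v => if (s y).1 v = (s y).1 (a y).1 then (s y).1 (a y).2.1
      else (s y).1 v) hn (hI.lift he).vertices ?_
    intro Z ψ e'' v he' hv
    have hs := hs.lift he'
    have ha := ha.lift he'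
    have hn := hn.reindex ψ
    exact ite (fin_eq hn (apply hn hs.fst hv) (apply hn hs.fst ha.fst))
      (apply hn hs.fst ha.snd.fst) (apply hn hs.fst hv)

theorem sparsify {l : ∀ x, List (WEdge (Fin (I x).n))} (hI : PolyTime M (fun x => (I x).size) e I)
    (hl : PolyTime M (fun x => (I x).size) e l)
    (hlen : PolyBdd (fun x => (I x).size) fun x => (l x).length) :
    PolyTime M (fun x => (I x).size) e (fun x => sparsify (l x)) := by
  have h := forest hI hl hlen
  refine append h.snd.fst (forest hI h.snd.snd (hlen.mono fun x => ?_)).snd.fst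
    ((bdd_n I).mono fun x => by simpa using length_forest_le (l x))
  have := (forest_spec (l x)).1.length_eq
  rw [List.length_append] at this
  omega

/-! ### Tours -/

theorem hamPoints (hI : PolyTime M (fun x => (I x).size) e I)
    (hu : PolyTime M (fun x => (I x).size) e u) (hp : PolyTime M (fun x => (I x).size) e p) :
    PolyTime M (fun x => (I x).size) e (fun x => hamPoints (I x).r (u x) (p x)) :=
  of_ofFn ((bdd_k I).add (.const 2)) <| (hu.cons (hp.cons hI.requiredList)).congr fun x => by
    rw [List.ofFn_succ, List.ofFn_succ]; rfl

/-- The paths `ham` can be computed in polynomial time, and their lengths are polynomial. -/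
structure HamPolyTime (M : NumModel)
    (ham : ∀ I : SpannerInput M, Fin I.n → Fin I.n → List (Fin (I.k + 2))) : Prop where
  length_le : ∀ I a b, (ham I a b).length ≤ I.k + 2
  polyTime : ∀ {X : Type} {e : X → Val} {I : X → SpannerInput M} {a b : ∀ x, Fin (I x).n},
    PolyTime M (fun x => (I x).size) e I → PolyTime M (fun x => (I x).size) e a →
    PolyTime M (fun x => (I x).size) e b →
    PolyTime M (fun x => (I x).size) e (fun x => ham (I x) (a x) (b x))

variable {ham : ∀ I : SpannerInput M, Fin I.n → Fin I.n → List (Fin (I.k + 2))}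

theorem tour {a b : ∀ x, Fin (I x).n} (hham : HamPolyTime M ham)
    (hI : PolyTime M (fun x => (I x).size) e I)
    (hp : PolyTime M (fun x => (I x).size) e p) (hq : PolyTime M (fun x => (I x).size) e q)
    (ha : PolyTime M (fun x => (I x).size) e a) (hb : PolyTime M (fun x => (I x).size) e b) :
    PolyTime M (fun x => (I x).size) e
      (fun x => tour (I x).edges (I x).r (ham (I x)) (p x) (q x) (a x) (b x)) := by
  have hk := (bdd_k I).add (.const 2)
  have hlen : PolyBdd (fun x => (I x).size) fun x =>
      ((ham (I x) (a x) (b x)).map (GroupSteiner.hamPoints (I x).r (a x) (b x))).length :=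
    hk.mono fun x => by rw [List.length_map]; exact hham.length_le _ _ _
  refine expandSeq hI hp (append (map (hham.polyTime hI ha hb)
    (hk.mono fun x => hham.length_le _ _ _) ?_) (hq.cons nil) hlen)
    ((hlen.add (.const 1)).mono fun x => by simp)
  intro Y φ e' i _ he hi
  exact apply (hk.reindex φ) ((hamPoints hI ha hb).lift he) hi

theorem length_tour_le (hham : HamPolyTime M ham) (I : SpannerInput M) (p q a b : Fin I.n) :
    (GroupSteiner.tour I.edges I.r (ham I) p q a b).length ≤ (I.k + 3) * I.n := by
  refine (length_expandSeq_le I.isEdgeList I.connected _ _).trans (Nat.mul_le_mul_right _ ?_)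
  have := hham.length_le I a b
  simp only [List.length_append, List.length_map, List.length_singleton]
  omega

theorem bdd_tour (I : X → SpannerInput M) :
    PolyBdd (fun x => (I x).size) fun x => ((I x).k + 3) * (I x).n :=
  ((bdd_k I).add (.const 3)).mul (bdd_n I)

theorem bestTour (hham : HamPolyTime M ham) (hI : PolyTime M (fun x => (I x).size) e I)
    (hp : PolyTime M (fun x => (I x).size) e p) (hq : PolyTime M (fun x => (I x).size) e q) :
    PolyTime M (fun x => (I x).size) e
      (fun x => bestTour (I x).edges (I x).r (ham (I x)) (p x) (q x)) := by
  refine option_cases (g := fun _ o => o.elim [] id) (pick (R := fun _ l l' => wt l ≤ wt l')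
    (l := fun x => (List.ofFn (I x).r).flatMap fun a => (List.ofFn (I x).r).map fun b =>
      GroupSteiner.tour (I x).edges (I x).r (ham (I x)) (p x) (q x) a b)
    (flatMap (f := fun x a => (List.ofFn (I x).r).map fun b =>
      GroupSteiner.tour (I x).edges (I x).r (ham (I x)) (p x) (q x) a b) hI.requiredList
      ((bdd_k I).mono fun x => by simp) ?_) ?_ ?_)
    (fun _ _ _ _ _ => nil) (fun _ _ _ _ _ _ hl => hl)
  · intro Y φ e' a _ he ha
    have hk := bdd_k fun y => I (φ y)
    refine ⟨map (f := fun y b => GroupSteiner.tour (I (φ y)).edges (I (φ y)).r (ham (I (φ y)))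
      (p (φ y)) (q (φ y)) (a y) b) (hI.lift he).requiredList (hk.mono fun y => by simp) ?_,
      hk.mono fun y => by simp⟩
    intro Z ψ e'' b _ he' hb
    exact tour (I := fun z => I (φ (ψ z))) hham ((hI.lift he).lift he') ((hp.lift he).lift he')
      ((hq.lift he).lift he') (ha.lift he') hb
  · exact ((bdd_k I).mul (bdd_k I)).mono fun x =>
      (length_flatMap_le _ _ (I x).k fun a _ => by simp).trans (by simp)
  · intro Y φ e' l l' hl hl' he h h'
    have key (c : ∀ y, List (WEdge (Fin (I (φ y)).n))) (hc : ∀ y, c y ∈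
        (List.ofFn (I (φ y)).r).flatMap fun a => (List.ofFn (I (φ y)).r).map fun b =>
          GroupSteiner.tour (I (φ y)).edges (I (φ y)).r (ham (I (φ y))) (p (φ y)) (q (φ y)) a b) :
        (∀ y, c y ⊆ (I (φ y)).edges) ∧
        PolyBdd (fun y => (I (φ y)).size) fun y => (c y).length := by
      refine ⟨fun y => ?_, (bdd_tour fun y => I (φ y)).mono fun y => ?_⟩ <;>
        obtain ⟨a, -, h⟩ := List.mem_flatMap.1 (hc y) <;>
        obtain ⟨b, -, h⟩ := List.mem_map.1 h <;> rw [← h]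
      · exact expandSeq_subset (I (φ y)).isEdgeList (I (φ y)).connected _ _
      · exact length_tour_le hham _ _ _ _ _
    obtain ⟨h1, h2⟩ := key l hl
    obtain ⟨h3, h4⟩ := key l' hl'
    exact nnreal_le (weight (I := fun y => I (φ y)) h1 h2 h) (weight (I := fun y => I (φ y)) h3 h4 h')
      (bits_wt (I := fun y => I (φ y)) h1 h2) (bits_wt (I := fun y => I (φ y)) h3 h4)

theorem pathTree (hI : PolyTime M (fun x => (I x).size) e I)
    (hp : PolyTime M (fun x => (I x).size) e p) :
    PolyTime M (fun x => (I x).size) e (fun x => pathTree (I x).edges (p x)) := by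
  refine flatMap (f := fun x u => (GroupSteiner.shortestPath (I x).edges u (p x)).head?.toList)
    hI.vertices ((bdd_n I).mono fun x => by simp) ?_
  intro Y φ e' u _ he hu
  refine ⟨option_cases (g := fun _ o => o.toList)
    (shortestPath (I := fun y => I (φ y)) (hI.lift he) hu (hp.lift he)).head?
    (fun _ _ _ _ _ => nil) (fun _ _ _ _ _ _ ha => ha.cons nil),
    (PolyBdd.const 1).mono fun y => ?_⟩
  cases (GroupSteiner.shortestPath (I (φ y)).edges (u y) (p (φ y))).head? <;> simp

theorem spannerEdges (hham : HamPolyTime M ham) (hI : PolyTime M (fun x => (I x).size) e I) :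
    PolyTime M (fun x => (I x).size) e
      (fun x => spannerEdges (I x).edges (I x).r (I x).ε (ham (I x))) := by
  refine flatMap (f := fun x p => GroupSteiner.pathTree (I x).edges p ++
    (GroupSteiner.marks (I x).edges (I x).ε (List.ofFn (I x).r)).flatMap fun q =>
      GroupSteiner.sparsify (GroupSteiner.bestTour (I x).edges (I x).r (ham (I x)) p q))
    (marks hI) (bdd_marks I) ?_
  intro Y φ e' p _ he hp
  have hI := hI.lift he
  have hn := bdd_n fun y => I (φ y)
  have hm := bdd_marks fun y => I (φ y)
  have htree : PolyBdd (fun y => (I (φ y)).size) fun y =>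
      (GroupSteiner.pathTree (I (φ y)).edges (p y)).length :=
    hn.mono fun y => length_pathTree_le _ _
  refine ⟨append (pathTree (I := fun y => I (φ y)) hI hp)
    (flatMap (f := fun y q => GroupSteiner.sparsify (GroupSteiner.bestTour (I (φ y)).edges
      (I (φ y)).r (ham (I (φ y))) (p y) q)) (marks (I := fun y => I (φ y)) hI) hm ?_) htree,
    (htree.add (hm.mul ((PolyBdd.const 2).mul hn))).mono fun y => ?_⟩
  · intro Z ψ e'' q _ he' hq
    refine ⟨sparsify (I := fun z => I (φ (ψ z))) (hI.lift he')
      (bestTour (I := fun z => I (φ (ψ z))) hham (hI.lift he') (hp.lift he') hq)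
      ((bdd_tour fun z => I (φ (ψ z))).mono fun z => ?_),
      ((PolyBdd.const 2).mul (bdd_n fun z => I (φ (ψ z)))).mono fun z => by
        simpa using length_sparsify_le (V := Fin (I (φ (ψ z))).n) _⟩
    obtain ⟨⟨a, b, h⟩, -⟩ := bestTour_spec (E := (I (φ (ψ z))).edges) (r := (I (φ (ψ z))).r)
      (ham := ham (I (φ (ψ z)))) (I (φ (ψ z))).one_le_k (p (ψ z)) (q z)
    rw [h]
    exact length_tour_le hham _ _ _ _ _
  · rw [List.length_append]
    exact Nat.add_le_add_left (length_flatMap_le _ _ _ fun q _ => by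
      simpa using length_sparsify_le (V := Fin (I (φ y)).n) _) _

theorem spannerList (hham : HamPolyTime M ham) (hI : PolyTime M (fun x => (I x).size) e I) :
    PolyTime M (fun x => (I x).size) e
      (fun x => spannerList (I x).edges (I x).r (I x).ε (ham (I x))) := by
  have hn := bdd_n I
  have hm := bdd_marks I
  refine map (f := fun _ e => (e.1, e.2.1)) (spannerEdges hham hI)
    ((hm.mul (hn.add (hm.mul ((PolyBdd.const 2).mul hn)))).mono fun x =>
      length_spannerEdges_le _) ?_
  intro Y φ e' a _ _ ha
  exact ha.fst.pair ha.snd.fst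

end PolyTime

/-! ## The Hamiltonian path instances -/

namespace SpannerInput

variable {M : NumModel}

/-- The weights of an instance of the Hamiltonian path problem: distances of points. -/
noncomputable def hamWeight (I : SpannerInput M) (a b : Fin I.n) : Sym2 (Fin (I.k + 2)) → ℝ≥0 :=
  Sym2.lift ⟨fun i j => pathDist I.edges (hamPoints I.r a b i) (hamPoints I.r a b j),
    fun _ _ => pathDist_comm I.isEdgeList I.connected _ _⟩

theorem hamWeight_mk (I : SpannerInput M) (a b : Fin I.n) (i j : Fin (I.k + 2)) :
    I.hamWeight a b s(i, j) = pathDist I.edges (hamPoints I.r a b i) (hamPoints I.r a b j) := rfl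

theorem pathDist_mem_numbers (I : SpannerInput M) (u v : Fin I.n) :
    (pathDist I.edges u v : ℝ) ∈ M.numbers :=
  (I.bits_wt_le (shortestPath_subset I.isEdgeList I.connected u v)).1

theorem bits_pathDist_le (I : SpannerInput M) (u v : Fin I.n) :
    M.bits (pathDist I.edges u v) ≤ I.size * (2 * I.size + 1) + 2 :=
  (I.bits_wt_le (shortestPath_subset I.isEdgeList I.connected u v)).2.trans <| by
    gcongr
    exact (length_shortestPath_le I.isEdgeList I.connected u v).trans I.n_le_size

theorem isMetricWeight_hamWeight (I : SpannerInput M) (a b : Fin I.n) :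
    IsMetricWeight (I.hamWeight a b) :=
  fun _ _ _ _ _ _ => pathDist_triangle I.isEdgeList I.connected _ _ _

theorem admissible_hamWeight (I : SpannerInput M) (a b : Fin I.n) :
    AdmissibleWeights M ⊤ (I.hamWeight a b) := by
  intro e _
  refine Sym2.ind (fun i j => ?_) e
  exact I.pathDist_mem_numbers _ _

end SpannerInput

/-- This rewrites the matrix as an encoded list of lists of pairs of numbers, for an arbitrary
decidability instance, so that the combinators for lists apply to it. -/
theorem encodeGraph_eq {m : ℕ} (H : SimpleGraph (Fin m)) [DecidableRel H.Adj]
    (w : Sym2 (Fin m) → ℝ≥0) :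
    encodeGraph H w = enc (List.ofFn fun i => List.ofFn fun j =>
      if H.Adj i j then ((1 : ℝ≥0), w s(i, j)) else (0, 0)) := by
  have h (i j : Fin m) : enc (if H.Adj i j then ((1 : ℝ≥0), w s(i, j)) else (0, 0)) =
      if H.Adj i j then Val.pair (.num 1) (.num (w s(i, j))) else .pair (.num 0) (.num 0) := by
    split_ifs <;> simp [enc]
  rw [encodeGraph]
  simp only [enc] at h ⊢
  simp only [List.map_ofFn, Function.comp_def, h]
  congr!

namespace PolyTime

variable {M : NumModel} {X : Type} {e : X → Val} {I : X → SpannerInput M}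

theorem hamInput {a b : ∀ x, Fin (I x).n} (hI : PolyTime M (fun x => (I x).size) e I)
    (ha : PolyTime M (fun x => (I x).size) e a) (hb : PolyTime M (fun x => (I x).size) e b) :
    PolyTime M (fun x => (I x).size) e
      (fun x => encodeHamInput ((I x).hamWeight (a x) (b x)) 0 1) := by
  have hk := (bdd_k I).add (.const 2)
  have hT := (hamPoints hI ha hb).table
  have hlen : PolyBdd (fun x => (I x).size) fun x => ((List.finRange ((I x).k + 2)).map
      fun i => (i, GroupSteiner.hamPoints (I x).r (a x) (b x) i)).length := hk.mono fun x => by simp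
  have hM := map (B := fun _ => List (ℝ≥0 × ℝ≥0)) (f := fun x p => ((List.finRange ((I x).k + 2)).map
      fun i => (i, GroupSteiner.hamPoints (I x).r (a x) (b x) i)).map fun p' =>
        if p.1 = p'.1 then ((0 : ℝ≥0), (0 : ℝ≥0))
          else (1, GroupSteiner.pathDist (I x).edges p.2 p'.2)) hT hlen
    (fun Y φ e' p _ he hp => map (B := fun _ => ℝ≥0 × ℝ≥0) (hT.lift he) (hlen.reindex φ)
      fun Z ψ e'' p' _ he' hp' => ite (fin_eq ((hk.reindex φ).reindex ψ) (hp.lift he').fst hp'.fst)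
        (zero_nnreal.pair zero_nnreal) (one_nnreal.pair
          (pathDist (I := fun z => I (φ (ψ z))) ((hI.lift he).lift he') (hp.lift he').snd hp'.snd)))
  refine (hM.pair ((nat_const 0).pair (nat_const 1))).congr_enc fun x => ?_
  have h1 : encodeHamInput ((I x).hamWeight (a x) (b x)) 0 1 =
      .pair (encodeGraph ⊤ ((I x).hamWeight (a x) (b x))) (enc ((0 : ℕ), (1 : ℕ))) := by
    simp [encodeHamInput, enc, encodeVertex]
  rw [h1, encodeGraph_eq]
  change Val.pair (enc _) _ = Val.pair _ _
  congr 2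
  simp only [List.map_map, List.ofFn_eq_map, Function.comp_def]
  refine List.map_congr_left fun i _ => List.map_congr_left fun j _ => ?_
  by_cases hij : i = j
  · simp [hij]
  · simp [hij, SpannerInput.hamWeight_mk]

/-- The assumed program runs in time polynomial in its own input. That input has `(k + 2) ^ 2`
entries of polynomial bit length, so the time is polynomial in the size of the spanner input too. -/
theorem bdd_size_hamInput (a b : ∀ x, Fin (I x).n) : PolyBdd (fun x => (I x).size)
    fun x => (encodeHamInput ((I x).hamWeight (a x) (b x)) 0 1).size M := by
  have hk := (bdd_k I).add (.const 2)
  have hs : PolyBdd (fun x => (I x).size) (fun x => (I x).size) := .self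
  have hB : PolyBdd (fun x => (I x).size) fun x =>
      (I x).size * (2 * (I x).size + 1) + 2 + (3 + 2 * M.bits 0 + M.bits 1) :=
    ((hs.mul (((PolyBdd.const 2).mul hs).add (.const 1))).add (.const 2)).add (.const _)
  have hrow := ((PolyBdd.const (1 + M.bits 0)).add (hk.mul ((PolyBdd.const 1).add hB)))
  have hmat := ((PolyBdd.const (1 + M.bits 0)).add (hk.mul ((PolyBdd.const 1).add hrow)))
  refine (hmat.add (.const (4 + M.bits 0 + M.bits 1))).mono fun x => ?_
  have h : (encodeGraph ⊤ ((I x).hamWeight (a x) (b x))).size M ≤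
      1 + M.bits 0 + ((I x).k + 2) * (1 + (1 + M.bits 0 + ((I x).k + 2) * (1 +
      ((I x).size * (2 * (I x).size + 1) + 2 + (3 + 2 * M.bits 0 + M.bits 1))))) := by
    refine (size_ofList_le M (B := 1 + M.bits 0 + ((I x).k + 2) * (1 +
      ((I x).size * (2 * (I x).size + 1) + 2 + (3 + 2 * M.bits 0 + M.bits 1)))) ?_).trans (by rw [List.length_ofFn])
    intro v hv
    obtain ⟨i, rfl⟩ := (List.mem_ofFn' _ _).1 hv
    refine (size_ofList_le M
      (B := (I x).size * (2 * (I x).size + 1) + 2 + (3 + 2 * M.bits 0 + M.bits 1)) ?_).trans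
        (by rw [List.length_ofFn])
    intro v hv
    obtain ⟨j, rfl⟩ := (List.mem_ofFn' _ _).1 hv
    have := (I x).bits_pathDist_le (GroupSteiner.hamPoints (I x).r (a x) (b x) i)
      (GroupSteiner.hamPoints (I x).r (a x) (b x) j)
    dsimp only
    split_ifs
    · simp only [Val.size, SpannerInput.hamWeight_mk]; omega
    · simp only [Val.size]; omega
  simp only [encodeHamInput, Val.size, encodeVertex, Fin.val_zero, Fin.val_one, Nat.cast_zero,
    Nat.cast_one]
  omega

end PolyTime

/-- Polynomial-time approximation of Hamiltonian paths, for the instances that the spanner algorithm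
needs. -/
theorem HasPolyTimeHamPathApprox.exists_ham {M : NumModel} {γ : ℝ}
    (h : HasPolyTimeHamPathApprox M γ) :
    ∃ ham : ∀ I : SpannerInput M, Fin I.n → Fin I.n → List (Fin (I.k + 2)),
      PolyTime.HamPolyTime M ham ∧ ∀ I, IsHamApprox I.edges I.r γ (ham I) := by
  obtain ⟨P, τ, hP⟩ := h
  -- A path is chosen for every instance, but the program `P` comes before the choice and computes
  -- all of them.
  choose π hcomp hham hopt using fun (I : SpannerInput M) (a b : Fin I.n) =>
    hP (I.k + 2) (I.hamWeight a b) 0 1 (by simp) (I.isMetricWeight_hamWeight a b)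
      (I.admissible_hamWeight a b)
  refine ⟨fun I a b => (π I a b).support, ⟨fun I a b => ?_, fun {X e I a b} hI ha hb => ?_⟩,
    fun I a b => ⟨I.hamWeight a b, fun i j => rfl, π I a b, rfl, hham I a b, hopt I a b⟩⟩
  · have := (hham I a b).length_support
    rw [Fintype.card_fin] at this
    exact this.le
  · refine (PolyTime.hamInput hI ha hb).comp (B := fun x => List (Fin ((I x).k + 2)))
      ⟨P, _, (PolyTime.bdd_size_hamInput a b).eval τ, fun x => ?_⟩
    obtain ⟨t, ht, hle⟩ := hcomp (I x) (a x) (b x)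
    exact ⟨t, hle, ht⟩

/-! ## Reading the input -/

open Classical in
-- The bridge from the prescribed encoding to the internal one: the adjacency matrix is scanned row
-- by row and turned into the list of oriented edges.
theorem PolyTime.input {M : NumModel} :
    PolyTime M SpannerInput.size
      (fun I : SpannerInput M => encodeSpannerInput I.G I.w I.r I.ε) (fun I => I) := by
  have hn : PolyBdd SpannerInput.size (fun I : SpannerInput M => I.n) := bdd_n fun I => I
  have hk : PolyBdd SpannerInput.size (fun I : SpannerInput M => I.k) := bdd_k fun I => I
  have hin : PolyTime M SpannerInput.size
      (fun I : SpannerInput M => encodeSpannerInput I.G I.w I.r I.ε)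
      (fun I => ((List.ofFn fun i => List.ofFn fun j =>
        if I.G.Adj i j then ((1 : ℝ≥0), I.w s(i, j)) else (0, 0)), List.ofFn I.r, I.ε)) :=
    env.congr_enc fun I => by
      change encodeSpannerInput I.G I.w I.r I.ε = .pair (enc _) (.pair (enc _) (enc _))
      rw [← encodeGraph_eq]
      rfl
  have hrows := of_ofFn hn hin.fst
  have hE : PolyTime M SpannerInput.size
      (fun I : SpannerInput M => encodeSpannerInput I.G I.w I.r I.ε) (fun I => I.edges) := by
    refine (flatMap (B := fun I => WEdge (Fin I.n)) (f := fun I p => (List.finRange I.n).flatMap fun j =>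
      if I.G.Adj p.1 j then [(p.1, j, I.w s(p.1, j))] else []) hrows.table
      (hn.mono fun I => by simp) ?_).congr fun I => ?_
    · intro Y φ e' p hp he hp'
      have hrow : PolyTime M (fun y => (φ y).size) e' (fun y => List.ofFn fun j =>
          if (φ y).G.Adj (p y).1 j then ((1 : ℝ≥0), (φ y).w s((p y).1, j)) else (0, 0)) :=
        hp'.snd.congr fun y => by
          obtain ⟨i, -, hi⟩ := List.mem_map.1 (hp y)
          rw [← hi]
      refine ⟨(flatMap (B := fun y => WEdge (Fin (φ y).n)) (f := fun y q =>
        if (φ y).G.Adj (p y).1 q.1 then [((p y).1, q.1, (φ y).w s((p y).1, q.1))] else [])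
        (of_ofFn (hn.reindex φ) hrow).table ((hn.reindex φ).mono fun y => by simp) ?_).congr
        fun y => by rw [List.flatMap_map], (hn.reindex φ).mono fun y => ?_⟩
      · intro Z ψ e'' q hq he' hq'
        have hq2 (z) : (q z).2 = if (φ (ψ z)).G.Adj (p (ψ z)).1 (q z).1 then
            ((1 : ℝ≥0), (φ (ψ z)).w s((p (ψ z)).1, (q z).1)) else (0, 0) := by
          obtain ⟨i, -, hi⟩ := List.mem_map.1 (hq z)
          rw [← hi]
        -- The flag of an entry is 0 or 1, so adjacency is decided by comparing it with 1.
        refine ⟨(ite (p := fun z => 1 ≤ (q z).2.1) (nnreal_le one_nnreal hq'.snd.fst (.const _)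
          ((PolyBdd.const (M.bits 0 + M.bits 1)).mono fun z => ?_))
          (((hp'.lift he').fst.pair (hq'.fst.pair hq'.snd.snd)).cons nil) nil).congr fun z => ?_,
          (PolyBdd.const 1).mono fun z => ?_⟩
        · rw [hq2]; split_ifs <;> simp
        · rw [hq2]; split_ifs <;> simp_all
        · split_ifs <;> simp
      · exact (length_flatMap_le _ _ 1 fun j _ => by split_ifs <;> simp).trans (by simp)
    · rw [List.flatMap_map]; rfl
  exact (hE.pair ((hrows.finRange hn).pair ((of_ofFn hk hin.snd.fst).pair hin.snd.snd))).congr_enc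
    fun _ => rfl

end GroupSteiner

/-! ### The main theorem. -/

theorem mainTheorem9 :
    ∃ C : ℝ, ∀ (M : GroupSteiner.NumModel) (γ : ℝ), 1 ≤ γ →
      GroupSteiner.HasPolyTimeHamPathApprox M γ →
      ∃ (P : GroupSteiner.Prog) (τ : Polynomial ℕ),
        ∀ (n k : ℕ) (G : SimpleGraph (Fin n)) (w : Sym2 (Fin n) → NNReal) (r : Fin k → Fin n)
          (ε : ℝ),
          G.Connected → 1 ≤ k → 0 < ε → ε < 1 →
          GroupSteiner.AdmissibleWeights M G w → ε ∈ M.numbers →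
          ∃ edges : List (Fin n × Fin n),
            GroupSteiner.ComputesInTime M P τ (GroupSteiner.encodeSpannerInput G w r ε)
              (GroupSteiner.encodeEdges edges) ∧
            GroupSteiner.IsGroupSteinerSpanner G w (fun i : Fin k => ({r i} : Set (Fin n))) (γ + ε)
              (GroupSteiner.graphOfEdges edges) ∧
            ((GroupSteiner.graphOfEdges edges).edgeSet.ncard : ℝ) ≤ C * n / ε ^ 2 := by
  refine ⟨55, fun M γ hγ h => ?_⟩
  obtain ⟨ham, hpoly, happrox⟩ := h.exists_ham
  obtain ⟨P, T, ⟨τ, hτ⟩, hP⟩ := GroupSteiner.PolyTime.spannerList hpoly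
    (GroupSteiner.PolyTime.input (M := M))
  refine ⟨P, τ, fun n k G w r ε hG hk h0 h1 hw hε => ?_⟩
  lift ε to ℝ≥0 using h0.le
  have h0 : 0 < ε := h0
  have h1 : ε < 1 := h1
  let I : GroupSteiner.SpannerInput M := ⟨n, k, G, w, r, ε, hG, hk, hw, hε⟩
  refine ⟨GroupSteiner.spannerList I.edges r ε (ham I), ?_, ?_, ?_⟩
  · obtain ⟨t, ht, hE⟩ := hP I
    exact ⟨t, hE, ht.trans (hτ I)⟩
  · exact GroupSteiner.isGroupSteinerSpanner_spannerList I.isEdgeList hG hk hγ (happrox I)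
  · exact GroupSteiner.ncard_spannerList_le I.edges r h0 h1.le (ham I)
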